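/- **Setting.** Let the action set be $[0,1]$ with metric $|a-a'|$ and Lebesgue measure $\nu$, let $\mathcal X$ be a set of contexts, let $\Pi$ be a finite class of policies $\pi:\mathcal X\to[0,1]$ with $|\Pi|\ge 2$, and let $\mathcal D$ be a distribution over pairs $(x,\ell)$ of a context $x$ and a loss function $\ell:[0,1]\to[0,1]$. Let $L\ge 1$ and assume that for every context $x$ the expected loss $a\mapsto\lambda(a\mid x)=\mathbb E[\ell(a)\mid x]$ is $L$-Lipschitz. In each round $t=1,\dots,T$ a pair $(x_t,\ell_t)\sim\mathcal D$ is drawn independently of the past, the learner observes $x_t$, chooses $a_t\in[0,1]$ and observes only $\ell_t(a_t)$. With $\lambda_0(\pi)=\mathbb E_{(x,\ell)\sim\mathcal D}[\ell(\pi(x))]$, the regret against the unsmoothed class is $$\mathrm{Regret}(T,\Pi)=\mathbb E\Big[\sum_{t=1}^T\ell_t(a_t)\Big]-T\min_{\pi\in\Pi}\lambda_0(\pi).$$ For $h>0$ let $B_h(a)=[a-h,a+h]\cap[0,1]$, and let $\mathrm{Smooth}_{\pi,h}(\cdot\mid x)=\mathbf 1\{\cdot\in B_h(\pi(x))\}/\nu(B_h(\pi(x)))$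 be the density of the uniform distribution $\mathrm{Smooth}_h(\pi(x))$ on $B_h(\pi(x))$. **Algorithm.** SmoothPolicyElimination.L with parameter $L$ knows $T$, $\Pi$ and the marginal distribution of $x$. It sets $\Pi^{(1)}=\Pi$ and $\delta_T=5\lceil\log(T|\Pi|\log_2 T)\rceil$ and proceeds in epochs $m=1,2,\dots$, until $T$ rounds are over, with $h_m=2^{-m}$, $r_m=L2^{-m}$, $\mu_m=\min\{1/2,r_m\}$, $V_m=\mathbb E_x\,\nu\big(\bigcup_{\pi\in\Pi^{(m)}}B_{h_m}(\pi(x))\big)$, $\tilde n_m=\lceil 320V_m/(r_m^2h_m)\rceil$. Before epoch $m$ it finds a distribution $Q_m$ over $\Pi^{(m)}$ that minimizes $$\max_{\pi\in\Pi^{(m)}}\mathbb E_x\,\mathbb E_{a\sim\mathrm{Smooth}_{h_m}(\pi(x))}\Big[\frac1{q_m(a\mid x)}\Big],\qquad q_m(a\mid x)=\mu_m+(1-\mu_m)\,\mathbb E_{\pi\sim Q_m}\mathrm{Smooth}_{\pi,h_m}(a\mid x)$$ (ties may be broken in any way). In each of the $\tilde n_m\delta_T$ rounds of the epoch it draws $a_t$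 from the density $q_m(\cdot\mid x_t)$. After the epoch it splits these rounds into $\delta_T$ consecutive batches of size $\tilde n_m$, lets $\hat L_m(\pi)$ be the median over the batches of the batch means of $\mathrm{Smooth}_{\pi,h_m}(a_t\mid x_t)\,\ell_t(a_t)/q_m(a_t\mid x_t)$, and sets $\Pi^{(m+1)}=\{\pi\in\Pi^{(m)}:\hat L_m(\pi)\le\min_{\pi'\in\Pi^{(m)}}\hat L_m(\pi')+3r_m\}$. **Claim.** SmoothPolicyElimination.L with parameter $L$ achieves $\mathrm{Regret}(T,\Pi)\le\tilde O\big(T^{2/3}(L\log|\Pi|)^{1/3}\big)$; precisely, there are absolute constants $C$ and $p$ such that in every such setting and for every $T\ge2$ $$\mathrm{Regret}(T,\Pi)\le C(\log T)^p\;T^{2/3}(L\log|\Pi|)^{1/3}.$$ Moreover $\psi_L(\epsilon_0)=O(\epsilon_0^{-2})$: for every $0<\epsilon_0\le1$ one has $\psi_L(\epsilon_0)\le C\epsilon_0^{-2}$, where $\psi_L(\epsilon_0)=\sup_{\epsilon\ge\epsilon_0}M_0(12L\epsilon,\epsilon)/\epsilon$ is the policy zooming coefficient, $M_0(\epsilon,\delta)=\mathbb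 E_x\big[\mathcal N_\delta(\{\pi(x):\pi\in\Pi,\ \lambda_0(\pi)\le\min_{\Pi}\lambda_0+\epsilon\})\big]$, and $\mathcal N_\delta(S)$ is the largest size of a subset of $S$ any two distinct points of which are at distance at least $\delta$. -/

import Mathlib

open MeasureTheory ProbabilityTheory Set
open scoped unitInterval ENNReal

universe u v w

namespace SmoothPE

noncomputable section

/-! ### Smoothing on the action space `[0,1]`

Actions are elements of `I = [0,1]` with the metric `|a - a'|`; `volume` on `I` is Lebesgue
measure (the uniform distribution on `[0,1]`). -/

/-- The density, with respect to Lebesgue measure on `[0,1]`, of the uniform distribution on the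
closed ball `[a - h, a + h] ∩ [0,1]`, evaluated at `a'`. -/
def smoothDensity (h : ℝ) (a a' : I) : ℝ :=
  if dist a' a ≤ h then (volume.real (Metric.closedBall a h))⁻¹ else 0

lemma measurable_smoothDensity (h : ℝ) :
    Measurable fun p : I × I => smoothDensity h p.1 p.2 := by
  have hset : MeasurableSet {p : I × I | dist p.2 p.1 ≤ h} :=
    (isClosed_le (by fun_prop) continuous_const).measurableSet
  have hvol : Measurable fun a : I => volume.real (Metric.closedBall a h) :=
    (measurable_measure_prodMk_left (ν := (volume : Measure I)) hset).ennreal_toReal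
  exact Measurable.ite hset (hvol.comp measurable_fst).inv measurable_const

/-! ### Median of finitely many reals -/

/-- The median of `k` reals: the average of the two middle entries of the sorted list (which
coincide when `k` is odd). -/
def median {k : ℕ} (v : Fin k → ℝ) : ℝ :=
  if hk : 0 < k then
    ((v ∘ Tuple.sort v) ⟨(k - 1) / 2, by omega⟩ + (v ∘ Tuple.sort v) ⟨k / 2, by omega⟩) / 2
  else 0

lemma measurable_orderStat {k : ℕ} (j : Fin k) :
    Measurable fun v : Fin k → ℝ => (v ∘ Tuple.sort v) j := by
  classical
  refine measurable_of_Iic fun c => ?_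
  have hEq : (fun v : Fin k → ℝ => (v ∘ Tuple.sort v) j) ⁻¹' Set.Iic c =
      (fun v : Fin k → ℝ => ∑ i, if v i ≤ c then (1 : ℕ) else 0) ⁻¹' Set.Ioi (j : ℕ) := by
    ext v
    have h1 := Tuple.lt_card_le_iff_apply_le_of_monotone (f := v ∘ Tuple.sort v) (j := j)
      (a := c) (Tuple.monotone_sort v)
    simp only [Set.mem_preimage, Set.mem_Iic, Set.mem_Ioi]
    rw [← h1, Finset.card_filter]
    simp only [Function.comp_apply]
    rw [Equiv.sum_comp (Tuple.sort v) (fun i => if v i ≤ c then (1 : ℕ) else 0)]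
  rw [hEq]
  refine (Finset.measurable_sum _ fun i _ => ?_) measurableSet_Ioi
  exact Measurable.ite (measurableSet_le (measurable_pi_apply i) measurable_const)
    measurable_const measurable_const

lemma measurable_median {k : ℕ} : Measurable (median : (Fin k → ℝ) → ℝ) := by
  unfold median
  split_ifs with hk
  · exact ((measurable_orderStat _).add (measurable_orderStat _)).div_const 2
  · exact measurable_const

/-! ### Parameters of epoch `m` (epochs are numbered from `1`) -/

/-- The bandwidth `h_m = 2^{-m}`. -/
def bandwidth (m : ℕ) : ℝ := (1 / 2) ^ m

/-- The radius `r_m = L 2^{-m}`. -/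
def radius (L : ℝ) (m : ℕ) : ℝ := L * (1 / 2) ^ m

/-- The exploration probability `μ_m = min (1/2, r_m)`. -/
def explore (L : ℝ) (m : ℕ) : ℝ := min (1 / 2) (radius L m)

/-- The number of batches `δ_T = 5 ⌈log (T |Π| log₂ T)⌉`, where `N = |Π|`. -/
def numBatches (T N : ℕ) : ℕ := 5 * ⌈Real.log (T * N * Real.logb 2 T)⌉₊

section Algorithm

variable {𝓧 : Type u} [MeasurableSpace 𝓧] {ι : Type w} [Fintype ι]

/-- The characteristic volume of the set `A` of policies in epoch `m`: the mean, over a context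
`x`, of the Lebesgue measure of the union of the balls of radius `h_m` around `π i x`, `i ∈ A`. -/
def charVolume (ctx : Measure 𝓧) (π : ι → 𝓧 → I) (m : ℕ) (A : Finset ι) : ℝ :=
  ∫ x, volume.real (⋃ i ∈ A, Metric.closedBall (π i x) (bandwidth m)) ∂ctx

/-- The batch size `320 V_m / (r_m² h_m)`, rounded up to an integer. -/
def batchSize (ctx : Measure 𝓧) (π : ι → 𝓧 → I) (L : ℝ) (m : ℕ) (A : Finset ι) : ℕ :=
  ⌈320 * charVolume ctx π m A / (radius L m ^ 2 * bandwidth m)⌉₊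

/-- The density of the action distribution in epoch `m`:
`q_m(a | x) = μ_m + (1 - μ_m) 𝔼_{i ∼ Q} Smooth_{π i, h_m}(a | x)`. -/
def actionDensity (π : ι → 𝓧 → I) (L : ℝ) (m : ℕ) (Q : ι → ℝ) (x : 𝓧) (a : I) : ℝ :=
  explore L m + (1 - explore L m) * ∑ i, Q i * smoothDensity (bandwidth m) (π i x) a

/-- Probability distributions over the set `A` of policies. -/
def simplexOn (A : Finset ι) : Set (ι → ℝ) :=
  {Q | (∀ i, 0 ≤ Q i) ∧ (∀ i, i ∉ A → Q i = 0) ∧ ∑ i, Q i = 1}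

/-- The objective minimized over `Q` in epoch `m`:
`max_{i ∈ A} 𝔼_x 𝔼_{a ∼ Smooth_{h_m}(π i x)} [1 / q_m(a | x)]`. -/
def objective (ctx : Measure 𝓧) (π : ι → 𝓧 → I) (L : ℝ) (m : ℕ) (A : Finset ι)
    (Q : ι → ℝ) : ℝ :=
  ⨆ i : A, ∫ x, (∫ a : I,
    smoothDensity (bandwidth m) (π i x) a * (actionDensity π L m Q x a)⁻¹) ∂ctx

/-- `Q m A` is the distribution over the set `A` of policies that the algorithm uses in epoch `m`
when the surviving set is `A`. It has to be a minimizer of the objective; how ties between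
minimizers are broken is left open. -/
def IsOptimalSelection (ctx : Measure 𝓧) (π : ι → 𝓧 → I) (L : ℝ)
    (Q : ℕ → Finset ι → ι → ℝ) : Prop :=
  ∀ m, 1 ≤ m → ∀ A : Finset ι, A.Nonempty →
    Q m A ∈ simplexOn A ∧ IsMinOn (objective ctx π L m A) (simplexOn A) (Q m A)

/-- What the learner sees in one round: the context, its own action, and the loss of that
action. -/
abbrev Obs (𝓧 : Type u) : Type u := 𝓧 × I × I

/-- The importance-weighted estimate of the smoothed loss of policy `i` from one observation. -/
def ipsLoss (π : ι → 𝓧 → I) (L : ℝ) (m : ℕ) (Q : ι → ℝ) (i : ι) (o : Obs 𝓧) : ℝ :=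
  smoothDensity (bandwidth m) (π i o.1) o.2.1 * (o.2.2 : ℝ) / actionDensity π L m Q o.1 o.2.1

/-- The mean of the estimates for policy `i` over the `b`-th batch (`b = 0, 1, …`), of size `n`,
of an epoch that started in round `s`. -/
def batchMean (π : ι → 𝓧 → I) (L : ℝ) (m : ℕ) (Q : ι → ℝ) (n s b : ℕ) (i : ι) {t : ℕ}
    (o : Fin t → Obs 𝓧) : ℝ :=
  (∑ j : Fin t, if s + b * n ≤ (j : ℕ) ∧ (j : ℕ) < s + (b + 1) * n
    then ipsLoss π L m Q i (o j) else 0) / n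

/-- The median-of-means estimate of the loss of policy `i` from the data of epoch `m`, which
started in round `s` with the set `A` of surviving policies. -/
def lossEstimate (ctx : Measure 𝓧) (π : ι → 𝓧 → I) (L : ℝ) (T : ℕ)
    (Q : ℕ → Finset ι → ι → ℝ) (m s : ℕ) (A : Finset ι) (i : ι) {t : ℕ}
    (o : Fin t → Obs 𝓧) : ℝ :=
  median fun b : Fin (numBatches T (Fintype.card ι)) =>
    batchMean π L m (Q m A) (batchSize ctx π L m A) s b i o

/-- The state of the algorithm: the current epoch, the round in which it started (rounds are
numbered from `0`), and the set of surviving policies. -/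
@[ext] structure State (ι : Type w) where
  epoch : ℕ
  start : ℕ
  active : Finset ι

/-- The state space is countable and carries the discrete `σ`-algebra. -/
instance : MeasurableSpace (State ι) := ⊤

instance : MeasurableSingletonClass (State ι) := ⟨fun _ => trivial⟩

instance : Countable (State ι) :=
  Function.Injective.countable (f := fun s : State ι => (s.epoch, s.start, s.active))
    fun s s' h => by
      simp only [Prod.mk.injEq] at h
      exact State.ext h.1 h.2.1 h.2.2

/-- Policy `i` survives epoch `m`: its estimated loss exceeds the smallest estimated loss of a
policy in `A` by at most `3 r_m`. -/
def Survives (ctx : Measure 𝓧) (π : ι → 𝓧 → I) (L : ℝ) (T : ℕ)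
    (Q : ℕ → Finset ι → ι → ℝ) (m s : ℕ) (A : Finset ι) {t : ℕ} (o : Fin t → Obs 𝓧)
    (i : ι) : Prop :=
  ∀ i' ∈ A, lossEstimate ctx π L T Q m s A i o ≤
    lossEstimate ctx π L T Q m s A i' o + 3 * radius L m

open Classical in
/-- The state after `t` rounds, given that it was `st` before the last of them: when the epoch
has lasted `n_m = ñ_m δ_T` rounds, the policies that do not survive are eliminated, and the next
epoch begins. -/
def nextState (ctx : Measure 𝓧) (π : ι → 𝓧 → I) (L : ℝ) (T : ℕ)
    (Q : ℕ → Finset ι → ι → ℝ) {t : ℕ} (o : Fin t → Obs 𝓧) (st : State ι) : State ι :=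
  if st.start + batchSize ctx π L st.epoch st.active * numBatches T (Fintype.card ι) ≤ t then
    { epoch := st.epoch + 1
      start := t
      active := st.active.filter fun i =>
        Survives ctx π L T Q st.epoch st.start st.active o i }
  else st

/-- The state of the algorithm before round `t`, as a function of the observations made in the
rounds `0, …, t - 1`. -/
def state (ctx : Measure 𝓧) (π : ι → 𝓧 → I) (L : ℝ) (T : ℕ)
    (Q : ℕ → Finset ι → ι → ℝ) : (t : ℕ) → (Fin t → Obs 𝓧) → State ι
  | 0, _ => { epoch := 1, start := 0, active := Finset.univ }
  | t + 1, o => nextState ctx π L T Q o (state ctx π L T Q t fun j => o j.castSucc)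

variable {π : ι → 𝓧 → I}

lemma measurable_actionDensity (hπ : ∀ i, Measurable (π i)) (L : ℝ) (m : ℕ) (Q : ι → ℝ) :
    Measurable (Function.uncurry (actionDensity π L m Q)) := by
  unfold actionDensity Function.uncurry
  refine measurable_const.add (measurable_const.mul (Finset.measurable_sum _ fun i _ => ?_))
  exact measurable_const.mul ((measurable_smoothDensity (bandwidth m)).comp
    (((hπ i).comp measurable_fst).prodMk measurable_snd))

lemma measurable_ipsLoss (hπ : ∀ i, Measurable (π i)) (L : ℝ) (m : ℕ) (Q : ι → ℝ) (i : ι) :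
    Measurable fun o : Obs 𝓧 => ipsLoss π L m Q i o := by
  have hf : Measurable fun o : Obs 𝓧 => o.1 := measurable_fst
  have ha : Measurable fun o : Obs 𝓧 => o.2.1 := measurable_fst.comp measurable_snd
  have hy : Measurable fun o : Obs 𝓧 => (o.2.2 : ℝ) :=
    measurable_subtype_coe.comp (measurable_snd.comp measurable_snd)
  have hfa : Measurable fun o : Obs 𝓧 => (o.1, o.2.1) := hf.prodMk ha
  have hia : Measurable fun o : Obs 𝓧 => (π i o.1, o.2.1) := ((hπ i).comp hf).prodMk ha
  have h1 : Measurable fun o : Obs 𝓧 => smoothDensity (bandwidth m) (π i o.1) o.2.1 :=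
    (measurable_smoothDensity (bandwidth m)).comp hia
  have h2 := Measurable.comp (measurable_actionDensity hπ L m Q) hfa
  exact (h1.mul hy).div h2

lemma measurable_lossEstimate (ctx : Measure 𝓧) (hπ : ∀ i, Measurable (π i)) (L : ℝ) (T : ℕ)
    (Q : ℕ → Finset ι → ι → ℝ) (m s : ℕ) (A : Finset ι) (i : ι) (t : ℕ) :
    Measurable fun o : Fin t → Obs 𝓧 => lossEstimate ctx π L T Q m s A i o := by
  refine measurable_median.comp (measurable_pi_lambda _ fun b => ?_)
  refine Measurable.div_const (Finset.measurable_sum _ fun j _ => ?_) _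
  split_ifs
  · exact (measurable_ipsLoss hπ L m (Q m A) i).comp (measurable_pi_apply j)
  · exact measurable_const

lemma measurable_nextState (ctx : Measure 𝓧) (hπ : ∀ i, Measurable (π i)) (L : ℝ) (T : ℕ)
    (Q : ℕ → Finset ι → ι → ℝ) (t : ℕ) (st : State ι) :
    Measurable fun o : Fin t → Obs 𝓧 => nextState ctx π L T Q o st := by
  classical
  let keep : (ι → Prop) → State ι := fun P =>
    { epoch := st.epoch + 1
      start := t
      active := st.active.filter P }
  have hP : Measurable fun (o : Fin t → Obs 𝓧) (i : ι) =>
      Survives ctx π L T Q st.epoch st.start st.active o i := by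
    refine measurable_pi_lambda _ fun i => ?_
    refine Measurable.forall fun i' => Measurable.forall fun _ => ?_
    exact measurableSet_setOfPred.1 (measurableSet_le
      (measurable_lossEstimate ctx hπ L T Q st.epoch st.start st.active i t)
      ((measurable_lossEstimate ctx hπ L T Q st.epoch st.start st.active i' t).add_const _))
  have hkeep : Measurable keep := measurable_of_countable _
  unfold nextState
  split_ifs
  · have h := hkeep.comp hP
    simp only [keep, Function.comp_def] at h
    convert h
  · exact measurable_const

lemma measurable_state (ctx : Measure 𝓧) (hπ : ∀ i, Measurable (π i)) (L : ℝ) (T : ℕ)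
    (Q : ℕ → Finset ι → ι → ℝ) (t : ℕ) : Measurable (state ctx π L T Q t) := by
  induction t with
  | zero => exact measurable_const
  | succ t ih =>
    have h1 : Measurable fun p : (Fin (t + 1) → Obs 𝓧) × State ι =>
        nextState ctx π L T Q p.1 p.2 :=
      measurable_from_prod_countable_left fun st => measurable_nextState ctx hπ L T Q (t + 1) st
    have h2 : Measurable fun (o : Fin (t + 1) → Obs 𝓧) (j : Fin t) => o j.castSucc :=
      measurable_pi_lambda _ fun j => measurable_pi_apply _
    exact h1.comp (measurable_id.prodMk (ih.comp h2))

end Algorithm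

/-! ### Interaction with the environment

The distribution of a pair (context, loss function) is `ctx ⊗ₘ lossLaw`: the context has law
`ctx`, and `lossLaw x` is the conditional law, given the context `x`, of an outcome `ω : 𝓛` that
determines the loss function `loss ω : [0,1] → [0,1]`. -/

section Interaction

variable {𝓧 : Type u} [MeasurableSpace 𝓧] {𝓛 : Type v} [MeasurableSpace 𝓛]
  {ι : Type w} [Fintype ι]

/-- One round: the context, the outcome that determines the loss function, and the action. -/
abbrev Round (𝓧 : Type u) (𝓛 : Type v) : Type (max u v) := (𝓧 × 𝓛) × I

/-- The learner sees the context, its action and the loss of that action, nothing else. -/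
def observe (loss : 𝓛 → I → I) (z : Round 𝓧 𝓛) : Obs 𝓧 := (z.1.1, z.2, loss z.1.2 z.2)

lemma measurable_observe {loss : 𝓛 → I → I} (hloss : Measurable (Function.uncurry loss)) :
    Measurable (observe (𝓧 := 𝓧) loss) :=
  measurable_fst.fst.prodMk
    (measurable_snd.prodMk (hloss.comp (measurable_fst.snd.prodMk measurable_snd)))

/-- The law of a round when the algorithm is in state `st`: the context and the loss function are
drawn from the environment, and given them the action is drawn from the density `q_m(· | x)`. -/
def roundLaw (ctx : Measure 𝓧) (lossLaw : Kernel 𝓧 𝓛) (π : ι → 𝓧 → I) (L : ℝ)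
    (Q : ℕ → Finset ι → ι → ℝ) : Kernel (State ι) (Round 𝓧 𝓛) :=
  ⟨fun st => (ctx ⊗ₘ lossLaw) ⊗ₘ Kernel.prodMkRight 𝓛
      (Kernel.withDensity (Kernel.const 𝓧 (volume : Measure I)) fun x a =>
        ENNReal.ofReal (actionDensity π L st.epoch (Q st.epoch st.active) x a)),
    measurable_from_top⟩

/-- The law of the next round given the first `t` rounds. -/
def stepKernel (ctx : Measure 𝓧) (lossLaw : Kernel 𝓧 𝓛) (loss : 𝓛 → I → I)
    (hloss : Measurable (Function.uncurry loss)) (π : ι → 𝓧 → I) (hπ : ∀ i, Measurable (π i))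
    (L : ℝ) (T : ℕ) (Q : ℕ → Finset ι → ι → ℝ) (t : ℕ) :
    Kernel (Fin t → Round 𝓧 𝓛) (Round 𝓧 𝓛) :=
  (roundLaw ctx lossLaw π L Q).comap
    (fun z => state ctx π L T Q t fun j => observe loss (z j))
    ((measurable_state ctx hπ L T Q t).comp
      (measurable_pi_lambda _ fun j => (measurable_observe hloss).comp (measurable_pi_apply j)))

/-- The joint law of the first `t` rounds, when the algorithm runs with horizon `T`. -/
def historyLaw (ctx : Measure 𝓧) (lossLaw : Kernel 𝓧 𝓛) (loss : 𝓛 → I → I)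
    (hloss : Measurable (Function.uncurry loss)) (π : ι → 𝓧 → I) (hπ : ∀ i, Measurable (π i))
    (L : ℝ) (T : ℕ) (Q : ℕ → Finset ι → ι → ℝ) : (t : ℕ) → Measure (Fin t → Round 𝓧 𝓛)
  | 0 => Measure.dirac Fin.elim0
  | t + 1 =>
    (historyLaw ctx lossLaw loss hloss π hπ L T Q t ⊗ₘ
        stepKernel ctx lossLaw loss hloss π hπ L T Q t).map
      fun p => Fin.snoc (α := fun _ => Round 𝓧 𝓛) p.1 p.2

/-- The expected (unsmoothed) loss `λ₀` of a policy `f`. -/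
def policyLoss (ctx : Measure 𝓧) (lossLaw : Kernel 𝓧 𝓛) (loss : 𝓛 → I → I) (f : 𝓧 → I) : ℝ :=
  ∫ p, (loss p.2 (f p.1) : ℝ) ∂(ctx ⊗ₘ lossLaw)

/-- The benchmark: the smallest expected loss of a policy in the class. -/
def bench (ctx : Measure 𝓧) (lossLaw : Kernel 𝓧 𝓛) (loss : 𝓛 → I → I) (π : ι → 𝓧 → I) : ℝ :=
  ⨅ i, policyLoss ctx lossLaw loss (π i)

/-- The expected regret, after `T` rounds, of the algorithm with parameter `L`, horizon `T` and
policy class `π`, against the unsmoothed class `π`. -/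
def regret (ctx : Measure 𝓧) (lossLaw : Kernel 𝓧 𝓛) (loss : 𝓛 → I → I)
    (hloss : Measurable (Function.uncurry loss)) (π : ι → 𝓧 → I) (hπ : ∀ i, Measurable (π i))
    (L : ℝ) (T : ℕ) (Q : ℕ → Finset ι → ι → ℝ) : ℝ :=
  (∫ z, ∑ t : Fin T, (loss (z t).1.2 (z t).2 : ℝ)
      ∂(historyLaw ctx lossLaw loss hloss π hπ L T Q T))
    - T * bench ctx lossLaw loss π

/-! ### The policy zooming coefficient -/

/-- The `δ`-packing number of `S ⊆ [0,1]`: the maximal cardinality of a subset of `S` any two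
points of which are at distance at least `δ`. -/
def packingNumber (δ : ℝ) (S : Set I) : ℕ∞ :=
  ⨆ (P : Set I) (_ : P ⊆ S) (_ : P.Pairwise fun a b => δ ≤ dist a b), P.encard

/-- `M₀(ε, δ)`: the expected `δ`-packing number of the set of actions chosen by the policies
whose unsmoothed expected loss is within `ε` of the benchmark. -/
def expectedPacking (ctx : Measure 𝓧) (lossLaw : Kernel 𝓧 𝓛) (loss : 𝓛 → I → I)
    (π : ι → 𝓧 → I) (ε δ : ℝ) : ℝ≥0∞ :=
  ∫⁻ x, (packingNumber δ ((fun i => π i x) ''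
    {i | policyLoss ctx lossLaw loss (π i) ≤ bench ctx lossLaw loss π + ε}) : ℝ≥0∞) ∂ctx

/-- The policy zooming coefficient `ψ_L(ε₀) = sup_{ε ≥ ε₀} M₀(12 L ε, ε) / ε`. -/
def zoomingCoefficient (ctx : Measure 𝓧) (lossLaw : Kernel 𝓧 𝓛) (loss : 𝓛 → I → I)
    (π : ι → 𝓧 → I) (L ε₀ : ℝ) : ℝ≥0∞ :=
  ⨆ (ε : ℝ) (_ : ε₀ ≤ ε),
    expectedPacking ctx lossLaw loss π (12 * L * ε) ε / ENNReal.ofReal ε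

end Interaction

end

end SmoothPE

namespace SmoothPE

/-! ### Smoothing densities -/

/-! The regret bound is an epoch-by-epoch account on the event that all median-of-means estimates
are accurate. Smoothing with bandwidth `h_m` changes the loss of a policy by at most `L h_m = r_m`,
since only the conditional mean loss, which is Lipschitz, enters (`abs_smoothedLoss_sub_le`). If
every estimate is within `r_m / 2` of the smoothed loss, estimation and bias shift a comparison of
two policies by at most `3 r_m`. Hence the best policy survives, and every survivor is within `6 r_m
= 12 r_{m+1}` of it (`good_nextState`). A round of a good epoch then costs at most `14 r_m`: `12
r_m` for the policies, `r_m` for the bias, `r_m` for exploration.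

Accuracy rests on a variance bound. The second moment of the importance-weighted loss is at most `1
/ h_m` times the design objective, and that objective has value at most `2 V_m`. To see this,
maximize `∫ log q` over mixtures: first-order optimality towards a single policy gives `(1 - μ) ∫
Smooth / q ≤ ∫ (1 - μ / q) ≤ V_m`, because `q = μ` off the union of the balls, and `μ ≤ 1/2`. The
selected minimizer does at least as well as this log-optimal design
(`IsOptimalSelection.integral_smooth_div_density_le`). Chebyshev makes one batch bad with
probability at most `1/40`, and independence of the batches makes the median bad with probability at
most `3 ^ (-δ_T)` (`measure_median_of_means_far_le`).

The data are adaptive, but the state is constant during an epoch, so conditionally on the state at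
its start the rounds are i.i.d. (`lintegral_epoch`). There are countably many states, so one sums
over the state and the starting round (`measure_deviates_le`). The resulting failures cost at most
`1` in total because `3 ^ (-δ_T) ≤ (T |Π|) ^ (-5)`.

Finally, `V_m ≤ 1` bounds the length of epoch `m` by about `320 · 8^m δ_T / L²`, so the epochs up to
`M` cost of order `4^M δ_T / L + L δ_T`. All later rounds together cost at most `14 T r_{M+1}`. A
potential function carries this account along every history (`potential_step`,
`integral_totalLoss_le`), and balancing the two costs in `M` gives the rate (`exists_cutoff`).

The zooming bound uses nothing about the policies: a `δ`-separated subset of `[0,1]` has at most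
`1/δ + 1` points. -/

lemma le_volume_closedBall (a : I) {h : ℝ} (h0 : 0 ≤ h) (h1 : h ≤ 1 / 2) :
    h ≤ volume.real (Metric.closedBall a h) := by
  have key : ∀ x y : I, (y : ℝ) - x = h → Icc x y ⊆ Metric.closedBall a h →
      h ≤ volume.real (Metric.closedBall a h) := by
    intro x y hxy hsub
    calc h = volume.real (Icc x y) := by
          rw [measureReal_def, unitInterval.volume_Icc, hxy, ENNReal.toReal_ofReal h0]
      _ ≤ _ := measureReal_mono hsub
  -- The half of the ball that points towards the midpoint of `[0,1]` is an interval of length `h`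
  -- that is not cut off, as `h ≤ 1/2`.
  rcases le_total (a : ℝ) (1 / 2) with ha | ha
  · refine key a ⟨a + h, by linarith [a.2.1], by linarith⟩ (by simp) fun b hb => ?_
    have h2 : (a : ℝ) ≤ b := hb.1
    have h3 : (b : ℝ) ≤ a + h := hb.2
    rw [Metric.mem_closedBall, Subtype.dist_eq, Real.dist_eq, abs_le]
    constructor <;> linarith
  · refine key ⟨a - h, by linarith, by linarith [a.2.2]⟩ a (by simp) fun b hb => ?_
    have h2 : (a : ℝ) - h ≤ b := hb.1
    have h3 : (b : ℝ) ≤ a := hb.2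
    rw [Metric.mem_closedBall, Subtype.dist_eq, Real.dist_eq, abs_le]
    constructor <;> linarith

lemma smoothDensity_nonneg (h : ℝ) (a b : I) : 0 ≤ smoothDensity h a b := by
  unfold smoothDensity
  split_ifs <;> positivity

lemma smoothDensity_le {h : ℝ} (h0 : 0 < h) (h1 : h ≤ 1 / 2) (a b : I) :
    smoothDensity h a b ≤ h⁻¹ := by
  unfold smoothDensity
  split_ifs
  · exact inv_anti₀ h0 (le_volume_closedBall a h0.le h1)
  · positivity

lemma smoothDensity_eq_indicator (h : ℝ) (a b : I) :
    smoothDensity h a b =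
      (Metric.closedBall a h).indicator (fun _ => (volume.real (Metric.closedBall a h))⁻¹) b := by
  unfold smoothDensity
  split_ifs with hb
  · rw [indicator_of_mem (Metric.mem_closedBall.2 hb)]
  · rw [indicator_of_notMem (mt Metric.mem_closedBall.1 hb)]

lemma measurable_smoothDensity_right (h : ℝ) (a : I) : Measurable (smoothDensity h a) :=
  (measurable_smoothDensity h).comp measurable_prodMk_left

lemma integral_smoothDensity {h : ℝ} (h0 : 0 < h) (h1 : h ≤ 1 / 2) (a : I) :
    ∫ b, smoothDensity h a b = 1 := by
  simp_rw [smoothDensity_eq_indicator]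
  rw [integral_indicator_const _ measurableSet_closedBall, smul_eq_mul]
  exact mul_inv_cancel₀ (h0.trans_le (le_volume_closedBall a h0.le h1)).ne'

lemma bandwidth_pos (m : ℕ) : 0 < bandwidth m := by unfold bandwidth; positivity

lemma bandwidth_le_half {m : ℕ} (hm : 1 ≤ m) : bandwidth m ≤ 1 / 2 := by
  unfold bandwidth
  simpa using pow_le_pow_of_le_one (by norm_num : (0 : ℝ) ≤ 1 / 2) (by norm_num) hm

lemma radius_pos {L : ℝ} (hL : 1 ≤ L) (m : ℕ) : 0 < radius L m :=
  mul_pos (by linarith) (bandwidth_pos m)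

lemma explore_pos {L : ℝ} (hL : 1 ≤ L) (m : ℕ) : 0 < explore L m :=
  lt_min (by norm_num) (radius_pos hL m)

lemma explore_le_half (L : ℝ) (m : ℕ) : explore L m ≤ 1 / 2 := min_le_left _ _

lemma explore_le_radius (L : ℝ) (m : ℕ) : explore L m ≤ radius L m := min_le_right _ _

section Density

variable {𝓧 : Type u} {ι : Type w} [Fintype ι] {π : ι → 𝓧 → I} {L : ℝ}
  {m : ℕ} {A : Finset ι} {Q : ι → ℝ}

lemma measurable_smoothDensity_policy [MeasurableSpace 𝓧] {f : 𝓧 → I} (hf : Measurable f) (h : ℝ) :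
    Measurable fun p : 𝓧 × I => smoothDensity h (f p.1) p.2 :=
  (measurable_smoothDensity h).comp ((hf.comp measurable_fst).prodMk measurable_snd)

lemma mixture_nonneg (hQ : Q ∈ simplexOn A) (h : ℝ) (x : 𝓧) (a : I) :
    0 ≤ ∑ i, Q i * smoothDensity h (π i x) a :=
  Finset.sum_nonneg fun i _ => mul_nonneg (hQ.1 i) (smoothDensity_nonneg _ _ _)

lemma mixture_le (hQ : Q ∈ simplexOn A) (hm : 1 ≤ m) (x : 𝓧) (a : I) :
    ∑ i, Q i * smoothDensity (bandwidth m) (π i x) a ≤ (bandwidth m)⁻¹ := by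
  calc ∑ i, Q i * smoothDensity (bandwidth m) (π i x) a
      ≤ ∑ i, Q i * (bandwidth m)⁻¹ := by
        gcongr with i
        · exact hQ.1 i
        · exact smoothDensity_le (bandwidth_pos m) (bandwidth_le_half hm) _ _
    _ = (bandwidth m)⁻¹ := by rw [← Finset.sum_mul, hQ.2.2, one_mul]

lemma explore_le_actionDensity (hQ : Q ∈ simplexOn A) (x : 𝓧) (a : I) :
    explore L m ≤ actionDensity π L m Q x a := by
  unfold actionDensity
  have h1 := mixture_nonneg (π := π) hQ (bandwidth m) x a
  have h2 := explore_le_half L m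
  have : 0 ≤ (1 - explore L m) * ∑ i, Q i * smoothDensity (bandwidth m) (π i x) a :=
    mul_nonneg (by linarith) h1
  linarith

lemma actionDensity_pos (hL : 1 ≤ L) (hQ : Q ∈ simplexOn A) (x : 𝓧) (a : I) :
    0 < actionDensity π L m Q x a :=
  (explore_pos hL m).trans_le (explore_le_actionDensity hQ x a)

lemma actionDensity_le (hL : 1 ≤ L) (hm : 1 ≤ m) (hQ : Q ∈ simplexOn A) (x : 𝓧) (a : I) :
    actionDensity π L m Q x a ≤ 1 + (bandwidth m)⁻¹ := by
  unfold actionDensity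
  have h0 := explore_pos hL m
  have h1 := mixture_nonneg (π := π) hQ (bandwidth m) x a
  have h2 := explore_le_half L m
  have h3 := mixture_le (π := π) hQ hm x a
  have : (1 - explore L m) * ∑ i, Q i * smoothDensity (bandwidth m) (π i x) a
      ≤ 1 * ∑ i, Q i * smoothDensity (bandwidth m) (π i x) a := by gcongr; linarith
  linarith

lemma integrable_of_abs_le {α : Type*} [MeasurableSpace α] {μ : Measure α} [IsFiniteMeasure μ]
    {f : α → ℝ} (hf : Measurable f) (C : ℝ) (hC : ∀ x, |f x| ≤ C) : Integrable f μ :=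
  Integrable.of_bound hf.aestronglyMeasurable C (Filter.Eventually.of_forall hC)

lemma integrable_smoothDensity {h : ℝ} (h0 : 0 < h) (h1 : h ≤ 1 / 2) (a : I) :
    Integrable (smoothDensity h a) (volume : Measure I) :=
  integrable_of_abs_le (measurable_smoothDensity_right h a) h⁻¹ fun b => by
    rw [abs_of_nonneg (smoothDensity_nonneg _ _ _)]
    exact smoothDensity_le h0 h1 a b

lemma integral_actionDensity (hm : 1 ≤ m) (hQ : Q ∈ simplexOn A) (x : 𝓧) :
    ∫ a, actionDensity π L m Q x a = 1 := by
  unfold actionDensity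
  have hi : ∀ i ∈ (Finset.univ : Finset ι),
      Integrable (fun a => Q i * smoothDensity (bandwidth m) (π i x) a) (volume : Measure I) :=
    fun i _ => (integrable_smoothDensity (bandwidth_pos m) (bandwidth_le_half hm) _).const_mul _
  rw [integral_add (integrable_const _) ((integrable_finsetSum _ hi).const_mul _),
    integral_const_mul, integral_finsetSum _ hi]
  simp_rw [integral_const_mul, integral_smoothDensity (bandwidth_pos m) (bandwidth_le_half hm)]
  simp [hQ.2.2]

lemma measurable_actionDensity_right [MeasurableSpace 𝓧] (hπ : ∀ i, Measurable (π i)) (x : 𝓧) :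
    Measurable (actionDensity π L m Q x) :=
  (measurable_actionDensity hπ L m Q).of_uncurry_left

end Density

/-! ### The zooming coefficient -/

/-- Cut `[0,1]` into cells of length `δ`. Two points in the same half-open cell are closer than `δ`,
so the cell index `⌊a / δ⌋` is injective on a separated set. -/
lemma packingNumber_le {δ : ℝ} (hδ : 0 < δ) (S : Set I) :
    packingNumber δ S ≤ (⌊δ⁻¹⌋₊ + 1 : ℕ) := by
  unfold packingNumber
  refine iSup_le fun P => iSup_le fun _ => iSup_le fun hP => ?_
  let f : I → ℕ := fun a => ⌊(a : ℝ) * δ⁻¹⌋₊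
  have hmaps : MapsTo f P (Finset.range (⌊δ⁻¹⌋₊ + 1) : Finset ℕ) := by
    intro a _
    simp only [Finset.coe_range, Set.mem_Iio, f]
    refine Nat.lt_succ_of_le (Nat.floor_le_floor ?_)
    exact mul_le_of_le_one_left (by positivity) a.2.2
  have hinj : InjOn f P := by
    intro a ha b hb hab
    by_contra hne
    have h1 : δ ≤ dist a b := hP ha hb hne
    have ha0 : 0 ≤ (a : ℝ) * δ⁻¹ := mul_nonneg a.2.1 (by positivity)
    have hb0 : 0 ≤ (b : ℝ) * δ⁻¹ := mul_nonneg b.2.1 (by positivity)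
    have e : (⌊(a : ℝ) * δ⁻¹⌋₊ : ℝ) = ⌊(b : ℝ) * δ⁻¹⌋₊ := by exact_mod_cast hab
    have h2 := Nat.floor_le ha0
    have h3 := Nat.lt_floor_add_one ((a : ℝ) * δ⁻¹)
    have h4 := Nat.floor_le hb0
    have h5 := Nat.lt_floor_add_one ((b : ℝ) * δ⁻¹)
    have h6 : |(a : ℝ) * δ⁻¹ - b * δ⁻¹| < 1 := by
      rw [abs_lt]; constructor <;> linarith
    rw [← sub_mul, abs_mul, abs_of_pos (inv_pos.2 hδ), ← div_eq_mul_inv, div_lt_one hδ] at h6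
    rw [Subtype.dist_eq, Real.dist_eq] at h1
    linarith
  have := Set.encard_le_encard_of_injOn hmaps hinj
  rwa [Set.encard_coe_eq_coe_finsetCard, Finset.card_range] at this

section Zooming

variable {𝓧 : Type u} [MeasurableSpace 𝓧] {𝓛 : Type v} [MeasurableSpace 𝓛]
  {ι : Type w}

lemma zoomingCoefficient_le (ctx : Measure 𝓧) [IsProbabilityMeasure ctx]
    (lossLaw : Kernel 𝓧 𝓛) (loss : 𝓛 → I → I) (π : ι → 𝓧 → I) (L : ℝ) {ε₀ : ℝ} (h0 : 0 < ε₀)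
    (h1 : ε₀ ≤ 1) :
    zoomingCoefficient ctx lossLaw loss π L ε₀ ≤ ENNReal.ofReal (2 / ε₀ ^ 2) := by
  unfold zoomingCoefficient
  refine iSup_le fun ε => iSup_le fun hε => ?_
  have hε0 : 0 < ε := h0.trans_le hε
  have hpack : expectedPacking ctx lossLaw loss π (12 * L * ε) ε
      ≤ ENNReal.ofReal (ε⁻¹ + 1) := by
    unfold expectedPacking
    calc _ ≤ ∫⁻ _, ENNReal.ofReal (ε⁻¹ + 1) ∂ctx := by
          refine lintegral_mono fun x => ?_
          refine (ENat.toENNReal_mono (packingNumber_le hε0 _)).trans ?_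
          rw [ENat.toENNReal_coe, ← ENNReal.ofReal_natCast]
          refine ENNReal.ofReal_le_ofReal ?_
          push_cast
          gcongr
          exact Nat.floor_le (by positivity)
      _ = _ := by simp
  calc _ ≤ ENNReal.ofReal (ε⁻¹ + 1) / ENNReal.ofReal ε := by gcongr
    _ = ENNReal.ofReal ((ε⁻¹ + 1) / ε) := (ENNReal.ofReal_div_of_pos hε0).symm
    _ ≤ _ := by
      refine ENNReal.ofReal_le_ofReal ?_
      -- The range `ε > 1` is included: both `ε⁻¹` and `1` are at most `ε₀⁻¹`.
      have h2 : ε⁻¹ ≤ ε₀⁻¹ := inv_anti₀ h0 hε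
      have h3 : 1 ≤ ε₀⁻¹ := (one_le_inv₀ h0).2 h1
      calc (ε⁻¹ + 1) / ε = (ε⁻¹ + 1) * ε⁻¹ := div_eq_mul_inv _ _
        _ ≤ (ε₀⁻¹ + ε₀⁻¹) * ε₀⁻¹ := by gcongr
        _ = 2 / ε₀ ^ 2 := by field_simp; ring

end Zooming

/-! ### The optimal design -/

section CoveredSet

variable {ι : Type w} {𝓧 : Type u} {π : ι → 𝓧 → I} {m : ℕ} {A : Finset ι}

/-- The union of the graphs of the smoothed policies. -/
def coveredSet (π : ι → 𝓧 → I) (m : ℕ) (A : Finset ι) : Set (𝓧 × I) :=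
  {p | ∃ i ∈ A, dist p.2 (π i p.1) ≤ bandwidth m}

lemma preimage_coveredSet (x : 𝓧) :
    Prod.mk x ⁻¹' coveredSet π m A = ⋃ i ∈ A, Metric.closedBall (π i x) (bandwidth m) := by
  ext a; simp [coveredSet]

lemma measurableSet_coveredSet [MeasurableSpace 𝓧] (hπ : ∀ i, Measurable (π i)) :
    MeasurableSet (coveredSet π m A) := by
  have : coveredSet π m A = ⋃ i ∈ A, {p : 𝓧 × I | dist p.2 (π i p.1) ≤ bandwidth m} := by
    ext p; simp [coveredSet]
  rw [this]
  exact Finset.measurableSet_biUnion _ fun i _ => measurableSet_le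
    (measurable_snd.dist ((hπ i).comp measurable_fst)) measurable_const

variable [MeasurableSpace 𝓧] {ctx : Measure 𝓧} [IsProbabilityMeasure ctx]

lemma measurable_volume_balls (hπ : ∀ i, Measurable (π i)) :
    Measurable fun x : 𝓧 =>
      volume.real (⋃ i ∈ A, Metric.closedBall (π i x) (bandwidth m)) := by
  simp_rw [← preimage_coveredSet]
  exact (measurable_measure_prodMk_left (ν := (volume : Measure I))
    (measurableSet_coveredSet hπ)).ennreal_toReal

lemma integrable_volume_balls (hπ : ∀ i, Measurable (π i)) :
    Integrable (fun x : 𝓧 =>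
      volume.real (⋃ i ∈ A, Metric.closedBall (π i x) (bandwidth m))) ctx :=
  integrable_of_abs_le (measurable_volume_balls hπ) 1 fun x => by
    rw [abs_of_nonneg measureReal_nonneg]
    exact measureReal_le_one

lemma charVolume_le_one (hπ : ∀ i, Measurable (π i)) : charVolume ctx π m A ≤ 1 := by
  calc charVolume ctx π m A ≤ ∫ _, 1 ∂ctx :=
        integral_mono (integrable_volume_balls hπ) (integrable_const _)
          fun x => measureReal_le_one
    _ = 1 := by simp

/-- Any one ball of the union suffices. This lower bound is needed only to make the batch size
positive; the rate itself uses the trivial bound `V ≤ 1`. -/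
lemma bandwidth_le_charVolume (hπ : ∀ i, Measurable (π i)) (hm : 1 ≤ m) (hA : A.Nonempty) :
    bandwidth m ≤ charVolume ctx π m A := by
  obtain ⟨i, hi⟩ := hA
  calc bandwidth m = ∫ _, bandwidth m ∂ctx := by simp
    _ ≤ charVolume ctx π m A := by
      refine integral_mono (integrable_const _) (integrable_volume_balls hπ) fun x => ?_
      refine (le_volume_closedBall (π i x) (bandwidth_pos m).le (bandwidth_le_half hm)).trans ?_
      exact measureReal_mono (subset_biUnion_of_mem (u := fun i =>
        Metric.closedBall (π i x) (bandwidth m)) hi) (measure_ne_top _ _)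

lemma integral_indicator_coveredSet (hπ : ∀ i, Measurable (π i)) :
    ∫ p, (coveredSet π m A).indicator (fun _ => (1 : ℝ)) p ∂(ctx.prod volume) =
      charVolume ctx π m A := by
  have hs := measurableSet_coveredSet (m := m) (A := A) hπ
  rw [integral_prod _ ((integrable_const _).indicator hs)]
  unfold charVolume
  refine integral_congr_ae (Filter.Eventually.of_forall fun x => ?_)
  have h : ∀ a : I, (coveredSet π m A).indicator (fun _ => (1 : ℝ)) (x, a) =
      (⋃ i ∈ A, Metric.closedBall (π i x) (bandwidth m)).indicator (fun _ => (1 : ℝ)) a :=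
    fun a => by rw [← preimage_coveredSet]; rfl
  simp only [h]
  rw [integral_indicator_const _
    (Finset.measurableSet_biUnion _ fun i _ => measurableSet_closedBall)]
  simp

end CoveredSet

/-! ### Log-optimal mixtures and the value of the design problem -/

section Design

variable {ι : Type w} [Fintype ι]

lemma isCompact_simplexOn (A : Finset ι) : IsCompact (simplexOn A) := by
  have h : simplexOn A = stdSimplex ℝ ι ∩ {Q | ∀ i, i ∉ A → Q i = 0} := by
    ext Q
    simp only [simplexOn, stdSimplex, mem_ofPred_eq, mem_inter_iff]
    tauto
  rw [h]
  refine (isCompact_stdSimplex ℝ ι).inter_right ?_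
  simp only [ofPred_forall]
  exact isClosed_iInter fun i => isClosed_iInter fun _ =>
    isClosed_eq (continuous_apply i) continuous_const

lemma single_mem_simplexOn [DecidableEq ι] {A : Finset ι} {i : ι} (hi : i ∈ A) :
    (Pi.single i 1 : ι → ℝ) ∈ simplexOn A := by
  refine ⟨fun j => ?_, fun j hj => ?_, by simp⟩
  · rw [Pi.single_apply]; split_ifs <;> norm_num
  · rw [Pi.single_apply, if_neg]
    rintro rfl
    exact hj hi

lemma mix_mem_simplexOn {A : Finset ι} {Q R : ι → ℝ} (hQ : Q ∈ simplexOn A)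
    (hR : R ∈ simplexOn A) {s : ℝ} (h0 : 0 ≤ s) (h1 : s ≤ 1) :
    (1 - s) • Q + s • R ∈ simplexOn A := by
  refine ⟨fun j => ?_, fun j hj => ?_, ?_⟩
  · have := hQ.1 j
    have := hR.1 j
    have : 0 ≤ 1 - s := by linarith
    simp only [Pi.add_apply, Pi.smul_apply, smul_eq_mul]
    positivity
  · simp [hQ.2.1 j hj, hR.2.1 j hj]
  · simp [Finset.sum_add_distrib, ← Finset.mul_sum, hQ.2.2, hR.2.2]

variable {𝓧 : Type u} {π : ι → 𝓧 → I} {L : ℝ} {m : ℕ} {A : Finset ι}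

lemma actionDensity_mix (Q R : ι → ℝ) (s : ℝ) (x : 𝓧) (a : I) :
    actionDensity π L m ((1 - s) • Q + s • R) x a =
      (1 - s) * actionDensity π L m Q x a + s * actionDensity π L m R x a := by
  simp only [actionDensity, Pi.add_apply, Pi.smul_apply, smul_eq_mul, add_mul,
    Finset.sum_add_distrib, mul_assoc, ← Finset.mul_sum]
  ring

lemma actionDensity_single [DecidableEq ι] (i : ι) (x : 𝓧) (a : I) :
    actionDensity π L m (Pi.single i 1) x a =
      explore L m + (1 - explore L m) * smoothDensity (bandwidth m) (π i x) a := by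
  unfold actionDensity
  congr 2
  rw [Finset.sum_eq_single i]
  · simp
  · intro j _ hj
    simp [hj]
  · simp

lemma continuous_actionDensity_weights (x : 𝓧) (a : I) :
    Continuous fun Q : ι → ℝ => actionDensity π L m Q x a := by
  unfold actionDensity
  fun_prop

/-- A second-order lower bound for `log` along a segment, from `log x ≤ x - 1` at `x = q / (q + s
d)`. The error is uniform because both endpoints stay above `e`; this replaces differentiation under
the integral sign. -/
lemma log_sub_log_ge {q d s e B : ℝ} (he : 0 < e) (hq : e ≤ q) (hqs : e ≤ q + s * d)
    (hd : |d| ≤ B) :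
    s * (d / q) - s ^ 2 * (B ^ 2 / e ^ 2) ≤ Real.log (q + s * d) - Real.log q := by
  have hq0 : 0 < q := he.trans_le hq
  have hqs0 : 0 < q + s * d := he.trans_le hqs
  have h1 : Real.log q - Real.log (q + s * d) ≤ q / (q + s * d) - 1 := by
    rw [← Real.log_div hq0.ne' hqs0.ne']
    exact Real.log_le_sub_one_of_pos (by positivity)
  have h2 : 1 - q / (q + s * d) = s * (d / q) - s ^ 2 * (d ^ 2 / (q * (q + s * d))) := by
    field_simp
    ring
  have h3 : d ^ 2 / (q * (q + s * d)) ≤ B ^ 2 / e ^ 2 := by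
    have h4 : d ^ 2 ≤ B ^ 2 := sq_le_sq' (by linarith [(abs_le.1 hd).1]) (abs_le.1 hd).2
    have h5 : e ^ 2 ≤ q * (q + s * d) := by
      rw [sq]; exact mul_le_mul hq hqs he.le hq0.le
    exact div_le_div₀ (sq_nonneg _) h4 (by positivity) h5
  have h6 := mul_le_mul_of_nonneg_left h3 (sq_nonneg s)
  linarith

lemma abs_log_actionDensity_le (hL : 1 ≤ L) (hm : 1 ≤ m) {Q : ι → ℝ} (hQ : Q ∈ simplexOn A)
    (x : 𝓧) (a : I) :
    |Real.log (actionDensity π L m Q x a)| ≤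
      max |Real.log (explore L m)| |Real.log (1 + (bandwidth m)⁻¹)| := by
  refine abs_le_max_abs_abs ?_ ?_
  · exact Real.log_le_log (explore_pos hL m) (explore_le_actionDensity hQ x a)
  · exact Real.log_le_log (actionDensity_pos hL hQ x a) (actionDensity_le hL hm hQ x a)

variable [MeasurableSpace 𝓧] {ctx : Measure 𝓧} [IsProbabilityMeasure ctx]

/-- The simplex is compact, and the objective is continuous by dominated convergence: exploration
keeps `q` away from `0` and the bandwidth bounds it above, so `log q` is bounded. -/
lemma exists_maximal_design (hπ : ∀ i, Measurable (π i)) (hL : 1 ≤ L) (hm : 1 ≤ m)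
    (hA : A.Nonempty) :
    ∃ Q ∈ simplexOn A, ∀ R ∈ simplexOn A,
      ∫ p : 𝓧 × I, Real.log (actionDensity π L m R p.1 p.2) ∂(ctx.prod volume) ≤
        ∫ p : 𝓧 × I, Real.log (actionDensity π L m Q p.1 p.2) ∂(ctx.prod volume) := by
  classical
  obtain ⟨i, hi⟩ := hA
  obtain ⟨Q, hQ, hmax⟩ := (isCompact_simplexOn A).exists_isMaxOn
    ⟨_, single_mem_simplexOn hi⟩ (f := fun R =>
      ∫ p : 𝓧 × I, Real.log (actionDensity π L m R p.1 p.2) ∂(ctx.prod volume)) (by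
    refine continuousOn_of_dominated (bound := fun _ =>
      max |Real.log (explore L m)| |Real.log (1 + (bandwidth m)⁻¹)|) ?_ ?_
      (integrable_const _) ?_
    · exact fun R _ => (Measurable.log (measurable_actionDensity hπ L m R)).aestronglyMeasurable
    · exact fun R hR => Filter.Eventually.of_forall fun p =>
        abs_log_actionDensity_le hL hm hR p.1 p.2
    · exact Filter.Eventually.of_forall fun p =>
        (continuous_actionDensity_weights p.1 p.2).continuousOn.log fun R hR =>
          (actionDensity_pos hL hR p.1 p.2).ne')
  exact ⟨Q, hQ, fun R hR => hmax hR⟩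

/-- First-order optimality: the directional derivative of `∫ log q` at the maximizer, towards any
other mixture, is nonpositive. -/
lemma integral_density_ratio_le_one (hπ : ∀ i, Measurable (π i)) (hL : 1 ≤ L) (hm : 1 ≤ m)
    {Q R : ι → ℝ} (hQ : Q ∈ simplexOn A) (hR : R ∈ simplexOn A)
    (hmax : ∀ R ∈ simplexOn A,
      ∫ p : 𝓧 × I, Real.log (actionDensity π L m R p.1 p.2) ∂(ctx.prod volume) ≤
        ∫ p : 𝓧 × I, Real.log (actionDensity π L m Q p.1 p.2) ∂(ctx.prod volume)) :
    ∫ p : 𝓧 × I, (actionDensity π L m R p.1 p.2 - actionDensity π L m Q p.1 p.2) /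
      actionDensity π L m Q p.1 p.2 ∂(ctx.prod volume) ≤ 0 := by
  set e := explore L m with he_def
  have he : 0 < e := explore_pos hL m
  set B := 1 + (bandwidth m)⁻¹ with hB_def
  have hB0 : 0 < B := by have := bandwidth_pos m; positivity
  set q : 𝓧 × I → ℝ := fun p => actionDensity π L m Q p.1 p.2 with hq
  set r : 𝓧 × I → ℝ := fun p => actionDensity π L m R p.1 p.2 with hr
  have hqm : Measurable q := measurable_actionDensity hπ L m Q
  have hrm : Measurable r := measurable_actionDensity hπ L m R
  have hqe : ∀ p, e ≤ q p := fun p => explore_le_actionDensity hQ p.1 p.2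
  have hre : ∀ p, e ≤ r p := fun p => explore_le_actionDensity hR p.1 p.2
  have hd : ∀ p, |r p - q p| ≤ B := fun p => by
    have h1 : q p ≤ B := actionDensity_le hL hm hQ p.1 p.2
    have h2 : r p ≤ B := actionDensity_le hL hm hR p.1 p.2
    rw [abs_le]
    constructor <;> linarith [hqe p, hre p]
  have hint : Integrable (fun p => (r p - q p) / q p) (ctx.prod volume) := by
    refine integrable_of_abs_le ((hrm.sub hqm).div hqm) (B / e) fun p => ?_
    rw [abs_div, abs_of_pos (he.trans_le (hqe p))]
    exact div_le_div₀ hB0.le (hd p) he (hqe p)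
  have hlogint : ∀ R' ∈ simplexOn A, Integrable
      (fun p : 𝓧 × I => Real.log (actionDensity π L m R' p.1 p.2)) (ctx.prod volume) :=
    fun R' hR' => integrable_of_abs_le (Measurable.log (measurable_actionDensity hπ L m R')) _
      fun p => abs_log_actionDensity_le hL hm hR' p.1 p.2
  have hstep : ∀ s : ℝ, 0 < s → s ≤ 1 →
      ∫ p, (r p - q p) / q p ∂(ctx.prod volume) ≤ s * (B ^ 2 / e ^ 2) := by
    intro s h0 h1
    have hmem := mix_mem_simplexOn hQ hR h0.le h1
    have hmix : ∀ p : 𝓧 × I, actionDensity π L m ((1 - s) • Q + s • R) p.1 p.2 =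
        q p + s * (r p - q p) := fun p => by rw [actionDensity_mix]; simp only [hq, hr]; ring
    have hle : ∫ p, (s * ((r p - q p) / q p) - s ^ 2 * (B ^ 2 / e ^ 2)) ∂(ctx.prod volume) ≤
        ∫ p, (Real.log (actionDensity π L m ((1 - s) • Q + s • R) p.1 p.2) -
          Real.log (actionDensity π L m Q p.1 p.2)) ∂(ctx.prod volume) := by
      refine integral_mono ((hint.const_mul s).sub (integrable_const _))
        ((hlogint _ hmem).sub (hlogint Q hQ)) fun p => ?_
      simp only [hmix]
      refine log_sub_log_ge he (hqe p) ?_ (hd p)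
      rw [← hmix]
      exact explore_le_actionDensity hmem p.1 p.2
    rw [integral_sub (hlogint _ hmem) (hlogint Q hQ),
      integral_sub (hint.const_mul s) (integrable_const _), integral_const_mul] at hle
    simp only [integral_const, probReal_univ, smul_eq_mul, one_mul] at hle
    have h2 := hmax _ hmem
    have h3 : s * ∫ p, (r p - q p) / q p ∂(ctx.prod volume) ≤ s * (s * (B ^ 2 / e ^ 2)) := by
      nlinarith
    exact le_of_mul_le_mul_left h3 h0
  by_contra hcon
  push Not at hcon
  set J := ∫ p, (r p - q p) / q p ∂(ctx.prod volume) with hJ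
  have hK : 0 < B ^ 2 / e ^ 2 := by positivity
  -- If the derivative `J` were positive, the step `s = J / (2K)`, capped at `1`, in `J ≤ s K` with
  -- `K = B² / e²` would give `J ≤ J / 2`.
  have h1 := hstep (min 1 (J / (2 * (B ^ 2 / e ^ 2)))) (lt_min one_pos (by positivity))
    (min_le_left _ _)
  have h2 : min 1 (J / (2 * (B ^ 2 / e ^ 2))) * (B ^ 2 / e ^ 2) ≤
      J / (2 * (B ^ 2 / e ^ 2)) * (B ^ 2 / e ^ 2) := by gcongr; exact min_le_right _ _
  have h3 : J / (2 * (B ^ 2 / e ^ 2)) * (B ^ 2 / e ^ 2) = J / 2 := by field_simp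
  linarith

/-- Optimality is tested against the point mass at `i`, whose density is `e + (1 - e) S`. The ratio
minus one is then `(1 - e) S / q - (1 - e / q)`, and the last bracket is at most the indicator of
the covered set. The factor `2` is `1 / (1 - e)` with `e ≤ 1/2`. -/
lemma integral_smooth_div_density_le (hπ : ∀ i, Measurable (π i)) (hL : 1 ≤ L) (hm : 1 ≤ m)
    {Q : ι → ℝ} (hQ : Q ∈ simplexOn A)
    (hmax : ∀ R ∈ simplexOn A,
      ∫ p : 𝓧 × I, Real.log (actionDensity π L m R p.1 p.2) ∂(ctx.prod volume) ≤
        ∫ p : 𝓧 × I, Real.log (actionDensity π L m Q p.1 p.2) ∂(ctx.prod volume))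
    {i : ι} (hi : i ∈ A) :
    ∫ x, (∫ a : I, smoothDensity (bandwidth m) (π i x) a *
      (actionDensity π L m Q x a)⁻¹) ∂ctx ≤ 2 * charVolume ctx π m A := by
  classical
  set e := explore L m with he_def
  have he : 0 < e := explore_pos hL m
  have he2 : e ≤ 1 / 2 := explore_le_half L m
  set q : 𝓧 × I → ℝ := fun p => actionDensity π L m Q p.1 p.2 with hq
  set S : 𝓧 × I → ℝ := fun p => smoothDensity (bandwidth m) (π i p.1) p.2 with hS
  have hqm : Measurable q := measurable_actionDensity hπ L m Q
  have hSm : Measurable S := measurable_smoothDensity_policy (hπ i) _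
  have hqe : ∀ p, e ≤ q p := fun p => explore_le_actionDensity hQ p.1 p.2
  have hS0 : ∀ p, 0 ≤ S p := fun p => smoothDensity_nonneg _ _ _
  have hSB : ∀ p, S p ≤ (bandwidth m)⁻¹ := fun p =>
    smoothDensity_le (bandwidth_pos m) (bandwidth_le_half hm) _ _
  have hint : Integrable (fun p => S p * (q p)⁻¹) (ctx.prod volume) := by
    refine integrable_of_abs_le (hSm.mul hqm.inv) ((bandwidth m)⁻¹ * e⁻¹) fun p => ?_
    rw [abs_of_nonneg (mul_nonneg (hS0 p) (inv_nonneg.2 (he.le.trans (hqe p))))]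
    exact mul_le_mul (hSB p) (inv_anti₀ he (hqe p)) (inv_nonneg.2 (he.le.trans (hqe p)))
      (inv_nonneg.2 (bandwidth_pos m).le)
  have hratio := integral_density_ratio_le_one (ctx := ctx) hπ hL hm hQ
    (single_mem_simplexOn hi) hmax
  have hind : Integrable ((coveredSet π m A).indicator (fun _ => (1 : ℝ))) (ctx.prod volume) :=
    (integrable_const _).indicator (measurableSet_coveredSet hπ)
  have hpt : ∀ p : 𝓧 × I, (1 - e) * (S p * (q p)⁻¹) -
      (coveredSet π m A).indicator (fun _ => (1 : ℝ)) p ≤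
      (actionDensity π L m (Pi.single i 1) p.1 p.2 - q p) / q p := by
    intro p
    have hq0 : 0 < q p := he.trans_le (hqe p)
    have h1 : (actionDensity π L m (Pi.single i 1) p.1 p.2 - q p) / q p =
        (1 - e) * (S p * (q p)⁻¹) - (1 - e / q p) := by
      rw [actionDensity_single]
      simp only [hS, ← he_def]
      field_simp
      ring
    rw [h1]
    have h2 : 1 - e / q p ≤ (coveredSet π m A).indicator (fun _ => (1 : ℝ)) p := by
      by_cases hp : p ∈ coveredSet π m A
      · rw [indicator_of_mem hp]
        have : 0 ≤ e / q p := by positivity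
        linarith
      · rw [indicator_of_notMem hp]
        -- Off the covered set all smoothed densities carrying weight vanish, so only uniform
        -- exploration remains.
        have h3 : q p = e := by
          simp only [hq, actionDensity, ← he_def]
          rw [Finset.sum_eq_zero, mul_zero, add_zero]
          intro j _
          by_cases hj : j ∈ A
          · have : ¬ dist p.2 (π j p.1) ≤ bandwidth m := fun h => hp ⟨j, hj, h⟩
            simp [smoothDensity, this]
          · rw [hQ.2.1 j hj, zero_mul]
        rw [h3, div_self he.ne', sub_self]
    linarith
  have hint2 : Integrable (fun p : 𝓧 × I =>
      (actionDensity π L m (Pi.single i 1) p.1 p.2 - q p) / q p) (ctx.prod volume) := by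
    refine integrable_of_abs_le (((measurable_actionDensity hπ L m _).sub hqm).div hqm)
      ((1 + (bandwidth m)⁻¹) / e) fun p => ?_
    rw [abs_div, abs_of_pos (he.trans_le (hqe p))]
    have h1 := actionDensity_le (π := π) hL hm hQ p.1 p.2
    have h2 := actionDensity_le (π := π) hL hm (single_mem_simplexOn hi) p.1 p.2
    have h3 := actionDensity_pos (π := π) (m := m) hL hQ p.1 p.2
    have h4 := actionDensity_pos (π := π) (m := m) hL (single_mem_simplexOn hi) p.1 p.2
    refine div_le_div₀ (by linarith) ?_ he (hqe p)
    rw [abs_le]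
    constructor <;> simp only [hq] <;> linarith
  have hmono := integral_mono ((hint.const_mul (1 - e)).sub hind) hint2 hpt
  rw [integral_sub' (hint.const_mul (1 - e)) hind, integral_const_mul,
    integral_indicator_coveredSet hπ, integral_prod _ hint] at hmono
  have h0 : 0 ≤ ∫ x, (∫ a : I, S (x, a) * (q (x, a))⁻¹) ∂ctx :=
    integral_nonneg fun x => integral_nonneg fun a =>
      mul_nonneg (hS0 _) (inv_nonneg.2 (he.le.trans (hqe _)))
  have h1 : (1 - e) * ∫ x, (∫ a : I, S (x, a) * (q (x, a))⁻¹) ∂ctx ≤ charVolume ctx π m A := by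
    have := hmono.trans hratio
    linarith
  change ∫ x, (∫ a : I, S (x, a) * (q (x, a))⁻¹) ∂ctx ≤ _
  nlinarith

/-- The algorithm minimizes the worst case over the active policies, so it does no worse than the
log-optimal design, which serves only as a comparison. -/
lemma IsOptimalSelection.integral_smooth_div_density_le {Q : ℕ → Finset ι → ι → ℝ}
    (hsel : IsOptimalSelection ctx π L Q) (hπ : ∀ i, Measurable (π i)) (hL : 1 ≤ L) (hm : 1 ≤ m)
    {i : ι} (hi : i ∈ A) :
    ∫ x, (∫ a : I, smoothDensity (bandwidth m) (π i x) a *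
      (actionDensity π L m (Q m A) x a)⁻¹) ∂ctx ≤ 2 * charVolume ctx π m A := by
  have hA : A.Nonempty := ⟨i, hi⟩
  obtain ⟨R, hR, hmax⟩ := exists_maximal_design (ctx := ctx) hπ hL hm hA
  have : Nonempty A := ⟨⟨i, hi⟩⟩
  calc _ ≤ objective ctx π L m A (Q m A) :=
        le_ciSup (f := fun j : A => ∫ x, (∫ a : I, smoothDensity (bandwidth m) (π j x) a *
          (actionDensity π L m (Q m A) x a)⁻¹) ∂ctx) (Set.finite_range _).bddAbove ⟨i, hi⟩
    _ ≤ objective ctx π L m A R := (hsel m hm A hA).2 hR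
    _ ≤ _ := ciSup_le fun j => SmoothPE.integral_smooth_div_density_le hπ hL hm hR hmax j.2

end Design

/-! ### The law of one round -/

section RoundLaw

variable {𝓧 : Type u} [MeasurableSpace 𝓧] {𝓛 : Type v} [MeasurableSpace 𝓛]
  {ctx : Measure 𝓧} [IsProbabilityMeasure ctx] {lossLaw : Kernel 𝓧 𝓛} [IsMarkovKernel lossLaw]
  {loss : 𝓛 → I → I}

/-- The expected loss of the policy `f` smoothed with bandwidth `h`. -/
noncomputable def smoothedLoss (ctx : Measure 𝓧) (lossLaw : Kernel 𝓧 𝓛) (loss : 𝓛 → I → I)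
    (h : ℝ) (f : 𝓧 → I) : ℝ :=
  ∫ p, (∫ a : I, smoothDensity h (f p.1) a * (loss p.2 a : ℝ)) ∂(ctx ⊗ₘ lossLaw)

lemma measurable_loss_apply (hloss : Measurable (Function.uncurry loss)) {f : 𝓧 → I}
    (hf : Measurable f) : Measurable fun p : 𝓧 × 𝓛 => (loss p.2 (f p.1) : ℝ) :=
  measurable_subtype_coe.comp
    (hloss.comp (measurable_snd.prodMk (hf.comp measurable_fst)))

lemma measurable_smooth_mul_loss (hloss : Measurable (Function.uncurry loss)) {f : 𝓧 → I}
    (hf : Measurable f) (h : ℝ) :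
    Measurable fun z : (𝓧 × 𝓛) × I => smoothDensity h (f z.1.1) z.2 * (loss z.1.2 z.2 : ℝ) :=
  ((measurable_smoothDensity h).comp
    ((hf.comp measurable_fst.fst).prodMk measurable_snd)).mul
    (measurable_subtype_coe.comp (hloss.comp (measurable_fst.snd.prodMk measurable_snd)))

omit [MeasurableSpace 𝓛] in
lemma abs_smooth_mul_loss_le {h : ℝ} (h0 : 0 < h) (h1 : h ≤ 1 / 2) (b a : I) (ω : 𝓛) :
    |smoothDensity h b a * (loss ω a : ℝ)| ≤ h⁻¹ := by
  have h2 := smoothDensity_nonneg h b a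
  rw [abs_of_nonneg (mul_nonneg h2 (loss ω a).2.1)]
  exact (mul_le_of_le_one_right h2 (loss ω a).2.2).trans (smoothDensity_le h0 h1 b a)

lemma integrable_smooth_mul_loss (hloss : Measurable (Function.uncurry loss)) {f : 𝓧 → I}
    (hf : Measurable f) {h : ℝ} (h0 : 0 < h) (h1 : h ≤ 1 / 2) (ν : Measure ((𝓧 × 𝓛) × I))
    [IsFiniteMeasure ν] :
    Integrable (fun z : (𝓧 × 𝓛) × I =>
      smoothDensity h (f z.1.1) z.2 * (loss z.1.2 z.2 : ℝ)) ν :=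
  integrable_of_abs_le (measurable_smooth_mul_loss hloss hf h) h⁻¹ fun _ =>
    abs_smooth_mul_loss_le h0 h1 _ _ _

omit [IsProbabilityMeasure ctx] in
-- Single loss functions need not be Lipschitz, only their conditional mean. Fubini therefore
-- averages over the outcome first, and the Lipschitz bound is applied on the ball that carries the
-- smoothing density.
lemma abs_integral_smooth_sub_le (hloss : Measurable (Function.uncurry loss)) {L h : ℝ}
    (hL : 0 ≤ L) (h0 : 0 < h) (h1 : h ≤ 1 / 2) (x : 𝓧) (b : I)
    (hlip : ∀ a a' : I,
      |(∫ ω, (loss ω a : ℝ) ∂(lossLaw x)) - ∫ ω, (loss ω a' : ℝ) ∂(lossLaw x)|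
        ≤ L * dist a a') :
    |(∫ ω, (∫ a : I, smoothDensity h b a * (loss ω a : ℝ)) ∂(lossLaw x)) -
      ∫ ω, (loss ω b : ℝ) ∂(lossLaw x)| ≤ L * h := by
  have hint : Integrable (Function.uncurry fun (ω : 𝓛) (a : I) =>
      smoothDensity h b a * (loss ω a : ℝ)) ((lossLaw x).prod volume) := by
    refine integrable_of_abs_le ?_ h⁻¹ fun z => abs_smooth_mul_loss_le h0 h1 _ _ _
    exact ((measurable_smoothDensity_right h b).comp measurable_snd).mul
      (measurable_subtype_coe.comp hloss)
  rw [integral_integral_swap hint]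
  have hint2 := hint.integral_prod_right
  simp only [Function.uncurry, integral_const_mul] at hint2
  simp only [integral_const_mul]
  set lam : I → ℝ := fun a => ∫ ω, (loss ω a : ℝ) ∂(lossLaw x) with hlam
  have hS := integrable_smoothDensity h0 h1 b
  have hsplit : (∫ a, smoothDensity h b a * lam a) - lam b =
      ∫ a, smoothDensity h b a * (lam a - lam b) := by
    simp_rw [mul_sub]
    rw [integral_sub hint2 (hS.mul_const _), integral_mul_const, integral_smoothDensity h0 h1,
      one_mul]
  change |(∫ a, smoothDensity h b a * lam a) - lam b| ≤ L * h
  rw [hsplit, ← Real.norm_eq_abs]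
  calc ‖∫ a, smoothDensity h b a * (lam a - lam b)‖
      ≤ ∫ a, smoothDensity h b a * (L * h) := by
        refine norm_integral_le_of_norm_le (hS.mul_const _)
          (Filter.Eventually.of_forall fun a => ?_)
        rw [norm_mul, Real.norm_of_nonneg (smoothDensity_nonneg _ _ _), Real.norm_eq_abs]
        by_cases hab : dist a b ≤ h
        · gcongr
          · exact smoothDensity_nonneg _ _ _
          · exact (hlip a b).trans (by gcongr)
        · simp [smoothDensity, hab]
    _ = L * h := by rw [integral_mul_const, integral_smoothDensity h0 h1, one_mul]

lemma integrable_integral_compProd {f : 𝓧 × 𝓛 → ℝ} (hf : Integrable f (ctx ⊗ₘ lossLaw)) :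
    Integrable (fun x => ∫ ω, f (x, ω) ∂(lossLaw x)) ctx := by
  simpa using Integrable.integral_compProd (κ := Kernel.const Unit ctx) (a := ()) hf

lemma abs_smoothedLoss_sub_le (hloss : Measurable (Function.uncurry loss)) {L h : ℝ}
    (hL : 0 ≤ L) (h0 : 0 < h) (h1 : h ≤ 1 / 2) {f : 𝓧 → I} (hf : Measurable f)
    (hlip : ∀ x : 𝓧, ∀ a a' : I,
      |(∫ ω, (loss ω a : ℝ) ∂(lossLaw x)) - ∫ ω, (loss ω a' : ℝ) ∂(lossLaw x)|
        ≤ L * dist a a') :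
    |smoothedLoss ctx lossLaw loss h f - policyLoss ctx lossLaw loss f| ≤ L * h := by
  have hi1 : Integrable (fun p : 𝓧 × 𝓛 =>
      ∫ a : I, smoothDensity h (f p.1) a * (loss p.2 a : ℝ)) (ctx ⊗ₘ lossLaw) :=
    (integrable_smooth_mul_loss hloss hf h0 h1 ((ctx ⊗ₘ lossLaw).prod volume)).integral_prod_left
  have hi2 : Integrable (fun p : 𝓧 × 𝓛 => (loss p.2 (f p.1) : ℝ)) (ctx ⊗ₘ lossLaw) :=
    integrable_of_abs_le (measurable_loss_apply hloss hf) 1 fun p => by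
      rw [abs_of_nonneg (loss p.2 (f p.1)).2.1]; exact (loss p.2 (f p.1)).2.2
  unfold smoothedLoss policyLoss
  rw [Measure.integral_compProd hi1, Measure.integral_compProd hi2,
    ← integral_sub (integrable_integral_compProd hi1) (integrable_integral_compProd hi2), ← Real.norm_eq_abs]
  refine (norm_integral_le_of_norm_le_const (C := L * h)
    (Filter.Eventually.of_forall fun x => ?_)).trans (by simp)
  exact abs_integral_smooth_sub_le hloss hL h0 h1 x (f x) (hlip x)

/-! ### Sampling from the action density: unbiasedness, second moment, expected loss -/

variable {ι : Type w} [Fintype ι] {π : ι → 𝓧 → I} {L : ℝ} {m : ℕ} {A : Finset ι} {Q : ι → ℝ}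

/-- The conditional law of the action given the context. -/
noncomputable def actionKernel (π : ι → 𝓧 → I) (L : ℝ) (m : ℕ) (Q : ι → ℝ) : Kernel 𝓧 I :=
  Kernel.withDensity (Kernel.const 𝓧 (volume : Measure I)) fun x a =>
    ENNReal.ofReal (actionDensity π L m Q x a)

lemma actionKernel_apply (hπ : ∀ i, Measurable (π i)) (x : 𝓧) :
    actionKernel π L m Q x =
      volume.withDensity fun a => ENNReal.ofReal (actionDensity π L m Q x a) := by
  unfold actionKernel
  rw [Kernel.withDensity_apply _ (measurable_actionDensity hπ L m Q).ennreal_ofReal,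
    Kernel.const_apply]

lemma isMarkovKernel_actionKernel (hπ : ∀ i, Measurable (π i)) (hL : 1 ≤ L) (hm : 1 ≤ m)
    (hQ : Q ∈ simplexOn A) : IsMarkovKernel (actionKernel π L m Q) where
  isProbabilityMeasure x := ⟨by
    rw [actionKernel_apply hπ, withDensity_apply _ MeasurableSet.univ, Measure.restrict_univ,
      ← ofReal_integral_eq_lintegral_ofReal, integral_actionDensity hm hQ, ENNReal.ofReal_one]
    -- A nonintegrable function has Bochner integral `0` by convention, whereas this integral is
    -- `1`.
    · by_contra hni
      have h1 := integral_undef hni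
      rw [integral_actionDensity hm hQ] at h1
      exact one_ne_zero h1
    · exact Filter.Eventually.of_forall fun a => (actionDensity_pos hL hQ x a).le⟩

lemma integral_actionKernel (hπ : ∀ i, Measurable (π i)) (hL : 1 ≤ L)
    (hQ : Q ∈ simplexOn A) (x : 𝓧) (g : I → ℝ) :
    ∫ a, g a ∂(actionKernel π L m Q x) = ∫ a, actionDensity π L m Q x a * g a := by
  rw [actionKernel_apply hπ, integral_withDensity_eq_integral_toReal_smul
    (measurable_actionDensity_right hπ x).ennreal_ofReal
    (Filter.Eventually.of_forall fun _ => ENNReal.ofReal_lt_top)]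
  simp only [ENNReal.toReal_ofReal (actionDensity_pos hL hQ x _).le, smul_eq_mul]

/-- The state is one in which the algorithm can draw an action. -/
def State.Proper (st : State ι) : Prop := 1 ≤ st.epoch ∧ st.active.Nonempty

variable {sel : ℕ → Finset ι → ι → ℝ} {st : State ι}

omit [IsProbabilityMeasure ctx] [IsMarkovKernel lossLaw] in
lemma roundLaw_apply (st : State ι) : roundLaw ctx lossLaw π L sel st =
    (ctx ⊗ₘ lossLaw) ⊗ₘ
      Kernel.prodMkRight 𝓛 (actionKernel π L st.epoch (sel st.epoch st.active)) := rfl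

omit [IsProbabilityMeasure ctx] in
lemma IsOptimalSelection.mem_simplexOn (hsel : IsOptimalSelection ctx π L sel)
    (hst : st.Proper) : sel st.epoch st.active ∈ simplexOn st.active :=
  (hsel _ hst.1 _ hst.2).1

lemma isProbabilityMeasure_roundLaw (hsel : IsOptimalSelection ctx π L sel)
    (hπ : ∀ i, Measurable (π i)) (hL : 1 ≤ L) (hst : st.Proper) :
    IsProbabilityMeasure (roundLaw ctx lossLaw π L sel st) := by
  have := isMarkovKernel_actionKernel hπ hL hst.1 (hsel.mem_simplexOn hst)
  rw [roundLaw_apply]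
  infer_instance

lemma integral_roundLaw (hsel : IsOptimalSelection ctx π L sel)
    (hπ : ∀ i, Measurable (π i)) (hL : 1 ≤ L) (hst : st.Proper) {f : Round 𝓧 𝓛 → ℝ}
    (hf : Measurable f) (C : ℝ) (hC : ∀ z, |f z| ≤ C) :
    ∫ z, f z ∂(roundLaw ctx lossLaw π L sel st) =
      ∫ p, (∫ a, actionDensity π L st.epoch (sel st.epoch st.active) p.1 a * f (p, a))
        ∂(ctx ⊗ₘ lossLaw) := by
  have hQ := hsel.mem_simplexOn hst
  have := isMarkovKernel_actionKernel hπ hL hst.1 hQ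
  rw [roundLaw_apply, Measure.integral_compProd (integrable_of_abs_le hf C hC)]
  simp only [Kernel.prodMkRight_apply, integral_actionKernel hπ hL hQ]

omit [MeasurableSpace 𝓧] in
lemma abs_ipsLoss_le (hL : 1 ≤ L) (hm : 1 ≤ m) (hQ : Q ∈ simplexOn A) (i : ι) (o : Obs 𝓧) :
    |ipsLoss π L m Q i o| ≤ (bandwidth m)⁻¹ / explore L m := by
  unfold ipsLoss
  rw [abs_div, abs_of_pos (actionDensity_pos hL hQ _ _),
    abs_of_nonneg (mul_nonneg (smoothDensity_nonneg _ _ _) o.2.2.2.1)]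
  refine div_le_div₀ (inv_nonneg.2 (bandwidth_pos m).le) ?_ (explore_pos hL m)
    (explore_le_actionDensity hQ _ _)
  exact (mul_le_of_le_one_right (smoothDensity_nonneg _ _ _) o.2.2.2.2).trans
    (smoothDensity_le (bandwidth_pos m) (bandwidth_le_half hm) _ _)

lemma measurable_ipsLoss_observe (hloss : Measurable (Function.uncurry loss))
    (hπ : ∀ i, Measurable (π i)) (i : ι) :
    Measurable fun z : Round 𝓧 𝓛 => ipsLoss π L m Q i (observe loss z) :=
  (measurable_ipsLoss hπ L m Q i).comp (measurable_observe hloss)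

/-- Unbiasedness: the sampling density cancels the denominator of the importance weight. -/
lemma integral_ipsLoss (hsel : IsOptimalSelection ctx π L sel)
    (hloss : Measurable (Function.uncurry loss)) (hπ : ∀ i, Measurable (π i)) (hL : 1 ≤ L)
    (hst : st.Proper) (i : ι) :
    ∫ z, ipsLoss π L st.epoch (sel st.epoch st.active) i (observe loss z)
      ∂(roundLaw ctx lossLaw π L sel st) =
      smoothedLoss ctx lossLaw loss (bandwidth st.epoch) (π i) := by
  have hQ := hsel.mem_simplexOn hst
  rw [integral_roundLaw hsel hπ hL hst (measurable_ipsLoss_observe hloss hπ i) _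
    fun z => abs_ipsLoss_le hL hst.1 hQ i _]
  unfold smoothedLoss
  refine integral_congr_ae (Filter.Eventually.of_forall fun p =>
    integral_congr_ae (Filter.Eventually.of_forall fun a => ?_))
  simp only [ipsLoss, observe]
  rw [mul_div_cancel₀ _ (actionDensity_pos hL hQ p.1 a).ne']

lemma measurable_smoothDensity_context {f : 𝓧 → I} (hf : Measurable f) (h : ℝ) :
    Measurable fun z : (𝓧 × 𝓛) × I => smoothDensity h (f z.1.1) z.2 :=
  (measurable_smoothDensity h).comp ((hf.comp measurable_fst.fst).prodMk measurable_snd)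

lemma measurable_actionDensity_context (hπ : ∀ i, Measurable (π i)) :
    Measurable fun z : (𝓧 × 𝓛) × I => actionDensity π L m Q z.1.1 z.2 :=
  Measurable.comp (g := Function.uncurry (actionDensity π L m Q))
    (f := fun z : (𝓧 × 𝓛) × I => (z.1.1, z.2)) (measurable_actionDensity hπ L m Q)
    (measurable_fst.fst.prodMk measurable_snd)

/-- After one factor `q` cancels, the integrand is `(S ℓ²) · (S / q)`. The first factor is at most
`1 / h`, and the integral of the second is controlled by the design bound. -/
lemma integral_ipsLoss_sq_le (hsel : IsOptimalSelection ctx π L sel)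
    (hloss : Measurable (Function.uncurry loss)) (hπ : ∀ i, Measurable (π i)) (hL : 1 ≤ L)
    (hst : st.Proper) {i : ι} (hi : i ∈ st.active) :
    ∫ z, ipsLoss π L st.epoch (sel st.epoch st.active) i (observe loss z) ^ 2
      ∂(roundLaw ctx lossLaw π L sel st) ≤
      2 * charVolume ctx π st.epoch st.active / bandwidth st.epoch := by
  have hQ := hsel.mem_simplexOn hst
  set m := st.epoch with hm
  set Q := sel m st.active with hQd
  set h := bandwidth m with hh
  have h0 : 0 < h := bandwidth_pos m
  have h1 : h ≤ 1 / 2 := bandwidth_le_half hst.1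
  have he := explore_pos hL m
  have hS : Measurable fun z : (𝓧 × 𝓛) × I => smoothDensity h (π i z.1.1) z.2 :=
    measurable_smoothDensity_context (hπ i) h
  have hq : Measurable fun z : (𝓧 × 𝓛) × I => actionDensity π L m Q z.1.1 z.2 :=
    measurable_actionDensity_context hπ
  have hfm : Measurable fun z : Round 𝓧 𝓛 => ipsLoss π L m Q i (observe loss z) ^ 2 :=
    (measurable_ipsLoss_observe hloss hπ i).pow_const 2
  have hfb : ∀ z : Round 𝓧 𝓛, |ipsLoss π L m Q i (observe loss z) ^ 2| ≤
      (h⁻¹ / explore L m) ^ 2 := fun z => by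
    rw [abs_pow]
    exact pow_le_pow_left₀ (abs_nonneg _) (abs_ipsLoss_le hL hst.1 hQ i _) 2
  rw [integral_roundLaw hsel hπ hL hst hfm _ hfb]
  have hgint : Integrable (fun z : (𝓧 × 𝓛) × I => h⁻¹ * (smoothDensity h (π i z.1.1) z.2 *
      (actionDensity π L m Q z.1.1 z.2)⁻¹)) ((ctx ⊗ₘ lossLaw).prod volume) := by
    refine Integrable.const_mul ?_ _
    refine integrable_of_abs_le (hS.mul hq.inv) (h⁻¹ * (explore L m)⁻¹) fun z => ?_
    rw [abs_of_nonneg (mul_nonneg (smoothDensity_nonneg _ _ _)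
      (inv_nonneg.2 (actionDensity_pos hL hQ _ _).le))]
    exact mul_le_mul (smoothDensity_le h0 h1 _ _)
      (inv_anti₀ he (explore_le_actionDensity hQ _ _))
      (inv_nonneg.2 (actionDensity_pos hL hQ _ _).le) (inv_nonneg.2 h0.le)
  have hfint : Integrable (fun z : (𝓧 × 𝓛) × I => actionDensity π L m Q z.1.1 z.2 *
      ipsLoss π L m Q i (observe loss z) ^ 2) ((ctx ⊗ₘ lossLaw).prod volume) := by
    refine integrable_of_abs_le (hq.mul hfm) ((1 + h⁻¹) * (h⁻¹ / explore L m) ^ 2) fun z => ?_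
    rw [abs_mul, abs_of_pos (actionDensity_pos hL hQ _ _)]
    exact mul_le_mul (actionDensity_le hL hst.1 hQ _ _) (hfb z) (abs_nonneg _) (by positivity)
  have hpt : ∀ z : (𝓧 × 𝓛) × I, actionDensity π L m Q z.1.1 z.2 *
      ipsLoss π L m Q i (observe loss z) ^ 2 ≤ h⁻¹ * (smoothDensity h (π i z.1.1) z.2 *
      (actionDensity π L m Q z.1.1 z.2)⁻¹) := by
    intro z
    have hq0 := actionDensity_pos (π := π) (m := m) hL hQ z.1.1 z.2
    have hS0 := smoothDensity_nonneg h (π i z.1.1) z.2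
    have hS1 := smoothDensity_le h0 h1 (π i z.1.1) z.2
    have hl0 : (0 : ℝ) ≤ loss z.1.2 z.2 := (loss z.1.2 z.2).2.1
    have hl1 : (loss z.1.2 z.2 : ℝ) ≤ 1 := (loss z.1.2 z.2).2.2
    have e : actionDensity π L m Q z.1.1 z.2 * ipsLoss π L m Q i (observe loss z) ^ 2 =
        (smoothDensity h (π i z.1.1) z.2 * (loss z.1.2 z.2 : ℝ) ^ 2) *
          (smoothDensity h (π i z.1.1) z.2 * (actionDensity π L m Q z.1.1 z.2)⁻¹) := by
      have h3 : ∀ q S l : ℝ, 0 < q → q * (S * l / q) ^ 2 = S * l ^ 2 * (S * q⁻¹) := by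
        intro q S l hq
        field_simp
      exact h3 _ _ _ hq0
    rw [e]
    refine mul_le_mul_of_nonneg_right ?_ (mul_nonneg hS0 (inv_nonneg.2 hq0.le))
    exact (mul_le_of_le_one_right hS0 (pow_le_one₀ hl0 hl1)).trans hS1
  have key : ∫ p, (∫ a, actionDensity π L m Q p.1 a *
        ipsLoss π L m Q i (observe loss (p, a)) ^ 2) ∂(ctx ⊗ₘ lossLaw) ≤
      ∫ p, (∫ a, h⁻¹ * (smoothDensity h (π i p.1) a *
        (actionDensity π L m Q p.1 a)⁻¹)) ∂(ctx ⊗ₘ lossLaw) := by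
    rw [← integral_prod _ hfint, ← integral_prod _ hgint]
    exact integral_mono hfint hgint hpt
  refine key.trans ?_
  rw [Measure.integral_compProd hgint.integral_prod_left]
  simp only [integral_const_mul, integral_const, probReal_univ, smul_eq_mul, one_mul]
  have hdes := hsel.integral_smooth_div_density_le hπ hL hst.1 hi
  rw [div_eq_inv_mul]
  exact mul_le_mul_of_nonneg_left hdes (inv_nonneg.2 h0.le)

/-- The density is a mixture. Its uniform part has weight `μ ≤ r` and losses at most `1`; the rest
averages the smoothed losses of active policies. -/
lemma integral_loss_roundLaw_le (hsel : IsOptimalSelection ctx π L sel)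
    (hloss : Measurable (Function.uncurry loss)) (hπ : ∀ i, Measurable (π i)) (hL : 1 ≤ L)
    (hst : st.Proper) {c : ℝ}
    (hc : ∀ i ∈ st.active, smoothedLoss ctx lossLaw loss (bandwidth st.epoch) (π i) ≤ c) :
    ∫ z, (loss z.1.2 z.2 : ℝ) ∂(roundLaw ctx lossLaw π L sel st) ≤
      radius L st.epoch + c := by
  have hQ := hsel.mem_simplexOn hst
  have hlm : Measurable fun z : Round 𝓧 𝓛 => (loss z.1.2 z.2 : ℝ) :=
    measurable_subtype_coe.comp (hloss.comp (measurable_fst.snd.prodMk measurable_snd))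
  have hlb : ∀ z : Round 𝓧 𝓛, |(loss z.1.2 z.2 : ℝ)| ≤ 1 := fun z => by
    rw [abs_of_nonneg (loss z.1.2 z.2).2.1]; exact (loss z.1.2 z.2).2.2
  rw [integral_roundLaw hsel hπ hL hst hlm 1 hlb]
  set m := st.epoch with hm
  set Q := sel m st.active with hQd
  have hint0 : Integrable (fun z : Round 𝓧 𝓛 => explore L m * (loss z.1.2 z.2 : ℝ))
    ((ctx ⊗ₘ lossLaw).prod volume) := (integrable_of_abs_le hlm 1 hlb).const_mul _
  have hint1 : ∀ i, Integrable (fun z : Round 𝓧 𝓛 =>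
      smoothDensity (bandwidth m) (π i z.1.1) z.2 * (loss z.1.2 z.2 : ℝ))
      ((ctx ⊗ₘ lossLaw).prod volume) := fun i =>
    integrable_smooth_mul_loss hloss (hπ i) (bandwidth_pos m) (bandwidth_le_half hst.1) _
  have hint2 : Integrable (fun z : Round 𝓧 𝓛 => ∑ i, (1 - explore L m) * Q i *
      (smoothDensity (bandwidth m) (π i z.1.1) z.2 * (loss z.1.2 z.2 : ℝ)))
      ((ctx ⊗ₘ lossLaw).prod volume) :=
    integrable_finsetSum _ fun i _ => (hint1 i).const_mul _
  have hsplit : ∀ z : Round 𝓧 𝓛,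
      actionDensity π L m Q z.1.1 z.2 * (loss z.1.2 z.2 : ℝ) =
      explore L m * (loss z.1.2 z.2 : ℝ) + ∑ i, (1 - explore L m) * Q i *
      (smoothDensity (bandwidth m) (π i z.1.1) z.2 * (loss z.1.2 z.2 : ℝ)) := fun z => by
    simp only [actionDensity, add_mul, Finset.mul_sum, Finset.sum_mul]
    congr 1
    exact Finset.sum_congr rfl fun i _ => by ring
  have htot : ∫ p, (∫ a, actionDensity π L m Q p.1 a * (loss p.2 a : ℝ)) ∂(ctx ⊗ₘ lossLaw) =
      ∫ z, explore L m * (loss z.1.2 z.2 : ℝ) ∂((ctx ⊗ₘ lossLaw).prod volume) +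
      ∑ i, (1 - explore L m) * Q i *
        smoothedLoss ctx lossLaw loss (bandwidth m) (π i) := by
    have hsum : Integrable (fun z : Round 𝓧 𝓛 =>
        actionDensity π L m Q z.1.1 z.2 * (loss z.1.2 z.2 : ℝ)) ((ctx ⊗ₘ lossLaw).prod volume) :=
      (hint0.add hint2).congr (Filter.Eventually.of_forall fun z => (hsplit z).symm)
    rw [← integral_prod _ hsum, integral_congr_ae (Filter.Eventually.of_forall hsplit),
      integral_add hint0 hint2, integral_finsetSum _ fun i _ => (hint1 i).const_mul _]
    congr 1
    refine Finset.sum_congr rfl fun i _ => ?_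
    rw [integral_const_mul, integral_prod _ (hint1 i)]
    rfl
  rw [htot]
  have he0 := explore_pos hL m
  have he2 := explore_le_half L m
  have h1 : ∫ z, explore L m * (loss z.1.2 z.2 : ℝ) ∂((ctx ⊗ₘ lossLaw).prod volume) ≤
      explore L m := by
    calc _ ≤ ∫ _, explore L m ∂((ctx ⊗ₘ lossLaw).prod (volume : Measure I)) :=
          integral_mono hint0 (integrable_const _) fun z =>
            mul_le_of_le_one_right he0.le (loss z.1.2 z.2).2.2
      _ = explore L m := by simp
  -- Nonnegativity of `c` allows the factor `1 - μ` of the policy part to be dropped.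
  have hc0 : 0 ≤ c := by
    obtain ⟨i, hi⟩ := hst.2
    refine le_trans ?_ (hc i hi)
    exact integral_nonneg fun p => integral_nonneg fun a =>
      mul_nonneg (smoothDensity_nonneg _ _ _) (loss p.2 a).2.1
  have h2 : ∑ i, (1 - explore L m) * Q i *
      smoothedLoss ctx lossLaw loss (bandwidth m) (π i) ≤ c := by
    calc _ ≤ ∑ i, (1 - explore L m) * Q i * c := by
          refine Finset.sum_le_sum fun i _ => ?_
          by_cases hi : i ∈ st.active
          · exact mul_le_mul_of_nonneg_left (hc i hi) (mul_nonneg (by linarith) (hQ.1 i))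
          · rw [hQ.2.1 i hi]; simp
      _ = (1 - explore L m) * c := by
          rw [← Finset.sum_mul, ← Finset.mul_sum, hQ.2.2, mul_one]
      _ ≤ c := mul_le_of_le_one_left hc0 (by linarith)
  have h3 := explore_le_radius L m
  linarith

end RoundLaw

/-! ### Concentration of the median of means -/

section Median

/-- If the median is too large, the upper middle entry and everything above it in sorted order is
too large; if too small, the lower middle entry and everything below. Either side contains at least
half of the entries. -/
lemma card_le_two_mul_of_median_far {k : ℕ} (hk : 0 < k) (v : Fin k → ℝ) {μ c : ℝ}
    (h : c < |median v - μ|) :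
    k ≤ 2 * (Finset.univ.filter fun b => c ≤ |v b - μ|).card := by
  classical
  set w := v ∘ Tuple.sort v with hw
  have hmono : Monotone w := Tuple.monotone_sort v
  have hcard : (Finset.univ.filter fun b => c ≤ |v b - μ|).card =
      (Finset.univ.filter fun b => c ≤ |w b - μ|).card := by
    rw [Finset.card_filter, Finset.card_filter,
      ← Equiv.sum_comp (Tuple.sort v) (fun b => if c ≤ |v b - μ| then 1 else 0)]
    rfl
  rw [hcard]
  set lo : Fin k := ⟨(k - 1) / 2, by omega⟩ with hlo
  set hi : Fin k := ⟨k / 2, by omega⟩ with hhi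
  have hmed : median v = (w lo + w hi) / 2 := by
    unfold median
    rw [dif_pos hk]
  have hlohi : w lo ≤ w hi := hmono (by
    rw [Fin.le_def]
    simp only [hlo, hhi]
    omega)
  rcases lt_abs.1 h with h1 | h1
  · have hsub : Finset.Ici hi ⊆ Finset.univ.filter fun b => c ≤ |w b - μ| := by
      intro b hb
      have h2 : w hi ≤ w b := hmono (Finset.mem_Ici.1 hb)
      rw [Finset.mem_filter]
      refine ⟨Finset.mem_univ _, le_trans ?_ (le_abs_self _)⟩
      linarith
    have h3 := Finset.card_le_card hsub
    rw [Fin.card_Ici] at h3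
    simp only [hhi] at h3
    omega
  · have hsub : Finset.Iic lo ⊆ Finset.univ.filter fun b => c ≤ |w b - μ| := by
      intro b hb
      have h2 : w b ≤ w lo := hmono (Finset.mem_Iic.1 hb)
      rw [Finset.mem_filter]
      refine ⟨Finset.mem_univ _, le_trans ?_ (neg_le_abs _)⟩
      linarith
    have h3 := Finset.card_le_card hsub
    rw [Fin.card_Iic] at h3
    simp only [hlo] at h3
    omega

end Median

/-! ### Independence across disjoint blocks -/

section Blocks

variable {Ω : Type*} [MeasurableSpace Ω] {P : Measure Ω} [IsProbabilityMeasure P]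
  {β κ : Type*} [DecidableEq β]

/-- Extension by zero of a family of reals indexed by a finite set. -/
noncomputable def zeroExtend (J : Finset β) (y : J → ℝ) (i : β) : ℝ :=
  if h : i ∈ J then y ⟨i, h⟩ else 0

lemma measurable_zeroExtend (J : Finset β) : Measurable (zeroExtend J) := by
  refine measurable_pi_lambda _ fun i => ?_
  unfold zeroExtend
  split_ifs with h
  · exact measurable_pi_apply _
  · exact measurable_const

/-- Events determined by disjoint blocks of independent random variables are independent. -/
lemma measure_biInter_blocks {f : β → Ω → ℝ} (hf : iIndepFun f P)
    (hfm : ∀ i, Measurable (f i)) {J : κ → Finset β} {G : κ → Set (β → ℝ)}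
    (hJ : Pairwise fun a b => Disjoint (J a) (J b)) (hG : ∀ b, MeasurableSet (G b))
    (hdep : ∀ b, ∀ y y' : β → ℝ, (∀ i ∈ J b, y i = y' i) → (y ∈ G b → y' ∈ G b))
    (S : Finset κ) :
    P (⋂ b ∈ S, {ω | (fun i => f i ω) ∈ G b}) = ∏ b ∈ S, P {ω | (fun i => f i ω) ∈ G b} := by
  classical
  -- An event that depends only on coordinates in `K` is unchanged when the others are set to zero.
  -- It thus becomes a preimage under the restricted family, the form that independence of finite
  -- subfamilies requires.
  have hrepr : ∀ b (K : Finset β), J b ⊆ K → {ω | (fun i => f i ω) ∈ G b} =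
      (fun ω (i : K) => f i ω) ⁻¹' (zeroExtend K ⁻¹' G b) := by
    intro b K hK
    ext ω
    have hagree : ∀ i ∈ J b, f i ω = zeroExtend K (fun i : K => f i ω) i := fun i hi => by
      unfold zeroExtend
      rw [dif_pos (hK hi)]
    exact ⟨hdep b _ _ hagree, hdep b _ _ fun i hi => (hagree i hi).symm⟩
  induction S using Finset.induction_on with
  | empty => simp
  | insert b S hb ih =>
    rw [Finset.prod_insert hb, ← ih, Finset.set_biInter_insert]
    have hdisj : Disjoint (J b) (S.biUnion J) := by
      rw [Finset.disjoint_biUnion_right]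
      intro c hc
      exact hJ fun h => hb (h ▸ hc)
    have hind := hf.indepFun_finset _ _ hdisj hfm
    have h1 := hrepr b (J b) subset_rfl
    have h2 : (⋂ c ∈ S, {ω | (fun i => f i ω) ∈ G c}) =
        (fun ω (i : S.biUnion J) => f i ω) ⁻¹' (⋂ c ∈ S, zeroExtend (S.biUnion J) ⁻¹' G c) := by
      rw [preimage_iInter₂]
      exact iInter₂_congr fun c hc => hrepr c _ (Finset.subset_biUnion_of_mem J hc)
    rw [h1, h2]
    exact hind.measure_inter_preimage_eq_mul _ _ (measurable_zeroExtend _ (hG b))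
      (Finset.measurableSet_biInter _ fun c _ => measurable_zeroExtend _ (hG c))

end Blocks

/-! ### Tail bounds for batch means and their median -/

section Tail

variable {R : Type*} [MeasurableSpace R] {ρ : Measure R} [IsProbabilityMeasure ρ] {X : R → ℝ}

/-- The `b`-th of the consecutive blocks of size `n` into which `0, …, K - 1` is divided. -/
def block (n K b : ℕ) : Finset (Fin K) :=
  Finset.univ.filter fun j => b * n ≤ (j : ℕ) ∧ (j : ℕ) < (b + 1) * n

lemma card_block {n k b : ℕ} (hb : b < k) : (block n (n * k) b).card = n := by
  have h : (block n (n * k) b).map Fin.valEmbedding = Finset.Ico (b * n) ((b + 1) * n) := by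
    ext j
    simp only [block, Finset.mem_map, Finset.mem_filter, Finset.mem_univ, true_and,
      Fin.valEmbedding_apply, Finset.mem_Ico]
    constructor
    · rintro ⟨i, hi, rfl⟩
      exact hi
    · intro hj
      have : (b + 1) * n ≤ n * k := by
        rw [mul_comm n k]
        exact Nat.mul_le_mul_right n hb
      exact ⟨⟨j, hj.2.trans_le this⟩, hj, rfl⟩
  rw [← Finset.card_map Fin.valEmbedding, h, Nat.card_Ico, add_mul, one_mul]
  omega

lemma pairwise_disjoint_block (n K k : ℕ) :
    Pairwise fun a b : Fin k => Disjoint (block n K a) (block n K b) := by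
  intro a b hab
  rw [Finset.disjoint_left]
  intro j hj hj'
  simp only [block, Finset.mem_filter, Finset.mem_univ, true_and] at hj hj'
  have h1 : (a : ℕ) < b + 1 := lt_of_mul_lt_mul_right (hj.1.trans_lt hj'.2) (Nat.zero_le n)
  have h2 : (b : ℕ) < a + 1 := lt_of_mul_lt_mul_right (hj'.1.trans_lt hj.2) (Nat.zero_le n)
  exact hab (Fin.ext (by omega))

/-- Chebyshev for a mean of `n` independent copies, with the variance bounded by the second moment.
-/
lemma measure_block_mean_far_le (hX : Measurable X) {C : ℝ} (hC : ∀ z, |X z| ≤ C) {K n : ℕ}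
    (hn : 0 < n) {J : Finset (Fin K)} (hJ : J.card = n) {v c : ℝ} (hv : ∫ z, X z ^ 2 ∂ρ ≤ v)
    (hc : 0 < c) :
    (Measure.pi fun _ : Fin K => ρ)
      {z | c ≤ |(∑ j ∈ J, X (z j)) / n - ∫ z, X z ∂ρ|} ≤ ENNReal.ofReal (v / (n * c ^ 2)) := by
  set P := Measure.pi fun _ : Fin K => ρ with hP
  have hn0 : (0 : ℝ) < n := by exact_mod_cast hn
  have hmp : ∀ j, MeasurePreserving (Function.eval j) P ρ := fun j =>
    measurePreserving_eval (fun _ : Fin K => ρ) j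
  have hXm : ∀ j, Measurable fun z : Fin K → R => X (z j) := fun j =>
    hX.comp (measurable_pi_apply j)
  have hmem : ∀ j, MemLp (fun z : Fin K → R => X (z j)) 2 P := fun j =>
    MemLp.of_bound (hXm j).aestronglyMeasurable C (Filter.Eventually.of_forall fun z => hC _)
  have hind : iIndepFun (fun (j : Fin K) z => X (z j)) P := iIndepFun_pi fun _ => hX.aemeasurable
  have hmean : ∀ j, ∫ z, X (z j) ∂P = ∫ z, X z ∂ρ := fun j => by
    rw [← (hmp j).map_eq, integral_map (measurable_pi_apply j).aemeasurable
      hX.aestronglyMeasurable]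
  have hvar : ∀ j, Var[fun z : Fin K → R => X (z j); P] ≤ v := fun j => by
    refine (variance_le_expectation_sq (hXm j).aestronglyMeasurable).trans (le_trans ?_ hv)
    rw [← (hmp j).map_eq, integral_map (measurable_pi_apply j).aemeasurable
      (hX.pow_const 2).aestronglyMeasurable]
    rfl
  set Y : (Fin K → R) → ℝ := fun z => (n : ℝ)⁻¹ * (∑ j ∈ J, fun z : Fin K → R => X (z j)) z with hY
  have hYmem : MemLp Y 2 P := (memLp_finsetSum' J fun j _ => hmem j).const_mul _
  have hYmean : ∫ z, Y z ∂P = ∫ z, X z ∂ρ := by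
    simp only [hY, Finset.sum_apply]
    rw [integral_const_mul, integral_finsetSum _ fun j _ => (hmem j).integrable (by norm_num)]
    simp only [hmean, Finset.sum_const, hJ, nsmul_eq_mul]
    field_simp
  have hYvar : Var[Y; P] ≤ v / n := by
    simp only [hY]
    rw [variance_const_mul, IndepFun.variance_sum (fun j _ => hmem j)
      fun i _ j _ hij => hind.indepFun hij]
    calc ((n : ℝ)⁻¹) ^ 2 * ∑ j ∈ J, Var[fun z : Fin K → R => X (z j); P]
        ≤ ((n : ℝ)⁻¹) ^ 2 * ∑ j ∈ J, v := by gcongr with j; exact hvar j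
      _ = v / n := by
          rw [Finset.sum_const, hJ, nsmul_eq_mul]
          field_simp
  have hcheb := meas_ge_le_variance_div_sq hYmem hc
  rw [hYmean] at hcheb
  refine le_trans (le_of_eq ?_) (hcheb.trans (ENNReal.ofReal_le_ofReal ?_))
  · congr 1
    ext z
    simp only [hY, Finset.sum_apply, div_eq_inv_mul]
  · rw [div_mul_eq_div_div]
    gcongr

lemma two_pow_mul_pow_le {k s : ℕ} (hks : k ≤ 2 * s) :
    (2 : ℝ≥0∞) ^ k * ENNReal.ofReal (1 / 40) ^ s ≤ ENNReal.ofReal ((1 / 3) ^ k) := by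
  have h2 : (2 : ℝ≥0∞) = ENNReal.ofReal 2 := by simp
  rw [h2, ← ENNReal.ofReal_pow (by norm_num), ← ENNReal.ofReal_pow (by norm_num),
    ← ENNReal.ofReal_mul (by positivity)]
  refine ENNReal.ofReal_le_ofReal ?_
  -- The reason for `40` is `1/40 ≤ (1/6)²`: a bad half of the batches then costs `(1/6) ^ k`, which
  -- beats the number `2 ^ k` of subsets.
  calc (2 : ℝ) ^ k * (1 / 40) ^ s ≤ 2 ^ k * ((1 / 6) ^ 2) ^ s := by gcongr; norm_num
    _ = 2 ^ k * (1 / 6) ^ (2 * s) := by rw [pow_mul]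
    _ ≤ 2 ^ k * (1 / 6) ^ k := by
        gcongr ?_ * ?_
        exact pow_le_pow_of_le_one (by norm_num) (by norm_num) hks
    _ = (1 / 3) ^ k := by rw [← mul_pow]; norm_num

/-- A bad median forces at least half of the `k` batches to be bad. There are at most `2 ^ k` sets
of batches, and by independence a given set `S` is entirely bad with probability at most `(1/40) ^
|S|`. -/
lemma measure_median_of_means_far_le (hX : Measurable X) {C : ℝ} (hC : ∀ z, |X z| ≤ C) {n k : ℕ}
    (hn : 0 < n) (hk : 0 < k) {v c : ℝ} (hv : ∫ z, X z ^ 2 ∂ρ ≤ v) (hc : 0 < c)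
    (hvc : v / (n * c ^ 2) ≤ 1 / 40) :
    (Measure.pi fun _ : Fin (n * k) => ρ)
      {z | c < |median (fun b : Fin k =>
        (∑ j ∈ block n (n * k) b, X (z j)) / n) - ∫ z, X z ∂ρ|} ≤
      ENNReal.ofReal ((1 / 3) ^ k) := by
  classical
  set P := Measure.pi fun _ : Fin (n * k) => ρ with hP
  set μ := ∫ z, X z ∂ρ with hμ
  set G : Fin k → Set (Fin (n * k) → ℝ) := fun b =>
    {y | c ≤ |(∑ j ∈ block n (n * k) b, y j) / n - μ|} with hG
  set B : Fin k → Set (Fin (n * k) → R) := fun b => {z | (fun j => X (z j)) ∈ G b} with hB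
  have hXm : ∀ j, Measurable fun z : Fin (n * k) → R => X (z j) := fun j =>
    hX.comp (measurable_pi_apply j)
  have hind : iIndepFun (fun (j : Fin (n * k)) z => X (z j)) P :=
    iIndepFun_pi fun _ => hX.aemeasurable
  have hGm : ∀ b, MeasurableSet (G b) := fun b => by
    refine measurableSet_le measurable_const ?_
    have h1 : Measurable fun y : Fin (n * k) → ℝ => ∑ j ∈ block n (n * k) b, y j :=
      Finset.measurable_sum _ fun j _ => measurable_pi_apply j
    exact ((h1.div_const _).sub_const μ).abs
  have hdep : ∀ b : Fin k, ∀ y y' : Fin (n * k) → ℝ, (∀ i ∈ block n (n * k) b, y i = y' i) →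
      (y ∈ G b → y' ∈ G b) := by
    intro b y y' hyy hy
    simp only [hG, mem_ofPred_eq] at hy ⊢
    rwa [← Finset.sum_congr rfl hyy]
  have hPB : ∀ b, P (B b) ≤ ENNReal.ofReal (1 / 40) := fun b =>
    (measure_block_mean_far_le hX hC hn (card_block b.2) hv hc).trans
      (ENNReal.ofReal_le_ofReal hvc)
  have hinter : ∀ S : Finset (Fin k), P (⋂ b ∈ S, B b) ≤ ENNReal.ofReal (1 / 40) ^ S.card := by
    intro S
    have h1 := measure_biInter_blocks hind hXm (pairwise_disjoint_block n (n * k) k) hGm hdep S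
    simp only [hB]
    rw [h1]
    exact Finset.prod_le_pow_card _ _ _ fun b _ => hPB b
  set 𝒮 : Finset (Finset (Fin k)) := Finset.univ.filter fun S => k ≤ 2 * S.card with h𝒮
  have hcover : {z | c < |median (fun b : Fin k =>
      (∑ j ∈ block n (n * k) b, X (z j)) / n) - μ|} ⊆ ⋃ S ∈ 𝒮, ⋂ b ∈ S, B b := by
    intro z hz
    have h1 := card_le_two_mul_of_median_far hk _ hz
    simp only [mem_iUnion, exists_prop]
    refine ⟨_, Finset.mem_filter.2 ⟨Finset.mem_univ _, h1⟩, ?_⟩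
    simp only [mem_iInter]
    intro b hb
    exact (Finset.mem_filter.1 hb).2
  have h𝒮card : (𝒮.card : ℝ≥0∞) ≤ 2 ^ k := by
    have h1 : 𝒮.card ≤ 2 ^ k := by
      refine (Finset.card_filter_le _ _).trans ?_
      simp
    exact_mod_cast h1
  have h40 : ENNReal.ofReal (1 / 40) ≤ 1 := by
    rw [ENNReal.ofReal_le_one]; norm_num
  calc P _ ≤ P (⋃ S ∈ 𝒮, ⋂ b ∈ S, B b) := measure_mono hcover
    _ ≤ ∑ S ∈ 𝒮, P (⋂ b ∈ S, B b) := measure_biUnion_finset_le _ _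
    -- The exponent `(k + 1) / 2` is `k / 2` rounded up, the least size of a set in `𝒮`.
    _ ≤ ∑ S ∈ 𝒮, ENNReal.ofReal (1 / 40) ^ ((k + 1) / 2) := by
        refine Finset.sum_le_sum fun S hS => (hinter S).trans ?_
        have h1 : k ≤ 2 * S.card := (Finset.mem_filter.1 hS).2
        exact pow_le_pow_of_le_one (zero_le) h40 (by omega)
    _ = 𝒮.card * ENNReal.ofReal (1 / 40) ^ ((k + 1) / 2) := by
        rw [Finset.sum_const, nsmul_eq_mul]
    _ ≤ 2 ^ k * ENNReal.ofReal (1 / 40) ^ ((k + 1) / 2) := by gcongr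
    _ ≤ _ := two_pow_mul_pow_le (by omega)

end Tail

/-! ### The states the algorithm can reach -/

section States

variable {𝓧 : Type u} [MeasurableSpace 𝓧] {ι : Type w} [Fintype ι]
  {ctx : Measure 𝓧} [IsProbabilityMeasure ctx] {π : ι → 𝓧 → I} {L : ℝ} {T : ℕ}
  {sel : ℕ → Finset ι → ι → ℝ}

/-- The number of rounds of the epoch described by the state `st`. -/
noncomputable def epochLength (ctx : Measure 𝓧) (π : ι → 𝓧 → I) (L : ℝ) (T : ℕ)
    (st : State ι) : ℕ :=
  batchSize ctx π L st.epoch st.active * numBatches T (Fintype.card ι)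

lemma one_le_logb_two {T : ℕ} (hT : 2 ≤ T) : 1 ≤ Real.logb 2 T := by
  rw [Real.le_logb_iff_rpow_le (by norm_num) (by positivity)]
  simpa using (by exact_mod_cast hT : (2 : ℝ) ≤ T)

lemma log_le_ceil_log {T N : ℕ} (hT : 2 ≤ T) (hN : 2 ≤ N) :
    Real.log (T * N) ≤ ⌈Real.log (T * N * Real.logb 2 T)⌉₊ := by
  have hT' : (2 : ℝ) ≤ T := by exact_mod_cast hT
  have hN' : (2 : ℝ) ≤ N := by exact_mod_cast hN
  refine le_trans (Real.log_le_log (by positivity) ?_) (Nat.le_ceil _)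
  exact le_mul_of_one_le_right (by positivity) (one_le_logb_two hT)

lemma numBatches_pos {T N : ℕ} (hT : 2 ≤ T) (hN : 2 ≤ N) : 0 < numBatches T N := by
  have hT' : (2 : ℝ) ≤ T := by exact_mod_cast hT
  have hN' : (2 : ℝ) ≤ N := by exact_mod_cast hN
  have h1 := log_le_ceil_log hT hN
  have h2 : 0 < Real.log (T * N) := Real.log_pos (by nlinarith)
  have h3 : (0 : ℝ) < (⌈Real.log (T * N * Real.logb 2 T)⌉₊ : ℝ) := h2.trans_le h1
  unfold numBatches
  have : 0 < ⌈Real.log (T * N * Real.logb 2 T)⌉₊ := by exact_mod_cast h3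
  omega

omit [Fintype ι] in
lemma batchSize_pos (hπ : ∀ i, Measurable (π i)) (hL : 1 ≤ L) {m : ℕ} {A : Finset ι}
    (hm : 1 ≤ m) (hA : A.Nonempty) : 0 < batchSize ctx π L m A := by
  have h1 := bandwidth_le_charVolume (ctx := ctx) hπ hm hA
  have h2 := bandwidth_pos m
  have h3 := radius_pos hL m
  have h4 : 0 < charVolume ctx π m A := h2.trans_le h1
  unfold batchSize
  rw [Nat.ceil_pos]
  positivity

lemma epochLength_pos (hπ : ∀ i, Measurable (π i)) (hL : 1 ≤ L) (hT : 2 ≤ T)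
    (hN : 2 ≤ Fintype.card ι) {st : State ι} (hst : st.Proper) :
    0 < epochLength ctx π L T st :=
  Nat.mul_pos (batchSize_pos hπ hL hst.1 hst.2) (numBatches_pos hT hN)

omit [IsProbabilityMeasure ctx] in
lemma nextState_of_lt {t : ℕ} (o : Fin t → Obs 𝓧) {st : State ι}
    (h : t < st.start + epochLength ctx π L T st) : nextState ctx π L T sel o st = st := by
  unfold nextState
  exact if_neg (not_le.2 h)

open Classical in
omit [IsProbabilityMeasure ctx] in
lemma nextState_of_le {t : ℕ} (o : Fin t → Obs 𝓧) {st : State ι}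
    (h : st.start + epochLength ctx π L T st ≤ t) : nextState ctx π L T sel o st =
      { epoch := st.epoch + 1
        start := t
        active := st.active.filter fun i =>
          Survives ctx π L T sel st.epoch st.start st.active o i } := by
  unfold nextState
  exact if_pos h

omit [IsProbabilityMeasure ctx] in
lemma state_succ {t : ℕ} (o : Fin (t + 1) → Obs 𝓧) : state ctx π L T sel (t + 1) o =
    nextState ctx π L T sel o (state ctx π L T sel t fun j => o j.castSucc) := rfl

/-- Every reachable state is one in which the algorithm can act, and its epoch is in progress. -/
lemma state_reachable (hπ : ∀ i, Measurable (π i)) (hL : 1 ≤ L) (hT : 2 ≤ T)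
    (hN : 2 ≤ Fintype.card ι) (t : ℕ) (o : Fin t → Obs 𝓧) :
    (state ctx π L T sel t o).Proper ∧ (state ctx π L T sel t o).start ≤ t ∧
      t < (state ctx π L T sel t o).start + epochLength ctx π L T (state ctx π L T sel t o) := by
  classical
  induction t with
  | zero =>
    have hprop : (state ctx π L T sel 0 o).Proper := by
      refine ⟨le_rfl, ?_⟩
      have : Nonempty ι := Fintype.card_pos_iff.1 (by omega)
      exact Finset.univ_nonempty
    exact ⟨hprop, le_rfl, Nat.add_pos_right _ (epochLength_pos hπ hL hT hN hprop)⟩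
  | succ t ih =>
    obtain ⟨hprop, hle, hlt⟩ := ih fun j => o j.castSucc
    rw [state_succ]
    set st := state ctx π L T sel t fun j => o j.castSucc with hst
    by_cases h : st.start + epochLength ctx π L T st ≤ t + 1
    · have hprop' : (nextState ctx π L T sel o st).Proper := by
        rw [nextState_of_le o h]
        refine ⟨by simp, ?_⟩
        -- A minimizer of the estimates always survives, so the active set never becomes empty.
        obtain ⟨i, hi, hmin⟩ := st.active.exists_min_image
          (fun i => lossEstimate ctx π L T sel st.epoch st.start st.active i o) hprop.2
        refine ⟨i, Finset.mem_filter.2 ⟨hi, fun i' hi' => ?_⟩⟩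
        have := radius_pos hL st.epoch
        linarith [hmin i' hi']
      have hstart : (nextState ctx π L T sel o st).start = t + 1 := by
        rw [nextState_of_le o h]
      have := epochLength_pos (ctx := ctx) hπ hL hT hN hprop'
      exact ⟨hprop', hstart.le, by omega⟩
    · rw [nextState_of_lt o (not_le.1 h)]
      exact ⟨hprop, by omega, by omega⟩

omit [IsProbabilityMeasure ctx] in
-- Within an epoch the state is frozen: `k < epochLength` excludes an update.
lemma state_add_of_state {s : ℕ} {st : State ι} (hs : st.start = s) (k : ℕ)
    (hk : k < epochLength ctx π L T st) (o : Fin (s + k) → Obs 𝓧)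
    (h : state ctx π L T sel s (fun j => o (Fin.castAdd k j)) = st) :
    state ctx π L T sel (s + k) o = st := by
  induction k with
  | zero => exact h
  | succ k ih =>
    have h1 : state ctx π L T sel (s + k) (fun j => o j.castSucc) = st :=
      ih (by omega) _ h
    change nextState ctx π L T sel (t := s + k + 1) o
      (state ctx π L T sel (s + k) fun j => o j.castSucc) = st
    rw [h1]
    exact nextState_of_lt (t := s + k + 1) o (by omega)

omit [IsProbabilityMeasure ctx] in
-- Conversely, a state that records the start `s` must already have held at round `s`: any later
-- update would have recorded a later start.
lemma state_of_state_add {s : ℕ} {st : State ι} (hs : st.start = s) (k : ℕ)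
    (o : Fin (s + k) → Obs 𝓧) (h : state ctx π L T sel (s + k) o = st) :
    state ctx π L T sel s (fun j => o (Fin.castAdd k j)) = st := by
  induction k with
  | zero => exact h
  | succ k ih =>
    refine ih (fun j => o j.castSucc) ?_
    change nextState ctx π L T sel (t := s + k + 1) o
      (state ctx π L T sel (s + k) fun j => o j.castSucc) = st at h
    set st' := state ctx π L T sel (s + k) fun j => o j.castSucc with hst'
    by_cases hc : st'.start + epochLength ctx π L T st' ≤ s + k + 1
    · rw [nextState_of_le (t := s + k + 1) o hc] at h
      rw [← h] at hs
      simp only at hs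
      omega
    · rwa [nextState_of_lt (t := s + k + 1) o (not_le.1 hc)] at h

omit [IsProbabilityMeasure ctx] in
-- The estimate uses only the rounds since the epoch began. Reindexing them from `0` exhibits it as
-- a function of a block of i.i.d. rounds.
lemma lossEstimate_add (m s : ℕ) (A : Finset ι) (i : ι) {K : ℕ} (o : Fin (s + K) → Obs 𝓧) :
    lossEstimate ctx π L T sel m s A i o =
      median fun b : Fin (numBatches T (Fintype.card ι)) =>
        (∑ j ∈ block (batchSize ctx π L m A) K b,
          ipsLoss π L m (sel m A) i (o (Fin.natAdd s j))) / batchSize ctx π L m A := by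
  unfold lossEstimate batchMean
  congr 1
  funext b
  congr 1
  rw [Fin.sum_univ_add, Finset.sum_eq_zero, zero_add, block, Finset.sum_filter]
  · refine Finset.sum_congr rfl fun j _ => ?_
    refine if_congr ?_ rfl rfl
    simp only [Fin.val_natAdd]
    omega
  · intro j _
    refine if_neg ?_
    simp only [Fin.val_castAdd]
    have := j.2
    omega

end States

/-! ### The law of the history -/

section History

variable {𝓧 : Type u} [MeasurableSpace 𝓧] {𝓛 : Type v} [MeasurableSpace 𝓛]
  {ι : Type w} [Fintype ι] {ctx : Measure 𝓧} [IsProbabilityMeasure ctx]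
  {lossLaw : Kernel 𝓧 𝓛} [IsMarkovKernel lossLaw] {loss : 𝓛 → I → I}
  {hloss : Measurable (Function.uncurry loss)} {π : ι → 𝓧 → I} {hπ : ∀ i, Measurable (π i)}
  {L : ℝ} {T : ℕ} {sel : ℕ → Finset ι → ι → ℝ}

/-- The state of the algorithm before round `t` as a function of the past rounds. -/
noncomputable def historyState (ctx : Measure 𝓧) (loss : 𝓛 → I → I) (π : ι → 𝓧 → I) (L : ℝ)
    (T : ℕ) (sel : ℕ → Finset ι → ι → ℝ) (t : ℕ) (z : Fin t → Round 𝓧 𝓛) : State ι :=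
  state ctx π L T sel t fun j => observe loss (z j)

omit [IsProbabilityMeasure ctx] in
lemma measurable_historyState (hloss : Measurable (Function.uncurry loss))
    (hπ : ∀ i, Measurable (π i)) (t : ℕ) :
    Measurable (historyState ctx loss π L T sel t) :=
  (measurable_state ctx hπ L T sel t).comp
    (measurable_pi_lambda _ fun j => (measurable_observe hloss).comp (measurable_pi_apply j))

omit [MeasurableSpace 𝓛] in
lemma historyState_reachable (hπ : ∀ i, Measurable (π i)) (hL : 1 ≤ L) (hT : 2 ≤ T)
    (hN : 2 ≤ Fintype.card ι) (t : ℕ) (z : Fin t → Round 𝓧 𝓛) :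
    (historyState ctx loss π L T sel t z).Proper ∧
      (historyState ctx loss π L T sel t z).start ≤ t ∧
      t < (historyState ctx loss π L T sel t z).start +
        epochLength ctx π L T (historyState ctx loss π L T sel t z) :=
  state_reachable hπ hL hT hN t _

omit [MeasurableSpace 𝓧] [MeasurableSpace 𝓛] in
lemma measurable_snoc {R : Type*} [MeasurableSpace R] (t : ℕ) :
    Measurable fun p : (Fin t → R) × R => Fin.snoc (α := fun _ => R) p.1 p.2 := by
  refine measurable_pi_lambda _ fun j => ?_
  refine Fin.lastCases ?_ (fun j => ?_) j
  · simpa using measurable_snd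
  · simpa using measurable_fst.eval

lemma isMarkovKernel_stepKernel (hsel : IsOptimalSelection ctx π L sel) (hL : 1 ≤ L)
    (hT : 2 ≤ T) (hN : 2 ≤ Fintype.card ι) (t : ℕ) :
    IsMarkovKernel (stepKernel ctx lossLaw loss hloss π hπ L T sel t) where
  isProbabilityMeasure z := by
    unfold stepKernel
    rw [Kernel.comap_apply]
    exact isProbabilityMeasure_roundLaw hsel hπ hL (state_reachable hπ hL hT hN t _).1

lemma isProbabilityMeasure_historyLaw (hsel : IsOptimalSelection ctx π L sel) (hL : 1 ≤ L)
    (hT : 2 ≤ T) (hN : 2 ≤ Fintype.card ι) (t : ℕ) :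
    IsProbabilityMeasure (historyLaw ctx lossLaw loss hloss π hπ L T sel t) := by
  induction t with
  | zero => unfold historyLaw; infer_instance
  | succ t ih =>
    have := isMarkovKernel_stepKernel (lossLaw := lossLaw) (hloss := hloss) (hπ := hπ)
      hsel hL hT hN t
    exact Measure.isProbabilityMeasure_map (measurable_snoc t).aemeasurable

lemma lintegral_historyLaw_succ (hsel : IsOptimalSelection ctx π L sel) (hL : 1 ≤ L)
    (hT : 2 ≤ T) (hN : 2 ≤ Fintype.card ι) (t : ℕ) {F : (Fin (t + 1) → Round 𝓧 𝓛) → ℝ≥0∞}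
    (hF : Measurable F) :
    ∫⁻ z, F z ∂(historyLaw ctx lossLaw loss hloss π hπ L T sel (t + 1)) =
      ∫⁻ z, (∫⁻ w, F (Fin.snoc (α := fun _ => Round 𝓧 𝓛) z w)
        ∂(roundLaw ctx lossLaw π L sel (historyState ctx loss π L T sel t z)))
        ∂(historyLaw ctx lossLaw loss hloss π hπ L T sel t) := by
  have h1 := isMarkovKernel_stepKernel (lossLaw := lossLaw) (hloss := hloss) (hπ := hπ)
    hsel hL hT hN t
  have h2 := isProbabilityMeasure_historyLaw (lossLaw := lossLaw) (hloss := hloss) (hπ := hπ)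
    hsel hL hT hN t
  rw [historyLaw, lintegral_map hF (measurable_snoc t),
    Measure.lintegral_compProd (f := fun p => F (Fin.snoc (α := fun _ => Round 𝓧 𝓛) p.1 p.2))
      (hF.comp (measurable_snoc t))]
  rfl

lemma integral_historyLaw_succ (hsel : IsOptimalSelection ctx π L sel) (hL : 1 ≤ L)
    (hT : 2 ≤ T) (hN : 2 ≤ Fintype.card ι) (t : ℕ) {F : (Fin (t + 1) → Round 𝓧 𝓛) → ℝ}
    (hF : Measurable F) (C : ℝ) (hC : ∀ z, |F z| ≤ C) :
    ∫ z, F z ∂(historyLaw ctx lossLaw loss hloss π hπ L T sel (t + 1)) =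
      ∫ z, (∫ w, F (Fin.snoc (α := fun _ => Round 𝓧 𝓛) z w)
        ∂(roundLaw ctx lossLaw π L sel (historyState ctx loss π L T sel t z)))
        ∂(historyLaw ctx lossLaw loss hloss π hπ L T sel t) := by
  have h1 := isMarkovKernel_stepKernel (lossLaw := lossLaw) (hloss := hloss) (hπ := hπ)
    hsel hL hT hN t
  have h2 := isProbabilityMeasure_historyLaw (lossLaw := lossLaw) (hloss := hloss) (hπ := hπ)
    hsel hL hT hN t
  rw [historyLaw, integral_map (measurable_snoc t).aemeasurable hF.aestronglyMeasurable,
    Measure.integral_compProd (f := fun p => F (Fin.snoc (α := fun _ => Round 𝓧 𝓛) p.1 p.2))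
      (integrable_of_abs_le (hF.comp (measurable_snoc t)) C fun p => hC _)]
  rfl

/-- Peels the last coordinate off a product measure, matching the recursion of `historyLaw` in the
induction of `lintegral_epoch`. -/
lemma lintegral_pi_succ {R : Type*} [MeasurableSpace R] (ρ : Measure R) [IsProbabilityMeasure ρ]
    (k : ℕ) {F : (Fin (k + 1) → R) → ℝ≥0∞} (hF : Measurable F) :
    ∫⁻ y, F y ∂(Measure.pi fun _ : Fin (k + 1) => ρ) =
      ∫⁻ y, (∫⁻ w, F (Fin.snoc (α := fun _ => R) y w) ∂ρ) ∂(Measure.pi fun _ : Fin k => ρ) := by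
  have hmp := (measurePreserving_piFinSuccAbove (fun _ : Fin (k + 1) => ρ) (Fin.last k)).symm
  rw [← hmp.lintegral_comp hF, lintegral_prod_symm']
  · refine lintegral_congr fun y => lintegral_congr fun w => ?_
    congr 1
    exact Fin.insertNth_last' w y
  · exact hF.comp hmp.measurable

/-- Given the state at the start of an epoch, the rounds of the epoch are independent draws from
the law of a round. -/
lemma lintegral_epoch (hsel : IsOptimalSelection ctx π L sel) (hL : 1 ≤ L)
    (hT : 2 ≤ T) (hN : 2 ≤ Fintype.card ι) {s : ℕ} {st : State ι} (hs : st.start = s)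
    (hst : st.Proper) (k : ℕ) (hk : k ≤ epochLength ctx π L T st)
    {F : (Fin k → Round 𝓧 𝓛) → ℝ≥0∞} (hF : Measurable F) :
    ∫⁻ z, {z : Fin (s + k) → Round 𝓧 𝓛 |
        historyState ctx loss π L T sel s (fun j => z (Fin.castAdd k j)) = st}.indicator
          (fun z => F fun j => z (Fin.natAdd s j)) z
        ∂(historyLaw ctx lossLaw loss hloss π hπ L T sel (s + k)) =
      historyLaw ctx lossLaw loss hloss π hπ L T sel s
        {z | historyState ctx loss π L T sel s z = st} *
      ∫⁻ y, F y ∂(Measure.pi fun _ : Fin k => roundLaw ctx lossLaw π L sel st) := by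
  have hρ := isProbabilityMeasure_roundLaw (lossLaw := lossLaw) hsel hπ hL hst
  have hpre : ∀ k, Measurable fun (z : Fin (s + k) → Round 𝓧 𝓛) (j : Fin s) =>
      z (Fin.castAdd k j) := fun k => measurable_pi_lambda _ fun j => measurable_pi_apply _
  have hsuf : ∀ k, Measurable fun (z : Fin (s + k) → Round 𝓧 𝓛) (j : Fin k) =>
      z (Fin.natAdd s j) := fun k => measurable_pi_lambda _ fun j => measurable_pi_apply _
  have hset : ∀ k, MeasurableSet {z : Fin (s + k) → Round 𝓧 𝓛 |
      historyState ctx loss π L T sel s (fun j => z (Fin.castAdd k j)) = st} := fun k =>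
    ((measurable_historyState hloss hπ s).comp (hpre k)) (measurableSet_singleton st)
  induction k with
  | zero =>
    have h1 : ∀ z : Fin (s + 0) → Round 𝓧 𝓛, (fun j : Fin 0 => z (Fin.natAdd s j)) = Fin.elim0 :=
      fun z => funext fun j => j.elim0
    simp only [h1]
    rw [lintegral_indicator_const (hset 0), mul_comm]
    congr 1
    rw [lintegral_congr fun y => congrArg F (Subsingleton.elim y Fin.elim0)]
    simp
  | succ k ih =>
    have hG : Measurable fun y : Fin k → Round 𝓧 𝓛 =>
        ∫⁻ w, F (Fin.snoc (α := fun _ => Round 𝓧 𝓛) y w) ∂(roundLaw ctx lossLaw π L sel st) :=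
      Measurable.lintegral_prod_right' (f := fun p : (Fin k → Round 𝓧 𝓛) × Round 𝓧 𝓛 =>
        F (Fin.snoc (α := fun _ => Round 𝓧 𝓛) p.1 p.2)) (hF.comp (measurable_snoc k))
    rw [lintegral_pi_succ _ _ hF, ← ih (by omega) hG]
    refine (lintegral_historyLaw_succ hsel hL hT hN (s + k)
      ((hF.comp (hsuf (k + 1))).indicator (hset (k + 1)))).trans ?_
    refine lintegral_congr fun z => ?_
    have hcast : ∀ w, (fun j : Fin s => (Fin.snoc (α := fun _ => Round 𝓧 𝓛) z w :
        Fin (s + k + 1) → Round 𝓧 𝓛) (Fin.castAdd (k + 1) j)) =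
          fun j => z (Fin.castAdd k j) := fun w => funext fun j =>
      Fin.snoc_castSucc (α := fun _ => Round 𝓧 𝓛) w z (Fin.castAdd k j)
    have hnat : ∀ w, (fun j : Fin (k + 1) => (Fin.snoc (α := fun _ => Round 𝓧 𝓛) z w :
        Fin (s + k + 1) → Round 𝓧 𝓛) (Fin.natAdd s j)) =
          Fin.snoc (α := fun _ => Round 𝓧 𝓛) (fun j => z (Fin.natAdd s j)) w := by
      intro w
      funext j
      refine Fin.lastCases ?_ (fun j => ?_) j
      · rw [Fin.snoc_last]
        exact Fin.snoc_last (α := fun _ => Round 𝓧 𝓛) w z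
      · rw [Fin.snoc_castSucc]
        exact Fin.snoc_castSucc (α := fun _ => Round 𝓧 𝓛) w z (Fin.natAdd s j)
    by_cases hz : historyState ctx loss π L T sel s (fun j => z (Fin.castAdd k j)) = st
    -- Since `k` is smaller than the epoch length, the state is still `st`, so the round being
    -- integrated out has law `roundLaw st` whatever the earlier rounds were.
    · have hz' : historyState ctx loss π L T sel (s + k) z = st :=
        state_add_of_state hs k (by omega) _ hz
      rw [indicator_of_mem (by exact hz), hz']
      refine lintegral_congr fun w => ?_
      rw [indicator_of_mem]
      · exact congrArg F (hnat w)
      · change historyState ctx loss π L T sel s _ = st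
        rw [hcast w]
        exact hz
    · rw [indicator_of_notMem (by exact hz)]
      rw [lintegral_congr fun w => indicator_of_notMem (by
        change ¬ historyState ctx loss π L T sel s _ = st
        rw [hcast w]
        exact hz) _]
      simp

end History

section Elimination

variable {𝓧 : Type u} [MeasurableSpace 𝓧] {𝓛 : Type v} [MeasurableSpace 𝓛]
  {ι : Type w} [Fintype ι] {ctx : Measure 𝓧} [IsProbabilityMeasure ctx]
  {lossLaw : Kernel 𝓧 𝓛} [IsMarkovKernel lossLaw] {loss : 𝓛 → I → I}
  {hloss : Measurable (Function.uncurry loss)} {π : ι → 𝓧 → I} {hπ : ∀ i, Measurable (π i)}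
  {L : ℝ} {T : ℕ} {sel : ℕ → Finset ι → ι → ℝ} {i₀ : ι}

/-! ### Correct elimination -/

/-- The policy `i₀` is active, and all active policies are nearly as good. -/
def State.Good (ctx : Measure 𝓧) (lossLaw : Kernel 𝓧 𝓛) (loss : 𝓛 → I → I) (π : ι → 𝓧 → I)
    (L : ℝ) (i₀ : ι) (st : State ι) : Prop :=
  i₀ ∈ st.active ∧ ∀ i ∈ st.active, policyLoss ctx lossLaw loss (π i) ≤
    policyLoss ctx lossLaw loss (π i₀) + 12 * radius L st.epoch

/-- The estimate of the loss of some active policy is far from its smoothed loss. -/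
def Deviates (ctx : Measure 𝓧) (lossLaw : Kernel 𝓧 𝓛) (loss : 𝓛 → I → I) (π : ι → 𝓧 → I)
    (L : ℝ) (T : ℕ) (sel : ℕ → Finset ι → ι → ℝ) (st : State ι) {t : ℕ} (o : Fin t → Obs 𝓧) :
    Prop :=
  ∃ i ∈ st.active, radius L st.epoch / 2 <
    |lossEstimate ctx π L T sel st.epoch st.start st.active i o -
      smoothedLoss ctx lossLaw loss (bandwidth st.epoch) (π i)|

omit [Fintype ι] [IsProbabilityMeasure ctx] [IsMarkovKernel lossLaw] in
lemma policyLoss_nonneg (i : ι) : 0 ≤ policyLoss ctx lossLaw loss (π i) :=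
  integral_nonneg fun p => (loss p.2 (π i p.1)).2.1

omit [Fintype ι] in
lemma policyLoss_le_one (hloss : Measurable (Function.uncurry loss))
    (hπ : ∀ i, Measurable (π i)) (i : ι) : policyLoss ctx lossLaw loss (π i) ≤ 1 := by
  unfold policyLoss
  calc _ ≤ ∫ _, (1 : ℝ) ∂(ctx ⊗ₘ lossLaw) := by
        refine integral_mono ?_ (integrable_const _) fun p => (loss p.2 (π i p.1)).2.2
        exact integrable_of_abs_le (measurable_loss_apply hloss (hπ i)) 1 fun p => by
          rw [abs_of_nonneg (loss p.2 (π i p.1)).2.1]; exact (loss p.2 (π i p.1)).2.2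
    _ = 1 := by simp

omit [Fintype ι] in
lemma abs_smoothedLoss_sub_le_radius (hloss : Measurable (Function.uncurry loss))
    (hπ : ∀ i, Measurable (π i)) (hL : 1 ≤ L)
    (hlip : ∀ x : 𝓧, ∀ a a' : I,
      |(∫ ω, (loss ω a : ℝ) ∂(lossLaw x)) - ∫ ω, (loss ω a' : ℝ) ∂(lossLaw x)|
        ≤ L * dist a a') {m : ℕ} (hm : 1 ≤ m) (i : ι) :
    |smoothedLoss ctx lossLaw loss (bandwidth m) (π i) - policyLoss ctx lossLaw loss (π i)| ≤
      radius L m :=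
  abs_smoothedLoss_sub_le hloss (by linarith) (bandwidth_pos m) (bandwidth_le_half hm) (hπ i) hlip

/-- Comparing two estimates costs `2 · r/2` for deviation and `2 r` for bias, `3 r` in total. The
threshold `3 r` therefore keeps the optimum, and a survivor loses at most `3 r + 3 r`, which is `12`
times the next radius. -/
lemma good_nextState (hloss : Measurable (Function.uncurry loss))
    (hπ : ∀ i, Measurable (π i)) (hL : 1 ≤ L)
    (hlip : ∀ x : 𝓧, ∀ a a' : I,
      |(∫ ω, (loss ω a : ℝ) ∂(lossLaw x)) - ∫ ω, (loss ω a' : ℝ) ∂(lossLaw x)|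
        ≤ L * dist a a')
    (hi₀ : ∀ i, policyLoss ctx lossLaw loss (π i₀) ≤ policyLoss ctx lossLaw loss (π i))
    {st : State ι} (hst : st.Proper) (hgood : st.Good ctx lossLaw loss π L i₀) {t : ℕ}
    (o : Fin t → Obs 𝓧)
    (hdev : st.start + epochLength ctx π L T st ≤ t →
      ¬ Deviates ctx lossLaw loss π L T sel st o) :
    (nextState ctx π L T sel o st).Good ctx lossLaw loss π L i₀ := by
  classical
  by_cases h : st.start + epochLength ctx π L T st ≤ t
  · have hclose := hdev h
    unfold Deviates at hclose
    push Not at hclose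
    have hsm := abs_smoothedLoss_sub_le_radius (ctx := ctx) hloss hπ hL hlip hst.1
    rw [nextState_of_le o h]
    have hr : radius L st.epoch = 2 * radius L (st.epoch + 1) := by
      unfold radius; rw [pow_succ]; ring
    refine ⟨Finset.mem_filter.2 ⟨hgood.1, fun i' hi' => ?_⟩, fun i hi => ?_⟩
    · have h1 := abs_le.1 (hclose i₀ hgood.1)
      have h2 := abs_le.1 (hclose i' hi')
      have h3 := abs_le.1 (hsm i₀)
      have h4 := abs_le.1 (hsm i')
      linarith [hi₀ i', h1.2, h2.1, h3.2, h4.1]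
    · obtain ⟨hi, hsurv⟩ := Finset.mem_filter.1 hi
      have h0 := hsurv i₀ hgood.1
      have h1 := abs_le.1 (hclose i₀ hgood.1)
      have h2 := abs_le.1 (hclose i hi)
      have h3 := abs_le.1 (hsm i₀)
      have h4 := abs_le.1 (hsm i)
      simp only
      linarith [h1.2, h2.1, h3.2, h4.1]
  · rwa [nextState_of_lt o (not_le.1 h)]

omit [Fintype ι] in
-- The constant `320` is chosen here: `(2V/h) / ((320 V / (r² h)) · r²/4) = 1/40`.
lemma batchSize_variance_bound (hπ : ∀ i, Measurable (π i)) (hL : 1 ≤ L) {m : ℕ}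
    {A : Finset ι} (hm : 1 ≤ m) (hA : A.Nonempty) :
    (2 * charVolume ctx π m A / bandwidth m) /
      (batchSize ctx π L m A * (radius L m / 2) ^ 2) ≤ 1 / 40 := by
  have h1 := bandwidth_le_charVolume (ctx := ctx) hπ hm hA
  have h2 := bandwidth_pos m
  have h3 := radius_pos hL m
  have h4 : (0 : ℝ) < batchSize ctx π L m A := by
    exact_mod_cast batchSize_pos (ctx := ctx) hπ hL hm hA
  have h5 : 320 * charVolume ctx π m A / (radius L m ^ 2 * bandwidth m) ≤
      batchSize ctx π L m A := Nat.le_ceil _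
  rw [div_le_iff₀ (by positivity)] at h5
  rw [div_div, div_le_div_iff₀ (by positivity) (by norm_num)]
  nlinarith

/-- At the end of an epoch, an estimate that is far from its mean has small probability. -/
lemma measure_deviates_epoch_le (hsel : IsOptimalSelection ctx π L sel) (hL : 1 ≤ L)
    (hT : 2 ≤ T) (hN : 2 ≤ Fintype.card ι) {st : State ι} (hst : st.Proper) {K : ℕ}
    (hK : epochLength ctx π L T st = K) :
    historyLaw ctx lossLaw loss hloss π hπ L T sel (st.start + K)
      {z | historyState ctx loss π L T sel st.start (fun j => z (Fin.castAdd K j)) = st ∧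
        Deviates ctx lossLaw loss π L T sel st fun j => observe loss (z j)} ≤
      historyLaw ctx lossLaw loss hloss π hπ L T sel st.start
        {z | historyState ctx loss π L T sel st.start z = st} *
      (Fintype.card ι * ENNReal.ofReal ((1 / 3) ^ numBatches T (Fintype.card ι))) := by
  unfold epochLength at hK
  subst hK
  set n := batchSize ctx π L st.epoch st.active with hn
  set δ := numBatches T (Fintype.card ι) with hδ
  set m := st.epoch with hm
  set ρ := roundLaw ctx lossLaw π L sel st with hρd
  have hρ : IsProbabilityMeasure ρ := isProbabilityMeasure_roundLaw hsel hπ hL hst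
  have hQ := hsel.mem_simplexOn hst
  set X : ι → Round 𝓧 𝓛 → ℝ := fun i w => ipsLoss π L m (sel m st.active) i (observe loss w)
    with hX
  have hXm : ∀ i, Measurable (X i) := fun i => measurable_ipsLoss_observe hloss hπ i
  have hXC : ∀ i w, |X i w| ≤ (bandwidth m)⁻¹ / explore L m := fun i w =>
    abs_ipsLoss_le hL hst.1 hQ i _
  set W : ι → Set (Fin (n * δ) → Round 𝓧 𝓛) := fun i =>
    {y | radius L m / 2 < |median (fun b : Fin δ =>
      (∑ j ∈ block n (n * δ) b, X i (y j)) / n) - ∫ w, X i w ∂ρ|} with hW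
  have hWm : ∀ i, MeasurableSet (W i) := fun i => by
    refine measurableSet_lt measurable_const (Measurable.abs (Measurable.sub_const ?_ _))
    refine measurable_median.comp (measurable_pi_lambda _ fun b => ?_)
    exact (Finset.measurable_sum _ fun j _ =>
      (hXm i).comp (measurable_pi_apply j)).div_const _
  have hWU : MeasurableSet (⋃ i ∈ st.active, W i) :=
    Finset.measurableSet_biUnion _ fun i _ => hWm i
  have hPW : (Measure.pi fun _ : Fin (n * δ) => ρ) (⋃ i ∈ st.active, W i) ≤
      Fintype.card ι * ENNReal.ofReal ((1 / 3) ^ δ) := by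
    calc _ ≤ ∑ i ∈ st.active, (Measure.pi fun _ : Fin (n * δ) => ρ) (W i) :=
          measure_biUnion_finset_le _ _
      _ ≤ ∑ i ∈ st.active, ENNReal.ofReal ((1 / 3) ^ δ) := by
          refine Finset.sum_le_sum fun i hi => ?_
          exact measure_median_of_means_far_le (hXm i) (hXC i)
            (batchSize_pos hπ hL hst.1 hst.2) (numBatches_pos hT hN)
            (integral_ipsLoss_sq_le hsel hloss hπ hL hst hi)
            (half_pos (radius_pos hL m)) (batchSize_variance_bound hπ hL hst.1 hst.2)
      _ = st.active.card * ENNReal.ofReal ((1 / 3) ^ δ) := by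
          rw [Finset.sum_const, nsmul_eq_mul]
      _ ≤ _ := by
          gcongr
          exact Finset.card_le_univ _
  have hsub : {z : Fin (st.start + n * δ) → Round 𝓧 𝓛 |
      historyState ctx loss π L T sel st.start (fun j => z (Fin.castAdd (n * δ) j)) = st ∧
        Deviates ctx lossLaw loss π L T sel st fun j => observe loss (z j)} ⊆
      {z | historyState ctx loss π L T sel st.start (fun j => z (Fin.castAdd (n * δ) j)) = st} ∩
        {z | (fun j => z (Fin.natAdd st.start j)) ∈ ⋃ i ∈ st.active, W i} := by
    rintro z ⟨hz, i, hi, hdev⟩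
    refine ⟨hz, ?_⟩
    simp only [mem_ofPred_eq, mem_iUnion, exists_prop]
    refine ⟨i, hi, ?_⟩
    rw [lossEstimate_add, ← integral_ipsLoss hsel hloss hπ hL hst i] at hdev
    exact hdev
  refine (measure_mono hsub).trans ?_
  -- Taking the whole epoch as the block and the indicator of a bad estimate as `F` factors the
  -- probability into that of starting in `st` and an i.i.d. tail probability.
  have hepoch := lintegral_epoch (lossLaw := lossLaw) (hloss := hloss) (hπ := hπ) hsel hL hT hN
    (st := st) rfl hst (n * δ) le_rfl
    (F := (⋃ i ∈ st.active, W i).indicator fun _ => 1) (measurable_const.indicator hWU)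
  rw [lintegral_indicator_const hWU, one_mul] at hepoch
  refine le_trans (le_of_eq ?_) (hepoch.le.trans (mul_le_mul_right hPW _))
  rw [← lintegral_indicator_one]
  · refine lintegral_congr fun z => ?_
    rw [← indicator_indicator]
    rfl
  · refine MeasurableSet.inter ?_ ?_
    · exact ((measurable_historyState hloss hπ st.start).comp
        (measurable_pi_lambda _ fun j => measurable_pi_apply _)) (measurableSet_singleton st)
    · exact (measurable_pi_lambda _ fun j => measurable_pi_apply _) hWU

/-- Consistency of the history laws: later rounds do not change the law of earlier ones. -/
lemma measure_castSucc (hsel : IsOptimalSelection ctx π L sel) (hL : 1 ≤ L)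
    (hT : 2 ≤ T) (hN : 2 ≤ Fintype.card ι) (t : ℕ) {S : Set (Fin t → Round 𝓧 𝓛)}
    (hS : MeasurableSet S) :
    historyLaw ctx lossLaw loss hloss π hπ L T sel (t + 1) {z | (fun j => z j.castSucc) ∈ S} =
      historyLaw ctx lossLaw loss hloss π hπ L T sel t S := by
  have hm : Measurable fun (z : Fin (t + 1) → Round 𝓧 𝓛) (j : Fin t) => z j.castSucc :=
    measurable_pi_lambda _ fun j => measurable_pi_apply _
  have hS' : MeasurableSet {z : Fin (t + 1) → Round 𝓧 𝓛 | (fun j => z j.castSucc) ∈ S} := hm hS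
  rw [← lintegral_indicator_one hS', lintegral_historyLaw_succ hsel hL hT hN t
    (measurable_one.indicator hS'), ← lintegral_indicator_one hS]
  refine lintegral_congr fun z => ?_
  have hρ := isProbabilityMeasure_roundLaw (lossLaw := lossLaw) hsel hπ hL
    (st := historyState ctx loss π L T sel t z) (state_reachable hπ hL hT hN t _).1
  have h1 : ∀ w, {z : Fin (t + 1) → Round 𝓧 𝓛 | (fun j => z j.castSucc) ∈ S}.indicator
      (1 : (Fin (t + 1) → Round 𝓧 𝓛) → ℝ≥0∞) (Fin.snoc (α := fun _ => Round 𝓧 𝓛) z w) =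
        S.indicator 1 z := fun w => by
    change S.indicator 1 (fun j : Fin t =>
      Fin.snoc (α := fun _ => Round 𝓧 𝓛) z w j.castSucc) = S.indicator 1 z
    simp only [Fin.snoc_castSucc]
  exact (lintegral_congr h1).trans (by simp)

/-- Union bound over the countably many states, each charged at its starting round. For a fixed
round `s` the probabilities of the possible states sum to `1`, so each of the `t + 1` possible
starts contributes `η` once. -/
lemma measure_deviates_le (hsel : IsOptimalSelection ctx π L sel) (hL : 1 ≤ L)
    (hT : 2 ≤ T) (hN : 2 ≤ Fintype.card ι) (t : ℕ) :
    historyLaw ctx lossLaw loss hloss π hπ L T sel (t + 1)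
      {z | (historyState ctx loss π L T sel t fun j => z j.castSucc).start +
          epochLength ctx π L T (historyState ctx loss π L T sel t fun j => z j.castSucc) ≤ t + 1 ∧
        Deviates ctx lossLaw loss π L T sel (historyState ctx loss π L T sel t fun j => z j.castSucc)
          fun j => observe loss (z j)} ≤
      (t + 1 : ℕ) *
        (Fintype.card ι * ENNReal.ofReal ((1 / 3) ^ numBatches T (Fintype.card ι))) := by
  set η := (Fintype.card ι * ENNReal.ofReal ((1 / 3) ^ numBatches T (Fintype.card ι)) : ℝ≥0∞)
    with hη
  set H := historyLaw ctx lossLaw loss hloss π hπ L T sel with hH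
  have hprob : ∀ s, IsProbabilityMeasure (H s) := fun s =>
    isProbabilityMeasure_historyLaw hsel hL hT hN s
  set E : State ι → Set (Fin (t + 1) → Round 𝓧 𝓛) := fun st =>
    {z | (historyState ctx loss π L T sel t fun j => z j.castSucc) = st ∧
      st.start + epochLength ctx π L T st ≤ t + 1 ∧
        Deviates ctx lossLaw loss π L T sel st fun j => observe loss (z j)} with hE
  have hcover : {z : Fin (t + 1) → Round 𝓧 𝓛 |
      (historyState ctx loss π L T sel t fun j => z j.castSucc).start +
          epochLength ctx π L T (historyState ctx loss π L T sel t fun j => z j.castSucc) ≤ t + 1 ∧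
        Deviates ctx lossLaw loss π L T sel (historyState ctx loss π L T sel t fun j => z j.castSucc)
          fun j => observe loss (z j)} ⊆ ⋃ st, E st := fun z hz =>
    mem_iUnion.2 ⟨_, rfl, hz.1, hz.2⟩
  have hEst : ∀ st, H (t + 1) (E st) ≤ ∑ s ∈ Finset.range (t + 1),
      H s (historyState ctx loss π L T sel s ⁻¹' {st}) * η := by
    intro st
    rcases (E st).eq_empty_or_nonempty with hemp | ⟨z, hz, hle, -⟩
    -- In the remaining case a history in `E st` shows that `st` is reachable and that its epoch is
    -- in progress at `t` but over at `t + 1`. This fixes the epoch length as `t + 1 - st.start`.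
    · rw [hemp]; simp
    obtain ⟨hprop, hstart, hlt⟩ := state_reachable (ctx := ctx) (T := T) (sel := sel) hπ hL hT hN t
      fun j => observe loss (z j.castSucc)
    change (state ctx π L T sel t fun j => observe loss (z j.castSucc)) = st at hz
    rw [hz] at hprop hstart hlt
    obtain ⟨k, hk⟩ : ∃ k, epochLength ctx π L T st = k + 1 :=
      Nat.exists_eq_succ_of_ne_zero (epochLength_pos hπ hL hT hN hprop).ne'
    obtain rfl : t = st.start + k := by omega
    refine le_trans ?_ (Finset.single_le_sum (f := fun s =>
      H s (historyState ctx loss π L T sel s ⁻¹' {st}) * η) (fun _ _ => zero_le)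
      (Finset.mem_range.2 (by omega : st.start < st.start + k + 1)))
    refine le_trans (measure_mono ?_) (measure_deviates_epoch_le hsel hL hT hN hprop hk)
    rintro y ⟨hy, -, hdev⟩
    exact ⟨state_of_state_add rfl k (fun j => observe loss (y j.castSucc)) hy, hdev⟩
  calc _ ≤ H (t + 1) (⋃ st, E st) := measure_mono hcover
    _ ≤ ∑' st, H (t + 1) (E st) := measure_iUnion_le _
    _ ≤ ∑' st, ∑ s ∈ Finset.range (t + 1),
        H s (historyState ctx loss π L T sel s ⁻¹' {st}) * η := ENNReal.tsum_le_tsum hEst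
    _ = ∑ s ∈ Finset.range (t + 1), (∑' st,
        H s (historyState ctx loss π L T sel s ⁻¹' {st})) * η := by
        rw [Summable.tsum_finsetSum fun _ _ => ENNReal.summable]
        simp only [ENNReal.tsum_mul_right]
    _ = ∑ s ∈ Finset.range (t + 1), 1 * η := by
        refine Finset.sum_congr rfl fun s _ => ?_
        have h1 : ∑' st, H s (historyState ctx loss π L T sel s ⁻¹' {st}) =
            H s (⋃ st, historyState ctx loss π L T sel s ⁻¹' {st}) := by
          refine (measure_iUnion (fun a b hab => ?_) fun st =>
            measurable_historyState hloss hπ s (measurableSet_singleton st)).symm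
          exact Disjoint.preimage _ (disjoint_singleton.2 hab)
        rw [h1, ← preimage_iUnion, iUnion_of_singleton, preimage_univ, measure_univ]
    _ = _ := by simp

/-- The elimination is correct up to round `t` with high probability. -/
lemma measure_not_good_le (hsel : IsOptimalSelection ctx π L sel) (hL : 1 ≤ L)
    (hT : 2 ≤ T) (hN : 2 ≤ Fintype.card ι)
    (hlip : ∀ x : 𝓧, ∀ a a' : I,
      |(∫ ω, (loss ω a : ℝ) ∂(lossLaw x)) - ∫ ω, (loss ω a' : ℝ) ∂(lossLaw x)|
        ≤ L * dist a a')
    (hi₀ : ∀ i, policyLoss ctx lossLaw loss (π i₀) ≤ policyLoss ctx lossLaw loss (π i)) (t : ℕ) :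
    historyLaw ctx lossLaw loss hloss π hπ L T sel t
      {z | ¬ (historyState ctx loss π L T sel t z).Good ctx lossLaw loss π L i₀} ≤
      (t ^ 2 : ℕ) *
        (Fintype.card ι * ENNReal.ofReal ((1 / 3) ^ numBatches T (Fintype.card ι))) := by
  set η := (Fintype.card ι * ENNReal.ofReal ((1 / 3) ^ numBatches T (Fintype.card ι)) : ℝ≥0∞)
    with hη
  induction t with
  | zero =>
    have h1 : {z : Fin 0 → Round 𝓧 𝓛 | ¬ (historyState ctx loss π L T sel 0 z).Good
        ctx lossLaw loss π L i₀} = ∅ := by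
      -- Initially all policies are active and the tolerance `12 r_1 = 6 L` exceeds the range of the
      -- losses.
      refine eq_empty_of_forall_notMem fun z hz => hz ⟨Finset.mem_univ _, fun i _ => ?_⟩
      have h2 := policyLoss_le_one (ctx := ctx) (lossLaw := lossLaw) hloss hπ i
      have h3 := policyLoss_nonneg (ctx := ctx) (lossLaw := lossLaw) (loss := loss) (π := π) i₀
      have h4 : radius L (historyState ctx loss π L T sel 0 z).epoch = L * (1 / 2) ^ 1 := rfl
      rw [h4]
      linarith
    rw [h1]
    simp
  | succ t ih =>
    have hsub : {z : Fin (t + 1) → Round 𝓧 𝓛 |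
        ¬ (historyState ctx loss π L T sel (t + 1) z).Good ctx lossLaw loss π L i₀} ⊆
        {z | (fun j => z j.castSucc) ∈ {z : Fin t → Round 𝓧 𝓛 |
          ¬ (historyState ctx loss π L T sel t z).Good ctx lossLaw loss π L i₀}} ∪
        {z | (historyState ctx loss π L T sel t fun j => z j.castSucc).start +
          epochLength ctx π L T (historyState ctx loss π L T sel t fun j => z j.castSucc) ≤ t + 1 ∧
        Deviates ctx lossLaw loss π L T sel (historyState ctx loss π L T sel t fun j => z j.castSucc)
          fun j => observe loss (z j)} := by
      intro z hz
      by_contra hcon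
      rw [mem_union, not_or] at hcon
      obtain ⟨h1, h2⟩ := hcon
      simp only [mem_ofPred_eq, not_not] at h1
      exact hz (good_nextState hloss hπ hL hlip hi₀ (state_reachable hπ hL hT hN t _).1 h1 _
        fun hle hdev => h2 ⟨hle, hdev⟩)
    have hmeas : MeasurableSet {z : Fin t → Round 𝓧 𝓛 |
        ¬ (historyState ctx loss π L T sel t z).Good ctx lossLaw loss π L i₀} :=
      measurable_historyState hloss hπ t
        (MeasurableSpace.measurableSet_top (s := {st : State ι |
          ¬ st.Good ctx lossLaw loss π L i₀}))
    refine (measure_mono hsub).trans ((measure_union_le _ _).trans ?_)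
    rw [measure_castSucc hsel hL hT hN t hmeas]
    refine (add_le_add ih (measure_deviates_le hsel hL hT hN t)).trans ?_
    rw [← hη, ← add_mul]
    gcongr
    -- The induction closes because `t² + (t + 1) ≤ (t + 1)²`.
    norm_cast
    nlinarith

end Elimination

/-! ### The regret -/

/-- The regret bound for a round of epoch `m`, cut off after epoch `M`. -/
noncomputable def epochGap (L : ℝ) (M m : ℕ) : ℝ := if m ≤ M then 14 * radius L m else 0

/-- An upper bound on the number of rounds of epoch `m`. -/
noncomputable def epochCap (L : ℝ) (δ m : ℕ) : ℕ :=
  ⌈320 / (radius L m ^ 2 * bandwidth m)⌉₊ * δ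

lemma epochGap_nonneg {L : ℝ} (hL : 1 ≤ L) (M m : ℕ) : 0 ≤ epochGap L M m := by
  unfold epochGap
  have := radius_pos hL m
  split_ifs <;> positivity

/-- Rounds beyond epoch `M` are charged to the uniform amount `14 r_{M+1}`, since radii decrease.
This makes the accumulated cost bounded independently of how many epochs are run. -/
lemma le_epochGap_add {L : ℝ} (hL : 1 ≤ L) (M m : ℕ) :
    14 * radius L m ≤ epochGap L M m + 14 * radius L (M + 1) := by
  have h1 := radius_pos hL (M + 1)
  unfold epochGap
  split_ifs with h
  · linarith
  · have h2 : radius L m ≤ radius L (M + 1) := by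
      unfold radius
      have := pow_le_pow_of_le_one (by norm_num : (0 : ℝ) ≤ 1 / 2) (by norm_num)
        (by omega : M + 1 ≤ m)
      have hL0 : 0 ≤ L := by linarith
      gcongr
    linarith

/-- The total regret bound of the first `M` epochs. -/
noncomputable def totalGap (L : ℝ) (δ M : ℕ) : ℝ :=
  ∑ m ∈ Finset.range (M + 1), 14 * radius L m * epochCap L δ m

lemma sum_epochGap_le {L : ℝ} (hL : 1 ≤ L) (δ M k : ℕ) :
    ∑ m ∈ Finset.range k, epochGap L M m * epochCap L δ m ≤ totalGap L δ M := by
  have hnn : ∀ m, 0 ≤ epochGap L M m * epochCap L δ m := fun m =>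
    mul_nonneg (epochGap_nonneg hL M m) (Nat.cast_nonneg _)
  calc _ ≤ ∑ m ∈ Finset.range (max k (M + 1)), epochGap L M m * epochCap L δ m :=
        Finset.sum_le_sum_of_subset_of_nonneg (Finset.range_subset_range.2 (le_max_left _ _))
          fun m _ _ => hnn m
    _ = ∑ m ∈ Finset.range (M + 1), epochGap L M m * epochCap L δ m := by
        refine (Finset.sum_subset (Finset.range_subset_range.2 (le_max_right _ _))
          fun m _ hm => ?_).symm
        rw [epochGap, if_neg, zero_mul]
        rw [Finset.mem_range] at hm
        omega
    _ = totalGap L δ M := by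
        refine Finset.sum_congr rfl fun m hm => ?_
        rw [epochGap, if_pos]
        rw [Finset.mem_range] at hm
        omega

/-! ### A pathwise account of the accumulated regret -/

section Potential

variable {ι : Type w}

/-- The regret bound accumulated before round `t`, when the algorithm is in state `st`. -/
noncomputable def potential (L : ℝ) (δ M t : ℕ) (st : State ι) : ℝ :=
  ∑ m ∈ Finset.range st.epoch, epochGap L M m * epochCap L δ m +
    epochGap L M st.epoch * (t - st.start)

variable {𝓧 : Type u} [MeasurableSpace 𝓧] [Fintype ι] {ctx : Measure 𝓧}
  [IsProbabilityMeasure ctx] {π : ι → 𝓧 → I} {L : ℝ} {T : ℕ} {sel : ℕ → Finset ι → ι → ℝ}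

lemma epochLength_le (hπ : ∀ i, Measurable (π i)) (hL : 1 ≤ L) (st : State ι) :
    epochLength ctx π L T st ≤ epochCap L (numBatches T (Fintype.card ι)) st.epoch := by
  unfold epochLength epochCap batchSize
  refine Nat.mul_le_mul_right _ (Nat.ceil_le_ceil ?_)
  have h1 := charVolume_le_one (ctx := ctx) (m := st.epoch) (A := st.active) hπ
  have h2 := bandwidth_pos st.epoch
  have h3 := radius_pos hL st.epoch
  gcongr
  linarith

/-- Each round adds the gap of its epoch. When an epoch ends, its rounds are replaced by the cap on
its length, which is at least as large, so the potential only gains. -/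
lemma potential_step (hπ : ∀ i, Measurable (π i)) (hL : 1 ≤ L) (hT : 2 ≤ T)
    (hN : 2 ≤ Fintype.card ι) (M t : ℕ) (o : Fin (t + 1) → Obs 𝓧) :
    potential L (numBatches T (Fintype.card ι)) M t
        (state ctx π L T sel t fun j => o j.castSucc) +
      epochGap L M (state ctx π L T sel t fun j => o j.castSucc).epoch ≤
      potential L (numBatches T (Fintype.card ι)) M (t + 1) (state ctx π L T sel (t + 1) o) := by
  obtain ⟨-, -, hlt⟩ := state_reachable (ctx := ctx) (T := T) (sel := sel) hπ hL hT hN t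
    fun j => o j.castSucc
  rw [state_succ]
  set st := state ctx π L T sel t fun j => o j.castSucc with hst
  have hgap := epochGap_nonneg hL M st.epoch
  by_cases h : st.start + epochLength ctx π L T st ≤ t + 1
  · rw [nextState_of_le o h]
    unfold potential
    simp only [Finset.sum_range_succ, sub_self, mul_zero, add_zero]
    have h1 : (t : ℝ) - st.start + 1 ≤
        epochCap L (numBatches T (Fintype.card ι)) st.epoch := by
      have h2 := epochLength_le (ctx := ctx) (T := T) hπ hL st
      have h3 : t + 1 ≤ epochCap L (numBatches T (Fintype.card ι)) st.epoch + st.start := by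
        omega
      have h4 : ((t + 1 : ℕ) : ℝ) ≤
          (epochCap L (numBatches T (Fintype.card ι)) st.epoch + st.start : ℕ) := by
        exact_mod_cast h3
      push_cast at h4
      linarith
    nlinarith [mul_le_mul_of_nonneg_left h1 hgap]
  · rw [nextState_of_lt o (not_le.1 h)]
    unfold potential
    push_cast
    linarith

omit [Fintype ι] in
lemma potential_nonneg (hL : 1 ≤ L) (δ M : ℕ) {t : ℕ} {st : State ι} (h : st.start ≤ t) :
    0 ≤ potential L δ M t st := by
  unfold potential
  have h1 : (st.start : ℝ) ≤ t := by exact_mod_cast h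
  exact add_nonneg (Finset.sum_nonneg fun m _ =>
    mul_nonneg (epochGap_nonneg hL M m) (Nat.cast_nonneg _))
    (mul_nonneg (epochGap_nonneg hL M _) (by linarith))

/-- The epoch in progress is shorter than its cap, so the potential is at most a sum over full
epochs, which the cut-off truncates at `M`. -/
lemma potential_le (hπ : ∀ i, Measurable (π i)) (hL : 1 ≤ L) (M : ℕ) {t : ℕ} {st : State ι}
    (h : t < st.start + epochLength ctx π L T st) :
    potential L (numBatches T (Fintype.card ι)) M t st ≤
      totalGap L (numBatches T (Fintype.card ι)) M := by
  refine le_trans ?_ (sum_epochGap_le hL _ M (st.epoch + 1))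
  unfold potential
  rw [Finset.sum_range_succ]
  have h2 := epochLength_le (ctx := ctx) (T := T) hπ hL st
  have h3 : t ≤ epochCap L (numBatches T (Fintype.card ι)) st.epoch + st.start := by omega
  have h4 : (t : ℝ) ≤ (epochCap L (numBatches T (Fintype.card ι)) st.epoch + st.start : ℕ) := by
    exact_mod_cast h3
  push_cast at h4
  have h5 := mul_le_mul_of_nonneg_left (sub_le_iff_le_add.2 h4) (epochGap_nonneg hL M st.epoch)
  linarith

end Potential

/-! ### From the pathwise account to expected loss -/

section Regret

variable {𝓧 : Type u} [MeasurableSpace 𝓧] {𝓛 : Type v} [MeasurableSpace 𝓛]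
  {ι : Type w} [Fintype ι] {ctx : Measure 𝓧} [IsProbabilityMeasure ctx]
  {lossLaw : Kernel 𝓧 𝓛} [IsMarkovKernel lossLaw] {loss : 𝓛 → I → I}
  {hloss : Measurable (Function.uncurry loss)} {π : ι → 𝓧 → I} {hπ : ∀ i, Measurable (π i)}
  {L : ℝ} {T : ℕ} {sel : ℕ → Finset ι → ι → ℝ} {i₀ : ι}

lemma measurable_totalLoss (hloss : Measurable (Function.uncurry loss))
    (t : ℕ) : Measurable fun z : Fin t → Round 𝓧 𝓛 => ∑ j, (loss (z j).1.2 (z j).2 : ℝ) :=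
  Finset.measurable_sum _ fun j _ => measurable_subtype_coe.comp
    (hloss.comp ((measurable_pi_apply j).fst.snd.prodMk (measurable_pi_apply j).snd))

omit [MeasurableSpace 𝓧] [MeasurableSpace 𝓛] in
lemma abs_totalLoss_le (t : ℕ) (z : Fin t → Round 𝓧 𝓛) :
    |∑ j, (loss (z j).1.2 (z j).2 : ℝ)| ≤ t := by
  rw [abs_of_nonneg (Finset.sum_nonneg fun j _ => (loss (z j).1.2 (z j).2).2.1)]
  calc _ ≤ ∑ _j : Fin t, (1 : ℝ) := Finset.sum_le_sum fun j _ => (loss (z j).1.2 (z j).2).2.2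
    _ = t := by simp

lemma integral_loss_roundLaw_le_gap (hsel : IsOptimalSelection ctx π L sel)
    (hloss : Measurable (Function.uncurry loss)) (hπ : ∀ i, Measurable (π i)) (hL : 1 ≤ L)
    (hlip : ∀ x : 𝓧, ∀ a a' : I,
      |(∫ ω, (loss ω a : ℝ) ∂(lossLaw x)) - ∫ ω, (loss ω a' : ℝ) ∂(lossLaw x)|
        ≤ L * dist a a') {st : State ι} (hst : st.Proper) (M : ℕ) :
    ∫ z, (loss z.1.2 z.2 : ℝ) ∂(roundLaw ctx lossLaw π L sel st) ≤
      policyLoss ctx lossLaw loss (π i₀) + epochGap L M st.epoch + 14 * radius L (M + 1) +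
        {st : State ι | ¬ st.Good ctx lossLaw loss π L i₀}.indicator 1 st := by
  have h0 := policyLoss_nonneg (ctx := ctx) (lossLaw := lossLaw) (loss := loss) (π := π) i₀
  have h1 := le_epochGap_add hL M st.epoch
  have h2 := radius_pos hL st.epoch
  by_cases hg : st.Good ctx lossLaw loss π L i₀
  · rw [indicator_of_notMem (by simpa using hg)]
    have h3 := integral_loss_roundLaw_le (lossLaw := lossLaw) hsel hloss hπ hL hst
      -- Here `13 = 12 + 1` counts the goodness tolerance and the smoothing bias; exploration
      -- supplies the fourteenth radius. In a state that is not good, the whole loss of at most `1`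
      -- is charged to the indicator.
      (c := policyLoss ctx lossLaw loss (π i₀) + 13 * radius L st.epoch) fun i hi => by
        have h4 := hg.2 i hi
        have h5 := abs_le.1 (abs_smoothedLoss_sub_le_radius (ctx := ctx) hloss hπ hL hlip hst.1 i)
        linarith [h5.2]
    linarith
  · rw [indicator_of_mem (by simpa using hg)]
    have := isProbabilityMeasure_roundLaw (lossLaw := lossLaw) hsel hπ hL hst
    have h3 : ∫ z, (loss z.1.2 z.2 : ℝ) ∂(roundLaw ctx lossLaw π L sel st) ≤ 1 := by
      calc _ ≤ ∫ _, (1 : ℝ) ∂(roundLaw ctx lossLaw π L sel st) := by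
            refine integral_mono_of_nonneg (Filter.Eventually.of_forall fun z =>
              (loss z.1.2 z.2).2.1) (integrable_const _)
              (Filter.Eventually.of_forall fun z => (loss z.1.2 z.2).2.2)
        _ = 1 := by simp
    simp only [Pi.one_apply]
    linarith

lemma integrable_of_state (hsel : IsOptimalSelection ctx π L sel) (hL : 1 ≤ L)
    (hT : 2 ≤ T) (hN : 2 ≤ Fintype.card ι) (t : ℕ) (g : State ι → ℝ) (C : ℝ)
    (hC : ∀ z, |g (historyState ctx loss π L T sel t z)| ≤ C) :
    Integrable (fun z => g (historyState ctx loss π L T sel t z))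
      (historyLaw ctx lossLaw loss hloss π hπ L T sel t) := by
  have := isProbabilityMeasure_historyLaw (lossLaw := lossLaw) (hloss := hloss) (hπ := hπ)
    hsel hL hT hN t
  exact integrable_of_abs_le (measurable_from_top.comp (measurable_historyState hloss hπ t)) C hC

lemma integral_castSucc (hsel : IsOptimalSelection ctx π L sel) (hL : 1 ≤ L)
    (hT : 2 ≤ T) (hN : 2 ≤ Fintype.card ι) (t : ℕ) {f : (Fin t → Round 𝓧 𝓛) → ℝ}
    (hf : Measurable f) (C : ℝ) (hC : ∀ z, |f z| ≤ C) :
    ∫ z, f (fun j => z j.castSucc) ∂(historyLaw ctx lossLaw loss hloss π hπ L T sel (t + 1)) =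
      ∫ z, f z ∂(historyLaw ctx lossLaw loss hloss π hπ L T sel t) := by
  have hm : Measurable fun (z : Fin (t + 1) → Round 𝓧 𝓛) (j : Fin t) => z j.castSucc :=
    measurable_pi_lambda _ fun j => measurable_pi_apply _
  rw [integral_historyLaw_succ hsel hL hT hN t (F := fun z => f fun j => z j.castSucc)
    (hf.comp hm) C fun z => hC _]
  refine integral_congr_ae (Filter.Eventually.of_forall fun z => ?_)
  have hρ := isProbabilityMeasure_roundLaw (lossLaw := lossLaw) hsel hπ hL
    (st := historyState ctx loss π L T sel t z) (historyState_reachable hπ hL hT hN t z).1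
  simp

lemma integral_totalLoss_succ (hsel : IsOptimalSelection ctx π L sel) (hL : 1 ≤ L)
    (hT : 2 ≤ T) (hN : 2 ≤ Fintype.card ι) (t : ℕ) :
    ∫ z, ∑ j, (loss (z j).1.2 (z j).2 : ℝ)
        ∂(historyLaw ctx lossLaw loss hloss π hπ L T sel (t + 1)) =
      ∫ z, (∑ j, (loss (z j).1.2 (z j).2 : ℝ) + ∫ w, (loss w.1.2 w.2 : ℝ)
        ∂(roundLaw ctx lossLaw π L sel (historyState ctx loss π L T sel t z)))
        ∂(historyLaw ctx lossLaw loss hloss π hπ L T sel t) := by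
  rw [integral_historyLaw_succ hsel hL hT hN t (measurable_totalLoss hloss (t + 1)) _
    (abs_totalLoss_le (t + 1))]
  refine integral_congr_ae (Filter.Eventually.of_forall fun z => ?_)
  have hρ := isProbabilityMeasure_roundLaw (lossLaw := lossLaw) hsel hπ hL
    (st := historyState ctx loss π L T sel t z) (historyState_reachable hπ hL hT hN t z).1
  simp only [Fin.sum_univ_castSucc, Fin.snoc_castSucc, Fin.snoc_last]
  rw [integral_add (integrable_const _)]
  · simp
  · refine integrable_of_abs_le ?_ 1 fun w => ?_
    · exact measurable_subtype_coe.comp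
        (hloss.comp (measurable_fst.snd.prodMk measurable_snd))
    · rw [abs_of_nonneg (loss w.1.2 w.2).2.1]; exact (loss w.1.2 w.2).2.2

/-- Induction on the rounds, integrating out the newest one. Its conditional loss depends only on
the current state, its gap is paid by the growth of the potential, and bad states are paid by their
probability. -/
lemma integral_totalLoss_le (hsel : IsOptimalSelection ctx π L sel) (hL : 1 ≤ L)
    (hT : 2 ≤ T) (hN : 2 ≤ Fintype.card ι)
    (hlip : ∀ x : 𝓧, ∀ a a' : I,
      |(∫ ω, (loss ω a : ℝ) ∂(lossLaw x)) - ∫ ω, (loss ω a' : ℝ) ∂(lossLaw x)|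
        ≤ L * dist a a') (M t : ℕ) :
    ∫ z, ∑ j, (loss (z j).1.2 (z j).2 : ℝ)
        ∂(historyLaw ctx lossLaw loss hloss π hπ L T sel t) ≤
      ∫ z, potential L (numBatches T (Fintype.card ι)) M t (historyState ctx loss π L T sel t z)
        ∂(historyLaw ctx lossLaw loss hloss π hπ L T sel t) +
      t * (policyLoss ctx lossLaw loss (π i₀) + 14 * radius L (M + 1)) +
      ∑ s ∈ Finset.range t, (historyLaw ctx lossLaw loss hloss π hπ L T sel s).real
        {z | ¬ (historyState ctx loss π L T sel s z).Good ctx lossLaw loss π L i₀} := by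
  set δ := numBatches T (Fintype.card ι) with hδ
  set H := historyLaw ctx lossLaw loss hloss π hπ L T sel with hH
  have hprob : ∀ s, IsProbabilityMeasure (H s) := fun s =>
    isProbabilityMeasure_historyLaw hsel hL hT hN s
  have hreach : ∀ s (z : Fin s → Round 𝓧 𝓛), _ := fun s z =>
    historyState_reachable (ctx := ctx) (loss := loss) (T := T) (sel := sel) hπ hL hT hN s z
  have hpot : ∀ s (z : Fin s → Round 𝓧 𝓛),
      |potential L δ M s (historyState ctx loss π L T sel s z)| ≤ totalGap L δ M := fun s z => by
    rw [abs_of_nonneg (potential_nonneg hL δ M (hreach s z).2.1)]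
    exact potential_le hπ hL M (hreach s z).2.2
  have hgap : ∀ s (z : Fin s → Round 𝓧 𝓛),
      |epochGap L M (historyState ctx loss π L T sel s z).epoch| ≤ 14 * L := fun s z => by
    rw [abs_of_nonneg (epochGap_nonneg hL M _)]
    unfold epochGap radius
    split_ifs
    · have := pow_le_one₀ (n := (historyState ctx loss π L T sel s z).epoch)
        (by norm_num : (0 : ℝ) ≤ 1 / 2) (by norm_num)
      nlinarith
    · linarith
  induction t with
  | zero =>
    have h1 : 0 ≤ ∫ z, potential L δ M 0 (historyState ctx loss π L T sel 0 z) ∂(H 0) :=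
      integral_nonneg fun z => potential_nonneg hL δ M (hreach 0 z).2.1
    simpa using h1
  | succ t ih =>
    have hi1 : Integrable (fun z : Fin t → Round 𝓧 𝓛 =>
        ∑ j, (loss (z j).1.2 (z j).2 : ℝ)) (H t) :=
      integrable_of_abs_le (measurable_totalLoss hloss t) _ (abs_totalLoss_le t)
    have hi2 := integrable_of_state (lossLaw := lossLaw) (loss := loss) (hloss := hloss)
      (hπ := hπ) hsel hL hT hN t (potential L δ M t) _ (hpot t)
    have hi3 := integrable_of_state (lossLaw := lossLaw) (loss := loss) (hloss := hloss)
      (hπ := hπ) hsel hL hT hN t (fun st => epochGap L M st.epoch) _ (hgap t)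
    have hi4 := integrable_of_state (lossLaw := lossLaw) (loss := loss) (hloss := hloss)
      (hπ := hπ) hsel hL hT hN t
      ({st : State ι | ¬ st.Good ctx lossLaw loss π L i₀}.indicator 1) 1 fun z => by
        unfold indicator
        split_ifs <;> simp
    have hi5 := integrable_of_state (lossLaw := lossLaw) (loss := loss) (hloss := hloss)
      (hπ := hπ) hsel hL hT hN (t + 1) (potential L δ M (t + 1)) _ (hpot (t + 1))
    have hi6 := integrable_of_state (lossLaw := lossLaw) (loss := loss) (hloss := hloss)
      (hπ := hπ) hsel hL hT hN t (fun st => ∫ w, (loss w.1.2 w.2 : ℝ)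
        ∂(roundLaw ctx lossLaw π L sel st)) 1 fun z => by
        have hρ := isProbabilityMeasure_roundLaw (lossLaw := lossLaw) hsel hπ hL (hreach t z).1
        rw [← Real.norm_eq_abs]
        refine (norm_integral_le_of_norm_le_const (C := 1)
          (Filter.Eventually.of_forall fun w => ?_)).trans (by simp)
        rw [Real.norm_of_nonneg (loss w.1.2 w.2).2.1]
        exact (loss w.1.2 w.2).2.2
    have hi34 : Integrable (fun z => (policyLoss ctx lossLaw loss (π i₀) +
        14 * radius L (M + 1)) + epochGap L M (historyState ctx loss π L T sel t z).epoch) (H t) :=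
      (integrable_const _).add hi3
    have hind : ∫ z, {st : State ι | ¬ st.Good ctx lossLaw loss π L i₀}.indicator 1
        (historyState ctx loss π L T sel t z) ∂(H t) = (H t).real
        {z | ¬ (historyState ctx loss π L T sel t z).Good ctx lossLaw loss π L i₀} := by
      exact integral_indicator_one (μ := H t)
        (s := {z | ¬ (historyState ctx loss π L T sel t z).Good ctx lossLaw loss π L i₀})
        (measurable_historyState hloss hπ t (MeasurableSpace.measurableSet_top
          (s := {st : State ι | ¬ st.Good ctx lossLaw loss π L i₀})))
    have hstep : ∫ z, ∑ j, (loss (z j).1.2 (z j).2 : ℝ) ∂(H (t + 1)) ≤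
        ∫ z, ∑ j, (loss (z j).1.2 (z j).2 : ℝ) ∂(H t) +
        (policyLoss ctx lossLaw loss (π i₀) + 14 * radius L (M + 1)) +
        ∫ z, epochGap L M (historyState ctx loss π L T sel t z).epoch ∂(H t) + (H t).real
        {z | ¬ (historyState ctx loss π L T sel t z).Good ctx lossLaw loss π L i₀} := by
      rw [hH, integral_totalLoss_succ hsel hL hT hN t, ← hH, integral_add hi1 hi6]
      have h1 : ∫ z, (∫ w, (loss w.1.2 w.2 : ℝ)
          ∂(roundLaw ctx lossLaw π L sel (historyState ctx loss π L T sel t z))) ∂(H t) ≤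
          ∫ z, ((policyLoss ctx lossLaw loss (π i₀) + 14 * radius L (M + 1)) +
            epochGap L M (historyState ctx loss π L T sel t z).epoch +
            {st : State ι | ¬ st.Good ctx lossLaw loss π L i₀}.indicator 1
              (historyState ctx loss π L T sel t z)) ∂(H t) := by
        refine integral_mono hi6 (hi34.add hi4) fun z => ?_
        have h2 := integral_loss_roundLaw_le_gap (i₀ := i₀) hsel hloss hπ hL hlip
          (hreach t z).1 M
        exact h2.trans (le_of_eq (by unfold historyState; ring))
      rw [integral_add hi34 hi4,
        integral_add (integrable_const _) hi3, hind] at h1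
      simp only [integral_const, probReal_univ, smul_eq_mul, one_mul] at h1
      linarith
    have hmono : ∫ z, potential L δ M t (historyState ctx loss π L T sel t z) ∂(H t) +
        ∫ z, epochGap L M (historyState ctx loss π L T sel t z).epoch ∂(H t) ≤
        ∫ z, potential L δ M (t + 1) (historyState ctx loss π L T sel (t + 1) z)
          ∂(H (t + 1)) := by
      have hm : ∀ g : State ι → ℝ, Measurable fun z : Fin t → Round 𝓧 𝓛 =>
          g (historyState ctx loss π L T sel t z) := fun g =>
        measurable_from_top.comp (measurable_historyState hloss hπ t)
      -- The quantities at time `t` are viewed as functions of the first `t` of `t + 1` rounds, so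
      -- that the pathwise inequality can be integrated against a single law.
      rw [← integral_add hi2 hi3, hH, ← integral_castSucc hsel hL hT hN t
        (f := fun z => potential L δ M t (historyState ctx loss π L T sel t z) +
          epochGap L M (historyState ctx loss π L T sel t z).epoch)
        ((hm (potential L δ M t)).add (hm fun st => epochGap L M st.epoch))
        (totalGap L δ M + 14 * L) fun z =>
          (abs_add_le _ _).trans (add_le_add (hpot t z) (hgap t z)), ← hH]
      refine integral_mono_of_nonneg (Filter.Eventually.of_forall fun z => ?_) hi5
        (Filter.Eventually.of_forall fun z => ?_)
      · exact add_nonneg (potential_nonneg hL δ M (hreach t _).2.1) (epochGap_nonneg hL M _)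
      · exact potential_step hπ hL hT hN M t fun j => observe loss (z j)
    rw [Finset.sum_range_succ]
    push_cast
    linarith

end Regret

/-! ### Choice of the cut-off -/

/-- As `1/3 ≤ 1/e`, the factor `5` in the number of batches gives `(T N) ^ (-5)`. This absorbs the
`N` of the union over policies and the `T³` of the union over rounds. -/
lemma cube_mul_pow_numBatches_le_one {T N : ℕ} (hT : 2 ≤ T) (hN : 2 ≤ N) :
    (T : ℝ) ^ 3 * (N * (1 / 3) ^ numBatches T N) ≤ 1 := by
  have hT' : (1 : ℝ) ≤ T := by exact_mod_cast (by omega : 1 ≤ T)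
  have hN' : (1 : ℝ) ≤ N := by exact_mod_cast (by omega : 1 ≤ N)
  have h1 : (1 / 3 : ℝ) ^ numBatches T N ≤ ((T * N : ℝ)⁻¹) ^ 5 := by
    unfold numBatches
    rw [mul_comm, pow_mul]
    gcongr
    set c := ⌈Real.log (T * N * Real.logb 2 T)⌉₊ with hc
    calc (1 / 3 : ℝ) ^ c ≤ (Real.exp (-1)) ^ c := by
          gcongr
          rw [Real.exp_neg, one_div]
          exact inv_anti₀ (Real.exp_pos 1) (Real.exp_one_lt_three).le
      _ = Real.exp (-c) := by rw [← Real.exp_nat_mul]; ring_nf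
      _ ≤ Real.exp (-Real.log (T * N)) := by
          gcongr
          exact log_le_ceil_log hT hN
      _ = (T * N : ℝ)⁻¹ := by rw [Real.exp_neg, Real.exp_log (by positivity)]
  have hT0 : (0 : ℝ) < T := by linarith
  have hN0 : (0 : ℝ) < N := by linarith
  calc (T : ℝ) ^ 3 * (N * (1 / 3) ^ numBatches T N)
      ≤ (T : ℝ) ^ 3 * (N * ((T * N : ℝ)⁻¹) ^ 5) := by gcongr
    _ = ((T : ℝ)⁻¹) ^ 2 * ((N : ℝ)⁻¹) ^ 4 := by field_simp
    _ ≤ 1 * 1 := by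
        gcongr
        · exact pow_le_one₀ (by positivity) (inv_le_one_of_one_le₀ hT')
        · exact pow_le_one₀ (by positivity) (inv_le_one_of_one_le₀ hN')
    _ = 1 := one_mul 1

lemma numBatches_le {T N : ℕ} (hT : 2 ≤ T) (hN : 2 ≤ N) :
    (numBatches T N : ℝ) ≤ 40 * Real.log T * Real.log N := by
  have hT' : (2 : ℝ) ≤ T := by exact_mod_cast hT
  have hN' : (2 : ℝ) ≤ N := by exact_mod_cast hN
  have hlog2 := Real.log_two_gt_d9
  have hu : Real.log 2 ≤ Real.log T := Real.log_le_log (by norm_num) hT'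
  have hv : Real.log 2 ≤ Real.log N := Real.log_le_log (by norm_num) hN'
  have hb := one_le_logb_two hT
  have h1 : Real.logb 2 T ≤ 2 * Real.log T := by
    unfold Real.logb
    rw [div_le_iff₀ (by linarith)]
    nlinarith
  -- The `-1` from `log x ≤ x - 1` cancels the `+1` from rounding up. What remains, `5 (3 log T +
  -- log N)`, is at most `40 log T log N` because both logarithms are at least `log 2`.
  have h2 : Real.log (Real.logb 2 T) ≤ 2 * Real.log T - 1 :=
    (Real.log_le_sub_one_of_pos (by linarith)).trans (by linarith)
  have h3 : Real.log (T * N * Real.logb 2 T) =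
      Real.log T + Real.log N + Real.log (Real.logb 2 T) := by
    rw [Real.log_mul (by positivity) (by linarith), Real.log_mul (by positivity) (by positivity)]
  have h4 : 0 ≤ Real.log (T * N * Real.logb 2 T) := by
    refine Real.log_nonneg ?_
    nlinarith [mul_le_mul hT' hN' (by norm_num) (by linarith)]
  have h5 := Nat.ceil_lt_add_one h4
  unfold numBatches
  push_cast
  nlinarith

/-- Epoch `m` costs its radius times its length: the main term grows like `4^m` and is dominated by
the last epoch, while rounding the batch size up gives a geometric series of order `L δ`. The
constants come from `4480 = 14 · 320` and `4480 · 4/3 ≤ 6000`; the extra summand `m = 0` is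
harmless. -/
lemma totalGap_le {L : ℝ} (hL : 1 ≤ L) (δ M : ℕ) :
    totalGap L δ M ≤ 6000 * (4 ^ M * δ / L) + 28 * (L * δ) := by
  have hL0 : 0 < L := by linarith
  have hterm : ∀ m : ℕ, 14 * radius L m * epochCap L δ m ≤
      4480 * (δ / L) * 4 ^ m + 14 * (L * δ) * (1 / 2) ^ m := by
    intro m
    have h1 : ((⌈320 / (radius L m ^ 2 * bandwidth m)⌉₊ : ℕ) : ℝ) ≤
        320 / (radius L m ^ 2 * bandwidth m) + 1 := by
      have := radius_pos hL m
      have := bandwidth_pos m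
      exact (Nat.ceil_lt_add_one (by positivity)).le
    have hr := radius_pos hL m
    unfold epochCap
    push_cast
    calc 14 * radius L m * ((⌈320 / (radius L m ^ 2 * bandwidth m)⌉₊ : ℝ) * δ)
        ≤ 14 * radius L m * ((320 / (radius L m ^ 2 * bandwidth m) + 1) * δ) := by gcongr
      _ = 4480 * (δ / L) * 4 ^ m + 14 * (L * δ) * (1 / 2) ^ m := by
          unfold radius bandwidth
          have h4 : (4 : ℝ) ^ m = 2 ^ m * 2 ^ m := by rw [← mul_pow]; norm_num
          rw [one_div, inv_pow, h4]
          field_simp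
          ring
  have hg1 : ∑ m ∈ Finset.range (M + 1), (4 : ℝ) ^ m ≤ 4 / 3 * 4 ^ M := by
    rw [geom_sum_eq (by norm_num), pow_succ]
    have : (0 : ℝ) < 4 ^ M := by positivity
    linarith
  have hg2 : ∑ m ∈ Finset.range (M + 1), (1 / 2 : ℝ) ^ m ≤ 2 := by
    have h1 : (0 : ℝ) < (1 / 2) ^ (M + 1) := by positivity
    have h2 : ((1 / 2 : ℝ) ^ (M + 1) - 1) / (1 / 2 - 1) = 2 - 2 * (1 / 2) ^ (M + 1) := by ring
    rw [geom_sum_eq (by norm_num), h2]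
    linarith
  have hδ : (0 : ℝ) ≤ δ := Nat.cast_nonneg δ
  calc totalGap L δ M ≤ ∑ m ∈ Finset.range (M + 1),
        (4480 * (δ / L) * 4 ^ m + 14 * (L * δ) * (1 / 2) ^ m) :=
        Finset.sum_le_sum fun m _ => hterm m
    _ = 4480 * (δ / L) * ∑ m ∈ Finset.range (M + 1), (4 : ℝ) ^ m +
        14 * (L * δ) * ∑ m ∈ Finset.range (M + 1), (1 / 2 : ℝ) ^ m := by
        rw [Finset.sum_add_distrib, ← Finset.mul_sum, ← Finset.mul_sum]
    _ ≤ 4480 * (δ / L) * (4 / 3 * 4 ^ M) + 14 * (L * δ) * 2 := by gcongr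
    _ = 17920 / 3 * (4 ^ M * δ / L) + 28 * (L * δ) := by ring
    _ ≤ _ := by
        gcongr
        norm_num

/-- The two costs balance when `2^M` is about `L a / b`, so `M` is its binary logarithm rounded
down. The condition `b ≤ a` ensures that this quantity is at least `1`. -/
lemma exists_cutoff {a b L δ T : ℝ} (ha : 0 < a) (hb : 0 < b) (hL : 1 ≤ L)
    (haT : a ^ 3 = T) (hbδ : b ^ 3 = L * δ) (hba : b ≤ a) :
    ∃ M : ℕ, 4 ^ M * δ / L ≤ a ^ 2 * b ∧ T * radius L (M + 1) ≤ a ^ 2 * b := by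
  have hL0 : 0 < L := by linarith
  have hy : 1 ≤ L * (a / b) := by
    have : 1 ≤ a / b := (one_le_div hb).2 hba
    nlinarith
  obtain ⟨M, hM1, hM2⟩ := exists_nat_pow_near hy (by norm_num : (1 : ℝ) < 2)
  refine ⟨M, ?_, ?_⟩
  · have h1 : (4 : ℝ) ^ M = (2 ^ M) ^ 2 := by rw [← pow_mul, mul_comm, pow_mul]; norm_num
    have h2 : δ = b ^ 3 / L := by rw [hbδ]; field_simp
    have h3 : ((2 : ℝ) ^ M) ^ 2 ≤ (L * (a / b)) ^ 2 := by gcongr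
    rw [h1, h2]
    calc ((2 : ℝ) ^ M) ^ 2 * (b ^ 3 / L) / L ≤ (L * (a / b)) ^ 2 * (b ^ 3 / L) / L := by gcongr
      _ = a ^ 2 * b := by field_simp
  · rw [← haT]
    unfold radius
    rw [one_div, inv_pow]
    have h1 : ((2 : ℝ) ^ (M + 1))⁻¹ ≤ (L * (a / b))⁻¹ := inv_anti₀ (by positivity) hM2.le
    calc a ^ 3 * (L * ((2 : ℝ) ^ (M + 1))⁻¹) ≤ a ^ 3 * (L * (L * (a / b))⁻¹) := by gcongr
      _ = a ^ 2 * b := by field_simp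

/-! ### Assembling the rate -/

section Regret

variable {𝓧 : Type u} [MeasurableSpace 𝓧] {𝓛 : Type v} [MeasurableSpace 𝓛]
  {ι : Type w} [Fintype ι] {ctx : Measure 𝓧} [IsProbabilityMeasure ctx]
  {lossLaw : Kernel 𝓧 𝓛} [IsMarkovKernel lossLaw] {loss : 𝓛 → I → I}
  {hloss : Measurable (Function.uncurry loss)} {π : ι → 𝓧 → I} {hπ : ∀ i, Measurable (π i)}
  {L : ℝ} {T : ℕ} {sel : ℕ → Finset ι → ι → ℝ}

lemma regret_le_horizon (hsel : IsOptimalSelection ctx π L sel) (hL : 1 ≤ L)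
    (hT : 2 ≤ T) (hN : 2 ≤ Fintype.card ι) :
    regret ctx lossLaw loss hloss π hπ L T sel ≤ T := by
  have hprob := isProbabilityMeasure_historyLaw (lossLaw := lossLaw) (hloss := hloss) (hπ := hπ)
    hsel hL hT hN T
  have h1 : ∫ z, ∑ j, (loss (z j).1.2 (z j).2 : ℝ)
      ∂(historyLaw ctx lossLaw loss hloss π hπ L T sel T) ≤ T := by
    calc _ ≤ ∫ _, (T : ℝ) ∂(historyLaw ctx lossLaw loss hloss π hπ L T sel T) :=
          integral_mono (integrable_of_abs_le (measurable_totalLoss hloss T) _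
            (abs_totalLoss_le T)) (integrable_const _)
            fun z => (le_abs_self _).trans (abs_totalLoss_le T z)
      _ = T := by simp
  have h2 : 0 ≤ (T : ℝ) * bench ctx lossLaw loss π :=
    mul_nonneg (Nat.cast_nonneg _) (Real.iInf_nonneg fun i => policyLoss_nonneg i)
  unfold regret
  linarith

lemma sum_measure_not_good_le (hsel : IsOptimalSelection ctx π L sel) (hL : 1 ≤ L)
    (hT : 2 ≤ T) (hN : 2 ≤ Fintype.card ι)
    (hlip : ∀ x : 𝓧, ∀ a a' : I,
      |(∫ ω, (loss ω a : ℝ) ∂(lossLaw x)) - ∫ ω, (loss ω a' : ℝ) ∂(lossLaw x)|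
        ≤ L * dist a a') {i₀ : ι}
    (hi₀ : ∀ i, policyLoss ctx lossLaw loss (π i₀) ≤ policyLoss ctx lossLaw loss (π i)) :
    ∑ s ∈ Finset.range T, (historyLaw ctx lossLaw loss hloss π hπ L T sel s).real
      {z | ¬ (historyState ctx loss π L T sel s z).Good ctx lossLaw loss π L i₀} ≤ 1 := by
  set N := Fintype.card ι with hNd
  have hterm : ∀ s ∈ Finset.range T, (historyLaw ctx lossLaw loss hloss π hπ L T sel s).real
      {z | ¬ (historyState ctx loss π L T sel s z).Good ctx lossLaw loss π L i₀} ≤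
      (T : ℝ) ^ 2 * (N * (1 / 3) ^ numBatches T N) := by
    intro s hs
    have h1 := measure_not_good_le (hloss := hloss) (hπ := hπ) hsel hL hT hN hlip hi₀ s
    have h2 : ((s ^ 2 : ℕ) * (N * ENNReal.ofReal ((1 / 3) ^ numBatches T N)) : ℝ≥0∞) =
        ENNReal.ofReal ((s : ℝ) ^ 2 * (N * (1 / 3) ^ numBatches T N)) := by
      rw [ENNReal.ofReal_mul (by positivity), ENNReal.ofReal_mul (by positivity),
        ENNReal.ofReal_natCast, ← Nat.cast_pow, ENNReal.ofReal_natCast]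
    rw [← hNd, h2] at h1
    refine (ENNReal.toReal_le_of_le_ofReal (by positivity) h1).trans ?_
    have h3 : (s : ℝ) ≤ T := by exact_mod_cast (Finset.mem_range.1 hs).le
    gcongr
  calc _ ≤ ∑ s ∈ Finset.range T, (T : ℝ) ^ 2 * (N * (1 / 3) ^ numBatches T N) :=
        Finset.sum_le_sum hterm
    _ = (T : ℝ) ^ 3 * (N * (1 / 3) ^ numBatches T N) := by
        rw [Finset.sum_const, Finset.card_range, nsmul_eq_mul]; ring
    _ ≤ 1 := cube_mul_pow_numBatches_le_one hT hN

lemma regret_le_totalGap (hsel : IsOptimalSelection ctx π L sel) (hL : 1 ≤ L)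
    (hT : 2 ≤ T) (hN : 2 ≤ Fintype.card ι)
    (hlip : ∀ x : 𝓧, ∀ a a' : I,
      |(∫ ω, (loss ω a : ℝ) ∂(lossLaw x)) - ∫ ω, (loss ω a' : ℝ) ∂(lossLaw x)|
        ≤ L * dist a a') (M : ℕ) :
    regret ctx lossLaw loss hloss π hπ L T sel ≤
      totalGap L (numBatches T (Fintype.card ι)) M + 14 * (T * radius L (M + 1)) + 1 := by
  have hne : Nonempty ι := Fintype.card_pos_iff.1 (by omega)
  obtain ⟨i₀, hi₀⟩ := exists_eq_ciInf_of_finite (f := fun i => policyLoss ctx lossLaw loss (π i))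
  have hmin : ∀ i, policyLoss ctx lossLaw loss (π i₀) ≤ policyLoss ctx lossLaw loss (π i) :=
    fun i => hi₀.le.trans (ciInf_le (Set.finite_range _).bddBelow i)
  have hprob := isProbabilityMeasure_historyLaw (lossLaw := lossLaw) (hloss := hloss) (hπ := hπ)
    hsel hL hT hN T
  have h1 := integral_totalLoss_le (i₀ := i₀) (hloss := hloss) (hπ := hπ) hsel hL hT hN hlip M T
  have h2 := sum_measure_not_good_le (hloss := hloss) (hπ := hπ) hsel hL hT hN hlip hmin
  have h3 : ∫ z, potential L (numBatches T (Fintype.card ι)) M T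
      (historyState ctx loss π L T sel T z)
      ∂(historyLaw ctx lossLaw loss hloss π hπ L T sel T) ≤
      totalGap L (numBatches T (Fintype.card ι)) M := by
    calc _ ≤ ∫ _, totalGap L (numBatches T (Fintype.card ι)) M
          ∂(historyLaw ctx lossLaw loss hloss π hπ L T sel T) := by
          refine integral_mono_of_nonneg (Filter.Eventually.of_forall fun z => ?_)
            (integrable_const _) (Filter.Eventually.of_forall fun z => ?_)
          · exact potential_nonneg hL _ M (historyState_reachable hπ hL hT hN T z).2.1
          · exact potential_le hπ hL M (historyState_reachable hπ hL hT hN T z).2.2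
      _ = _ := by simp
  have h4 : bench ctx lossLaw loss π = policyLoss ctx lossLaw loss (π i₀) := hi₀.symm
  unfold regret
  rw [h4]
  linarith

/-- With `a = T^{1/3}` and `b = (L δ)^{1/3}` the target is `a² b`. If `a ≤ b` it already exceeds the
trivial bound `T = a³`; otherwise the cut-off applies, and `L δ = b³ ≤ a² b` absorbs the rounding
term. The constant is `6000 + 28 + 14 + 1`. -/
lemma regret_le_rate (hsel : IsOptimalSelection ctx π L sel) (hL : 1 ≤ L)
    (hT : 2 ≤ T) (hN : 2 ≤ Fintype.card ι)
    (hlip : ∀ x : 𝓧, ∀ a a' : I,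
      |(∫ ω, (loss ω a : ℝ) ∂(lossLaw x)) - ∫ ω, (loss ω a' : ℝ) ∂(lossLaw x)|
        ≤ L * dist a a') :
    regret ctx lossLaw loss hloss π hπ L T sel ≤
      6043 * ((T : ℝ) ^ (2 / 3 : ℝ) *
        (L * numBatches T (Fintype.card ι)) ^ (1 / 3 : ℝ)) := by
  set δ := numBatches T (Fintype.card ι) with hδ
  have hT1 : (1 : ℝ) ≤ T := by exact_mod_cast (by omega : 1 ≤ T)
  have hδ1 : (1 : ℝ) ≤ δ := by exact_mod_cast numBatches_pos hT hN
  have hLδ : 1 ≤ L * δ := by nlinarith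
  set a := (T : ℝ) ^ (1 / 3 : ℝ) with ha
  set b := (L * δ) ^ (1 / 3 : ℝ) with hb
  have ha1 : 1 ≤ a := Real.one_le_rpow hT1 (by norm_num)
  have hb1 : 1 ≤ b := Real.one_le_rpow hLδ (by norm_num)
  have ha3 : a ^ 3 = T := by
    rw [ha, ← Real.rpow_natCast, ← Real.rpow_mul (by linarith)]; norm_num
  have hb3 : b ^ 3 = L * δ := by
    rw [hb, ← Real.rpow_natCast, ← Real.rpow_mul (by linarith)]; norm_num
  have ha2 : (T : ℝ) ^ (2 / 3 : ℝ) = a ^ 2 := by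
    rw [ha, ← Real.rpow_natCast, ← Real.rpow_mul (by linarith)]; norm_num
  rw [ha2]
  have hX : 1 ≤ a ^ 2 * b := by nlinarith
  rcases le_total a b with hab | hab
  · have h1 := regret_le_horizon (lossLaw := lossLaw) (hloss := hloss) (hπ := hπ) hsel hL hT hN
    have h2 : a ^ 3 ≤ a ^ 2 * b := by rw [pow_succ]; gcongr
    rw [ha3] at h2
    linarith
  · obtain ⟨M, hM1, hM2⟩ := exists_cutoff (by linarith) (by linarith) hL ha3 hb3 hab
    have h1 := regret_le_totalGap (hloss := hloss) (hπ := hπ) hsel hL hT hN hlip M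
    have h2 := totalGap_le hL δ M
    have h3 : L * δ ≤ a ^ 2 * b := by
      rw [← hb3, pow_succ]
      gcongr
    linarith

end Regret

end SmoothPE

theorem corollary6 :
    ∃ (C : ℝ) (p : ℕ),
      ∀ (𝓧 : Type u) [MeasurableSpace 𝓧] (𝓛 : Type v) [MeasurableSpace 𝓛]
        (ι : Type w) [Fintype ι]
        (ctx : Measure 𝓧) [IsProbabilityMeasure ctx]
        (lossLaw : Kernel 𝓧 𝓛) [IsMarkovKernel lossLaw]
        (loss : 𝓛 → I → I) (hloss : Measurable (Function.uncurry loss))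
        (π : ι → 𝓧 → I) (hπ : ∀ i, Measurable (π i))
        (L : ℝ),
        2 ≤ Fintype.card ι → 1 ≤ L →
        (∀ x : 𝓧, ∀ a a' : I,
          |(∫ ω, (loss ω a : ℝ) ∂(lossLaw x)) - ∫ ω, (loss ω a' : ℝ) ∂(lossLaw x)|
            ≤ L * dist a a') →
        (∀ Q : ℕ → Finset ι → ι → ℝ, SmoothPE.IsOptimalSelection ctx π L Q →
          ∀ T : ℕ, 2 ≤ T →
            SmoothPE.regret ctx lossLaw loss hloss π hπ L T Q ≤
              C * Real.log T ^ p *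
                ((T : ℝ) ^ (2 / 3 : ℝ) *
                  (L * Real.log (Fintype.card ι)) ^ (1 / 3 : ℝ))) ∧
        (∀ ε₀ : ℝ, 0 < ε₀ → ε₀ ≤ 1 →
          SmoothPE.zoomingCoefficient ctx lossLaw loss π L ε₀ ≤
            ENNReal.ofReal (C / ε₀ ^ 2)) := by
  -- `241720 = 6043 · 40`, with `40` from `numBatches_le`. One power of `log T` suffices, since `40
  -- log T ≥ 1` allows its cube root to be replaced by itself.
  refine ⟨241720, 1, ?_⟩
  intro 𝓧 _ 𝓛 _ ι _ ctx _ lossLaw _ loss hloss π hπ L hN hL hlip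
  refine ⟨fun Q hQ T hT => ?_, fun ε₀ h0 h1 => ?_⟩
  · refine (SmoothPE.regret_le_rate hQ hL hT hN hlip).trans ?_
    have hL0 : 0 ≤ L := by linarith
    have hT' : (2 : ℝ) ≤ T := by exact_mod_cast hT
    have hN' : (1 : ℝ) ≤ Fintype.card ι := by exact_mod_cast (by omega : 1 ≤ Fintype.card ι)
    have hlogN : 0 ≤ Real.log (Fintype.card ι) := Real.log_nonneg hN'
    have hlogT : 1 ≤ 40 * Real.log T := by
      have h2 := Real.log_two_gt_d9
      have h3 : Real.log 2 ≤ Real.log T := Real.log_le_log (by norm_num) hT'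
      linarith
    have hroot : (L * SmoothPE.numBatches T (Fintype.card ι)) ^ (1 / 3 : ℝ) ≤
        40 * Real.log T * (L * Real.log (Fintype.card ι)) ^ (1 / 3 : ℝ) := by
      calc (L * (SmoothPE.numBatches T (Fintype.card ι) : ℝ)) ^ (1 / 3 : ℝ)
          ≤ (40 * Real.log T * (L * Real.log (Fintype.card ι))) ^ (1 / 3 : ℝ) := by
            refine Real.rpow_le_rpow (by positivity) ?_ (by norm_num)
            have h2 := mul_le_mul_of_nonneg_left (SmoothPE.numBatches_le hT hN) hL0
            linarith
        _ = (40 * Real.log T) ^ (1 / 3 : ℝ) *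
            (L * Real.log (Fintype.card ι)) ^ (1 / 3 : ℝ) :=
            Real.mul_rpow (by linarith) (by positivity)
        _ ≤ (40 * Real.log T) ^ (1 : ℝ) *
            (L * Real.log (Fintype.card ι)) ^ (1 / 3 : ℝ) := by
            gcongr ?_ * _
            exact Real.rpow_le_rpow_of_exponent_le hlogT (by norm_num)
        _ = _ := by rw [Real.rpow_one]
    have hT0 : (0 : ℝ) ≤ (T : ℝ) ^ (2 / 3 : ℝ) := by positivity
    have h2 := mul_le_mul_of_nonneg_left hroot hT0
    linarith
  · refine (SmoothPE.zoomingCoefficient_le ctx lossLaw loss π L h0 h1).trans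
      (ENNReal.ofReal_le_ofReal ?_)
    gcongr
    norm_num
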